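/- \textbf{Theorem (Discrete method in the strong symmetry case).} \emph{Geometry.} Let $\widehat\Omega=(0,1)^2$ and let $F:\widehat\Omega\to\Omega:=F(\widehat\Omega)\subset\mathbb R^2$ be a bijection with $F\in C^3(\overline{\widehat\Omega})$ and $F^{-1}\in C^3(\overline\Omega)$. Put $J=DF$ and $\tilde J=\operatorname{adj}J$; by $\tilde J^{-1}$ we also denote the field $\tilde J^{-1}\circ F^{-1}$ on $\Omega$. Write $\hat\partial_i$ and $\partial_i$ for derivatives with respect to parametric and physical coordinates, $\int_0^{\zeta_i}g\,di$ for the primitive of $g$ in the $i$-th parametric variable, $\widehat{\mathrm{Airy}}(\phi)=\begin{pmatrix}\hat\partial_{22}\phi&-\hat\partial_{12}\phi\\-\hat\partial_{21}\phi&\hat\partial_{11}\phi\end{pmatrix}$ and $\sigma(n)=3-n$. Repeated indices are summed over $\{1,2\}$, $\mathbb S$ denotes the symmetric matrices in $\mathbb R^{2\times2}$, and $\langle\cdot,\cdot\rangle$ is the $L^2$ inner product. $H(\Omega,\mathrm{div},\mathbb S)$ is the space of $\tau\in L^2(\Omega,\mathbb S)$ whose weak row-wise divergence lies in $L^2(\Omega)^2$,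 with $\|\tau\|_{H(\mathrm{div})}^2=\|\tau\|_{L^2}^2+\|\nabla\cdot\tau\|_{L^2}^2$. \emph{Transforms.} For $S\in L^2(\Omega,\mathbb S)$ and $v\in L^2(\Omega)^2$ let $$\mathcal Y_{2,\Gamma_1}^s(S)=\tilde J\,(S\circ F)\,\tilde J^T+\widehat{\mathrm{Airy}}(F_n)\int_0^{\zeta_1}(-1)^{n+1}\tilde J_{2l}\,(S_{\sigma(n)l}\circ F)\,d1,$$ $$\mathcal Y_3^s(v)=\det(J)\,\tilde J\,(v\circ F)+\hat\partial_1\tilde J\int_0^{\zeta_1}\det(J)\,(v\circ F)\,d1,$$ which are bijections onto $L^2(\widehat\Omega,\mathbb S)$ and $L^2(\widehat\Omega)^2$, respectively. For $\tilde S:\widehat\Omega\to\mathbb S$ continuous up to the edge $\zeta_1=0$ and piecewise smooth set $$T(\tilde S)_m=\partial_k\tilde J^{-1}_{mi}\;\tilde J^{-1}_{k1}\;\bigl(\tilde S_{i1}(0,\cdot)\circ F^{-1}\bigr),$$ $$\tilde{\mathcal Y}_2^s(\tilde S)=(\mathcal Y_{2,\Gamma_1}^s)^{-1}(\tilde S)-(\mathcal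 Y_{2,\Gamma_1}^s)^{-1}\begin{pmatrix}\int_0^{\zeta_1}[\mathcal Y_3^s(T(\tilde S))]_1\,d1&0\\0&\int_0^{\zeta_2}[\mathcal Y_3^s(T(\tilde S))]_2\,d2\end{pmatrix}.$$ \emph{Discrete spaces.} Let $p>r\ge1$ be integers. In each of the two coordinate directions let a finite non-decreasing family of interior knots in $(0,1)$ be given in which no knot is repeated more than $p-r$ times. For $q\in\{p-1,p,p+1\}$ let $S_q^{\,q-p+r}$ be the span of the B-splines of degree $q$ for the $q$-open knot vector on $[0,1]$ with these interior knots, and let $S_{q_1,q_2}^{\rho_1,\rho_2}=S_{q_1}^{\rho_1}\otimes S_{q_2}^{\rho_2}$ (first factor with the knots of the first direction, second factor with those of the second). Define $$\widehat{\mathcal V}_{h,2}^s=\Bigl\{\begin{pmatrix}s_1&s_2\\s_2&s_3\end{pmatrix}: s_1\in S_{p+1,p-1}^{r+1,r-1},\ s_2\in S_{p,p}^{r,r},\ s_3\in S_{p-1,p+1}^{r-1,r+1}\Bigr\},\qquad \widehat V_{h,3}^s=S_{p,p-1}^{r,r-1}\times S_{p-1,p}^{r-1,r},$$ $$\mathcal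 V_{h,2}^s=\tilde{\mathcal Y}_2^s(\widehat{\mathcal V}_{h,2}^s),\qquad V_{h,3}^s=(\mathcal Y_3^s)^{-1}(\widehat V_{h,3}^s).$$ \emph{Material.} Let $A(x):\mathbb S\to\mathbb S$, $x\in\Omega$, be a measurable field of linear maps that is bounded, symmetric and uniformly positive definite. \emph{Claim.} Then $\mathcal V_{h,2}^s\subset H(\Omega,\mathrm{div},\mathbb S)$ and $V_{h,3}^s\subset L^2(\Omega)^2$, and the discretized Hellinger--Reissner problem with Dirichlet data $u_D\in H^{1/2}(\partial\Omega)^2$ and load $f\in L^2(\Omega)^2$ --- find $\sigma_h\in\mathcal V_{h,2}^s$, $u_h\in V_{h,3}^s$ with $\langle A\sigma_h,\tau_h\rangle+\langle u_h,\nabla\cdot\tau_h\rangle=\langle\tau_h\cdot n;u_D\rangle_{\partial\Omega}$ for all $\tau_h\in\mathcal V_{h,2}^s$ and $\langle\nabla\cdot\sigma_h,v_h\rangle=\langle f,v_h\rangle$ for all $v_h\in V_{h,3}^s$ --- is inf-sup stable in the following sense: there are constants $\gamma_1>0$, depending only on $F,p,r$, and $\gamma_2>0$, depending only on $F,p,r,A$,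 both independent of the knots (in particular of the mesh size $h$), such that $$\inf_{v_h\in V_{h,3}^s\setminus\{0\}}\ \sup_{\tau_h\in\mathcal V_{h,2}^s}\frac{\langle\nabla\cdot\tau_h,v_h\rangle}{\|\tau_h\|_{H(\mathrm{div})}\,\|v_h\|_{L^2}}\ \ge\ \gamma_1$$ (the quotient being read as $0$ for $\tau_h=0$) and $$\langle A\tau_h,\tau_h\rangle\ \ge\ \gamma_2\,\|\tau_h\|_{H(\mathrm{div})}^2\qquad\text{for all }\tau_h\in B_h:=\{\tau_h\in\mathcal V_{h,2}^s:\ \langle\nabla\cdot\tau_h,v_h\rangle=0\ \ \forall\,v_h\in V_{h,3}^s\}.$$ -/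

import Mathlib

open scoped Matrix ContDiff

noncomputable section

namespace StrongSym

/-- Points of the plane (with Lebesgue measure). -/
abbrev Pt := Fin 2 → ℝ

/-- Matrices in `ℝ^{2×2}`. -/
abbrev Mat := Matrix (Fin 2) (Fin 2) ℝ

/-- The partial derivative `∂_k f` (indices `0, 1` instead of `1, 2`). -/
def pd (k : Fin 2) (f : Pt → ℝ) (x : Pt) : ℝ := fderiv ℝ f x (Pi.single k 1)

/-! ### Function spaces, inner products and norms -/

/-- `v ∈ L²(D)²`. -/
def MemL2 (D : Set Pt) (v : Pt → Fin 2 → ℝ) : Prop :=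
  ∀ i, MeasureTheory.MemLp (fun x => v x i) 2 (MeasureTheory.volume.restrict D)

/-- `τ ∈ L²(D, 𝕊)`: square-integrable symmetric matrix fields. -/
def MemL2Sym (D : Set Pt) (τ : Pt → Mat) : Prop :=
  (∀ i j, MeasureTheory.MemLp (fun x => τ x i j) 2 (MeasureTheory.volume.restrict D)) ∧
    ∀ᵐ x ∂(MeasureTheory.volume.restrict D), (τ x).IsSymm

/-- The `L²(D)` inner product of vector fields. -/
def innerVec (D : Set Pt) (u v : Pt → Fin 2 → ℝ) : ℝ :=
  ∫ x in D, ∑ i, u x i * v x i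

/-- The `L²(D)` inner product of matrix fields. -/
def innerMat (D : Set Pt) (σ τ : Pt → Mat) : ℝ :=
  ∫ x in D, ∑ i, ∑ j, σ x i j * τ x i j

/-- The `L²(D)` norm of a vector field. -/
def normL2 (D : Set Pt) (v : Pt → Fin 2 → ℝ) : ℝ := Real.sqrt (innerVec D v v)

/-- `d` is the weak (distributional) row-wise divergence of `τ` in `D`. -/
def HasWeakDiv (D : Set Pt) (τ : Pt → Mat) (d : Pt → Fin 2 → ℝ) : Prop :=
  ∀ φ : Pt → ℝ, ContDiff ℝ ∞ φ → HasCompactSupport φ → tsupport φ ⊆ D →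
    ∀ i, ∫ x in D, d x i * φ x = - ∫ x in D, ∑ j, τ x i j * pd j φ x

/-- `τ ∈ H(D, div, 𝕊)`. -/
def MemHdivSym (D : Set Pt) (τ : Pt → Mat) : Prop :=
  MemL2Sym D τ ∧ ∃ d, MemL2 D d ∧ HasWeakDiv D τ d

open Classical in
/-- The weak divergence `∇ · τ ∈ L²(D)²` (zero if there is none); it is unique up to a.e.
equality. -/
def weakDiv (D : Set Pt) (τ : Pt → Mat) : Pt → Fin 2 → ℝ :=
  if h : ∃ d, MemL2 D d ∧ HasWeakDiv D τ d then h.choose else 0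

/-- `‖τ‖_{H(div)} = (‖τ‖²_{L²} + ‖∇ · τ‖²_{L²})^{1/2}`. -/
def normHdiv (D : Set Pt) (τ : Pt → Mat) : ℝ :=
  Real.sqrt (innerMat D τ τ + innerVec D (weakDiv D τ) (weakDiv D τ))

/-! ### B-splines -/

/-- The interior knots (in one coordinate direction, with repetitions): a non-decreasing list of
numbers in `(0,1)` in which no number occurs more than `m` times. -/
structure InteriorKnots (m : ℕ) where
  knots : List ℝ
  sorted : knots.Pairwise (· ≤ ·)
  mem_Ioo : ∀ x ∈ knots, 0 < x ∧ x < 1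
  count_le : ∀ x, knots.count x ≤ m

/-- The `q`-open knot vector with the given interior knots (indices start at `0`). -/
def openKnot (q : ℕ) (L : List ℝ) (j : ℕ) : ℝ :=
  (List.replicate (q + 1) (0 : ℝ) ++ L ++ List.replicate (q + 1) (1 : ℝ)).getD j 1

/-- The Cox–de Boor recursion (with `0 / 0 = 0`). -/
def bspline (ξ : ℕ → ℝ) : ℕ → ℕ → ℝ → ℝ
  | 0, j, x => Set.indicator (Set.Ico (ξ j) (ξ (j + 1))) (fun _ => 1) x
  | q + 1, j, x =>
      (x - ξ j) / (ξ (j + q + 1) - ξ j) * bspline ξ q j x +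
      (ξ (j + q + 2) - x) / (ξ (j + q + 2) - ξ (j + 1)) * bspline ξ q (j + 1) x

/-- The tensor-product spline space of degree `q₁` in the first and `q₂` in the second variable,
spanned by the products of the `n_l = |L_l| + q_l + 1` univariate B-splines. If interior knots have
multiplicity at most `m` these are the splines of regularity `q_l - m` in direction `l`. -/
def tensorSpline (q₁ q₂ : ℕ) (L₁ L₂ : List ℝ) : Submodule ℝ (Pt → ℝ) :=
  Submodule.span ℝ {f | ∃ i < L₁.length + q₁ + 1, ∃ j < L₂.length + q₂ + 1,
    f = fun ζ => bspline (openKnot q₁ L₁) q₁ i (ζ 0) * bspline (openKnot q₂ L₂) q₂ j (ζ 1)}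

/-- `SYM(S_{p+1,p-1}^{r+1,r-1}, S_{p,p}^{r,r}, S_{p-1,p+1}^{r-1,r+1})`, where `m = p - r`. -/
def paramStress (p : ℕ) {m : ℕ} (K₁ K₂ : InteriorKnots m) : Set (Pt → Mat) :=
  {τ | ∃ s₁ ∈ tensorSpline (p + 1) (p - 1) K₁.knots K₂.knots,
      ∃ s₂ ∈ tensorSpline p p K₁.knots K₂.knots,
      ∃ s₃ ∈ tensorSpline (p - 1) (p + 1) K₁.knots K₂.knots,
      τ = fun ζ => !![s₁ ζ, s₂ ζ; s₂ ζ, s₃ ζ]}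

/-- `S_{p,p-1}^{r,r-1} × S_{p-1,p}^{r-1,r}`, where `m = p - r`. -/
def paramDisp (p : ℕ) {m : ℕ} (K₁ K₂ : InteriorKnots m) : Set (Pt → Fin 2 → ℝ) :=
  {v | ∃ s₁ ∈ tensorSpline p (p - 1) K₁.knots K₂.knots,
      ∃ s₂ ∈ tensorSpline (p - 1) p K₁.knots K₂.knots,
      v = fun ζ => ![s₁ ζ, s₂ ζ]}

/-! ### Geometry -/

/-- The parametric domain `(0,1)²`. -/
def paramDomain : Set Pt := {ζ | ∀ i, 0 < ζ i ∧ ζ i < 1}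

/-- The physical domain `F((0,1)²)`. -/
def physDomain (F : Pt → Pt) : Set Pt := F '' paramDomain

/-- `F` is a single-patch parametrization with inverse `G`, and both are three times continuously
differentiable up to the boundary. -/
structure IsParametrization (F G : Pt → Pt) : Prop where
  contDiffOn : ContDiffOn ℝ 3 F (closure paramDomain)
  contDiffOn_inv : ContDiffOn ℝ 3 G (closure (physDomain F))
  left_inv : ∀ ζ ∈ paramDomain, G (F ζ) = ζ

/-- The Jacobian `J = DF`. -/
def jac (F : Pt → Pt) (ζ : Pt) : Mat := Matrix.of fun i j => pd j (fun ξ => F ξ i) ζ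

/-- The adjugate `J̃ = adj J`. -/
def adjJac (F : Pt → Pt) (ζ : Pt) : Mat := (jac F ζ).adjugate

/-- The inverse `J̃⁻¹` of the adjugate, as a matrix field on the physical domain. -/
def adjJacInv (F G : Pt → Pt) (x : Pt) : Mat := (adjJac F (G x))⁻¹

/-! ### The transforms -/

/-- `∫_0^{ζ₁} g d1`. -/
def int1 (g : Pt → ℝ) (ζ : Pt) : ℝ := ∫ t in (0 : ℝ)..(ζ 0), g ![t, ζ 1]

/-- `∫_0^{ζ₂} g d2`. -/
def int2 (g : Pt → ℝ) (ζ : Pt) : ℝ := ∫ t in (0 : ℝ)..(ζ 1), g ![ζ 0, t]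

/-- The Airy operator. -/
def airy (φ : Pt → ℝ) (ζ : Pt) : Mat :=
  !![pd 1 (pd 1 φ) ζ, - pd 0 (pd 1 φ) ζ; - pd 1 (pd 0 φ) ζ, pd 0 (pd 0 φ) ζ]

/-- The transform `Y_{2,Γ₁}^s`:
`J̃ (S ∘ F) J̃ᵀ + Airy(F_n) ∫_0^{ζ₁} (-1)^{n+1} J̃_{2l} (S_{σ(n)l} ∘ F) d1` (summed over `n`, `l`,
where `σ` swaps the two indices). -/
def Y2Γ (F : Pt → Pt) (S : Pt → Mat) (ζ : Pt) : Mat :=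
  adjJac F ζ * S (F ζ) * (adjJac F ζ)ᵀ +
    ∑ n : Fin 2,
      int1 (fun ξ => (-1) ^ (n : ℕ) * ∑ l, adjJac F ξ 1 l * S (F ξ) (Fin.rev n) l) ζ •
        airy (fun ξ => F ξ n) ζ

/-- The transform `Y_3^s`: `det(J) J̃ (v ∘ F) + ∂₁J̃ ∫_0^{ζ₁} det(J) (v ∘ F) d1`. -/
def Y3 (F : Pt → Pt) (v : Pt → Fin 2 → ℝ) (ζ : Pt) : Fin 2 → ℝ := fun i =>
  (jac F ζ).det * ∑ k, adjJac F ζ i k * v (F ζ) k +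
    ∑ k, pd 0 (fun ξ => adjJac F ξ i k) ζ * int1 (fun ξ => (jac F ξ).det * v (F ξ) k) ζ

/-- The inverse of `Y_{2,Γ₁}^s : L²(Ω, 𝕊) → L²((0,1)², 𝕊)`: a field in `L²(Ω, 𝕊)` which is mapped
to `W` (such a field is unique up to a.e. equality). -/
def Y2ΓInv (F : Pt → Pt) (W : Pt → Mat) : Pt → Mat :=
  Classical.epsilon fun S => MemL2Sym (physDomain F) S ∧
    Y2Γ F S =ᵐ[MeasureTheory.volume.restrict paramDomain] W

/-- The inverse of `Y_3^s : L²(Ω)² → L²((0,1)²)²`: a field in `L²(Ω)²` which is mapped to `w`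
(such a field is unique up to a.e. equality). -/
def Y3Inv (F : Pt → Pt) (w : Pt → Fin 2 → ℝ) : Pt → Fin 2 → ℝ :=
  Classical.epsilon fun v => MemL2 (physDomain F) v ∧
    Y3 F v =ᵐ[MeasureTheory.volume.restrict paramDomain] w

/-- `T(S)_m = ∂_k J̃⁻¹_{mi} J̃⁻¹_{k1} (S_{i1}(0,·) ∘ F⁻¹)` on the physical domain. -/
def T (F G : Pt → Pt) (S : Pt → Mat) (x : Pt) : Fin 2 → ℝ := fun m =>
  ∑ i, ∑ k, pd k (fun y => adjJacInv F G y m i) x * adjJacInv F G x k 0 * S ![0, G x 1] i 0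

/-- The transform `Ỹ_2^s(S) = (Y_{2,Γ₁}^s)⁻¹(S) - Ỹ_{2,A}^s(S)`, where
`Ỹ_{2,A}^s(S) = (Y_{2,Γ₁}^s)⁻¹(diag(∫_0^{ζ₁} [Y_3^s(T(S))]_1 d1, ∫_0^{ζ₂} [Y_3^s(T(S))]_2 d2))`. -/
def Y2Tilde (F G : Pt → Pt) (S : Pt → Mat) : Pt → Mat :=
  Y2ΓInv F S - Y2ΓInv F (fun ζ =>
    !![int1 (fun ξ => Y3 F (T F G S) ξ 0) ζ, 0; 0, int2 (fun ξ => Y3 F (T F G S) ξ 1) ζ])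

/-! ### The discrete problem -/

/-- The discrete stress space `V_{h,2}^s`. -/
def stressSpace (F G : Pt → Pt) (p : ℕ) {m : ℕ} (K₁ K₂ : InteriorKnots m) : Set (Pt → Mat) :=
  Y2Tilde F G '' paramStress p K₁ K₂

/-- The discrete displacement space `V_{h,3}^s`. -/
def dispSpace (F : Pt → Pt) (p : ℕ) {m : ℕ} (K₁ K₂ : InteriorKnots m) : Set (Pt → Fin 2 → ℝ) :=
  Y3Inv F '' paramDisp p K₁ K₂

/-- `A` is a compliance tensor field on `D`: a measurable field of linear maps `𝕊 → 𝕊` (given as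
linear maps on all matrices, only the action on symmetric ones being relevant) which is bounded,
symmetric and (uniformly) positive definite. -/
structure IsCompliance (D : Set Pt) (A : Pt → Mat →ₗ[ℝ] Mat) : Prop where
  measurable : ∀ M : Mat, M.IsSymm → ∀ i j,
    MeasureTheory.AEStronglyMeasurable (fun x => A x M i j) (MeasureTheory.volume.restrict D)
  isSymm : ∀ᵐ x ∂(MeasureTheory.volume.restrict D), ∀ M : Mat, M.IsSymm → (A x M).IsSymm
  bounded : ∃ C : ℝ, ∀ᵐ x ∂(MeasureTheory.volume.restrict D), ∀ M : Mat, M.IsSymm →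
    ∑ i, ∑ j, A x M i j ^ 2 ≤ C * ∑ i, ∑ j, M i j ^ 2
  selfAdjoint : ∀ᵐ x ∂(MeasureTheory.volume.restrict D), ∀ M N : Mat, M.IsSymm → N.IsSymm →
    ∑ i, ∑ j, A x M i j * N i j = ∑ i, ∑ j, M i j * A x N i j
  posDef : ∃ α : ℝ, 0 < α ∧ ∀ᵐ x ∂(MeasureTheory.volume.restrict D), ∀ M : Mat, M.IsSymm →
    α * ∑ i, ∑ j, M i j ^ 2 ≤ ∑ i, ∑ j, A x M i j * M i j

/-- The form `⟨A σ, τ⟩`. -/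
def formA (D : Set Pt) (A : Pt → Mat →ₗ[ℝ] Mat) (σ τ : Pt → Mat) : ℝ :=
  innerMat D (fun x => A x (σ x)) τ

/-- The form `⟨∇ · τ, v⟩`. -/
def formB (D : Set Pt) (τ : Pt → Mat) (v : Pt → Fin 2 → ℝ) : ℝ :=
  innerVec D (weakDiv D τ) v

/-- The discrete kernel `B_h` of the divergence form. -/
def discreteKernel (F G : Pt → Pt) (p : ℕ) {m : ℕ} (K₁ K₂ : InteriorKnots m) : Set (Pt → Mat) :=
  {τ | τ ∈ stressSpace F G p K₁ K₂ ∧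
    ∀ v ∈ dispSpace F p K₁ K₂, formB (physDomain F) τ v = 0}

end StrongSym

end

open StrongSym

/-! The transforms are built so that the divergence commutes with them: ∇·Ỹ₂ˢ(W) = (Y₃ˢ)⁻¹(∇̂·W) for
spline fields W. Stability then reduces to two facts about splines and to L² bounds whose constants
depend on F alone.

Commutation. Put K = J̃⁻¹, let V₁, V₂ be the columns of V and R = ∫V₂ d1. The transform Y₂ is
triangular in the columns P₁, P₂ of the Piola field (S∘F)J̃ᵀ, and solving Y₂(S) = V gives P₁ = KV₁ -
∂₂K R and P₂ = KV₂ + ∂₁K R = ∂₁(KR). The mixed terms cancel in ∂₁P₁ + ∂₂P₂ = ∂₁(K(V₁ + ∂₂R)). Since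
V₁ + ∂₂R = V₁(0,·) + ∫(∇̂·V) d1, this equals K ∇̂·V + ∂₁K ∫∇̂·V d1 + ∂₁K V₁(0,·). The first two
terms are det(J) (Y₃ˢ)⁻¹(∇̂·V)∘F, the last one is det(J) T(V)∘F. The correction in Ỹ₂ˢ is the
inverse image of a diagonal field whose first column vanishes at ζ₁ = 0 and whose divergence is
Y₃ˢ(T(V)); it removes exactly T(V). The weak form of this computation is `integral_commutation`, the
result `hasWeakDiv_Y2Tilde`.

Splines. Differentiation and integration lower and raise the degree by one within the given families
(`exists_splineSpace_deriv`, `exists_splineSpace_succ_eq_integral`), because the derivative of a sum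
of B-splines from some index on is a multiple of a single B-spline. So the parametric divergence
maps the stress splines into the displacement splines, and w ↦ diag(∫w₁ d1, ∫w₂ d2) is a right
inverse.

Stability. For that right inverse the trace at ζ₁ = 0, hence T and the correction, vanish.
Primitives do not increase the L² norm on the unit square, and the transforms and their inverses are
bounded because J, 1/det J and the needed derivatives are; this gives `exists_innerMat_le` and the
inf-sup bound. On the discrete kernel ∇·τ is itself an admissible test function, so it vanishes and
coercivity is the positive definiteness of A. -/

namespace StrongSym

/-! ### Univariate B-splines: derivatives and primitives through tail sums. -/

section Splines

open Set MeasureTheory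

/-- The partial sum `∑_{i ≥ j}` of the B-splines of degree `q`, given by its own recursion. -/
noncomputable def tailSpline (ξ : ℕ → ℝ) : ℕ → ℕ → ℝ → ℝ
  | 0, j, x => (Ici (ξ j)).indicator (fun _ => 1) x
  | q + 1, j, x =>
      (x - ξ j) / (ξ (j + q + 1) - ξ j) * tailSpline ξ q j x +
      (1 - (x - ξ j) / (ξ (j + q + 1) - ξ j)) * tailSpline ξ q (j + 1) x

theorem eq_of_monotone_of_eq {ξ : ℕ → ℝ} (hξ : Monotone ξ) {j k i : ℕ} (h : ξ j = ξ k)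
    (h₁ : j ≤ i) (h₂ : i ≤ k) : ξ i = ξ j :=
  le_antisymm (h ▸ hξ h₂) (hξ h₁)

/-- On coinciding knots the weight is a quotient by zero, hence 0, and every level of the recursion
passes to the tail from `j + 1`, down to the step function of degree 0. All degenerate knot
configurations below are reduced to this case. -/
theorem tailSpline_of_eq {ξ : ℕ → ℝ} (hξ : Monotone ξ) :
    ∀ (q j : ℕ), ξ j = ξ (j + q) → ∀ x,
      tailSpline ξ q j x = (Ici (ξ j)).indicator (fun _ => 1) x
  | 0, _, _, _ => rfl
  | q + 1, j, h, x => by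
    have h1 : ξ (j + 1) = ξ j := eq_of_monotone_of_eq hξ h (by omega) (by omega)
    have h2 : ξ (j + 1 + q) = ξ j := eq_of_monotone_of_eq hξ h (by omega) (by omega)
    have h3 : ξ (j + q + 1) = ξ j := h.symm
    simp only [tailSpline, h3, sub_self, div_zero, zero_mul, sub_zero, one_mul, zero_add]
    rw [tailSpline_of_eq hξ q (j + 1) (by rw [h1, h2]), h1]

/-- Subtracting two consecutive tail recursions gives the Cox–de Boor recursion, since its second
weight is the complement of the next first weight. This fails only if the denominator is zero (the
weight is then 0 and not 1), but in that case the two tails involved are the same step function. -/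
theorem bspline_eq_sub {ξ : ℕ → ℝ} (hξ : Monotone ξ) :
    ∀ (q j : ℕ) (x : ℝ), bspline ξ q j x = tailSpline ξ q j x - tailSpline ξ q (j + 1) x
  | 0, j, x => by
    have := hξ (Nat.le_succ j)
    simp only [bspline, tailSpline, indicator, mem_Ico, mem_Ici, Nat.succ_eq_add_one] at *
    split_ifs <;> first | (exfalso; grind) | norm_num
  | q + 1, j, x => by
    simp only [bspline, tailSpline, bspline_eq_sub hξ q]
    have e : j + 1 + q + 1 = j + q + 2 := by omega
    rw [e]
    by_cases hd : ξ (j + q + 2) - ξ (j + 1) = 0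
    · have h0 : ξ (j + 1) = ξ (j + q + 2) := by linarith
      have h2 : ξ (j + 1 + 1) = ξ (j + 1) := eq_of_monotone_of_eq hξ h0 (by omega) (by omega)
      have h3 : ξ (j + 1 + q) = ξ (j + 1) := eq_of_monotone_of_eq hξ h0 (by omega) (by omega)
      have h4 : ξ (j + 1 + 1 + q) = ξ (j + 1) := eq_of_monotone_of_eq hξ h0 (by omega) (by omega)
      rw [tailSpline_of_eq hξ q (j + 1) h3.symm, tailSpline_of_eq hξ q (j + 1 + 1) (h2.trans h4.symm),
        h2]
      ring
    · have : (ξ (j + q + 2) - x) / (ξ (j + q + 2) - ξ (j + 1)) =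
          1 - (x - ξ (j + 1)) / (ξ (j + q + 2) - ξ (j + 1)) := by
        field_simp; ring
      rw [this]; ring

theorem tailSpline_of_lt {ξ : ℕ → ℝ} (hξ : Monotone ξ) :
    ∀ (q j : ℕ) (x : ℝ), x < ξ j → tailSpline ξ q j x = 0
  | 0, j, x, h => by simp [tailSpline, h]
  | q + 1, j, x, h => by
    simp [tailSpline, tailSpline_of_lt hξ q j x h,
      tailSpline_of_lt hξ q (j + 1) x (h.trans_le (hξ (Nat.le_succ j)))]

/-- At `x = ξ j` only the tail from `j + 1` survives in the recursion. It vanishes by support if the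
knot increases, and by recursion otherwise. This is the initial value needed to write a tail as a
primitive. -/
theorem tailSpline_of_le {ξ : ℕ → ℝ} (hξ : Monotone ξ) :
    ∀ (q j : ℕ) (x : ℝ), ξ j < ξ (j + q) → x ≤ ξ j → tailSpline ξ q j x = 0
  | 0, j, x, h, _ => by simp at h
  | q + 1, j, x, h, hx => by
    rcases hx.lt_or_eq with hx | rfl
    · exact tailSpline_of_lt hξ _ _ _ hx
    · simp only [tailSpline, sub_self, zero_div, zero_mul, zero_add, sub_zero, one_mul]
      rcases (hξ (Nat.le_succ j)).lt_or_eq with h1 | h1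
      · exact tailSpline_of_lt hξ _ _ _ h1
      · refine tailSpline_of_le hξ q (j + 1) _ ?_ h1.le
        have e : j + 1 + q = j + (q + 1) := by omega
        rw [e]; exact h1 ▸ h

theorem hasDerivAt_indicator_Ici {a x : ℝ} (h : x ≠ a) :
    HasDerivAt (fun y => (Ici a).indicator (fun _ => (1 : ℝ)) y) 0 x := by
  rcases lt_or_gt_of_ne h with h | h
  · refine (hasDerivAt_const x (0 : ℝ)).congr_of_eventuallyEq ?_
    filter_upwards [Iio_mem_nhds h] with y hy
    simp only [indicator, mem_Ici]; rw [if_neg (not_le.2 hy)]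
  · refine (hasDerivAt_const x (1 : ℝ)).congr_of_eventuallyEq ?_
    filter_upwards [Ioi_mem_nhds h] with y hy
    simp only [indicator, mem_Ici]; rw [if_pos (le_of_lt hy)]

/-- Differentiating the weights contributes the difference of two tails, which is one B-spline.
Differentiating the tails contributes, by induction, a combination of two lower B-splines which
Cox–de Boor turns into multiples of that same B-spline. Hence a tail has only one B-spline in its
derivative. For collapsed knots both sides are 0. -/
theorem hasDerivAt_tailSpline {ξ : ℕ → ℝ} (hξ : Monotone ξ) {x : ℝ} (hx : ∀ j, x ≠ ξ j) :
    ∀ q j : ℕ, HasDerivAt (tailSpline ξ (q + 1) j)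
      ((q + 1) / (ξ (j + q + 1) - ξ j) * bspline ξ q j x) x := by
  intro q
  induction q with
  | zero =>
    intro j
    have hω : HasDerivAt (fun y => (y - ξ j) / (ξ (j + 0 + 1) - ξ j)) (1 / (ξ (j + 0 + 1) - ξ j)) x :=
      ((hasDerivAt_id x).sub_const _).div_const _
    have h := (hω.mul (hasDerivAt_indicator_Ici (hx j))).add
      ((hω.const_sub 1).mul (hasDerivAt_indicator_Ici (hx (j + 1))))
    refine h.congr_deriv ?_
    rw [bspline_eq_sub hξ]
    simp only [tailSpline]
    push_cast
    ring
  | succ q ih =>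
    intro j
    by_cases hd : ξ (j + (q + 1) + 1) - ξ j = 0
    · rw [hd, div_zero, zero_mul]
      have : tailSpline ξ (q + 1 + 1) j = fun y => (Ici (ξ j)).indicator (fun _ => 1) y :=
        funext fun y => tailSpline_of_eq hξ _ _ (by
          have e : j + (q + 1 + 1) = j + (q + 1) + 1 := by omega
          rw [e]; linarith) y
      rw [this]
      exact hasDerivAt_indicator_Ici (hx j)
    · have hω : HasDerivAt (fun y => (y - ξ j) / (ξ (j + (q + 1) + 1) - ξ j))
          (1 / (ξ (j + (q + 1) + 1) - ξ j)) x :=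
        ((hasDerivAt_id x).sub_const _).div_const _
      have h := (hω.mul (ih j)).add ((hω.const_sub 1).mul (ih (j + 1)))
      refine h.congr_deriv ?_
      have e1 : 1 - (x - ξ j) / (ξ (j + (q + 1) + 1) - ξ j) =
          (ξ (j + (q + 1) + 1) - x) / (ξ (j + (q + 1) + 1) - ξ j) := by
        field_simp; ring
      have e2 : bspline ξ (q + 1) j x = (x - ξ j) / (ξ (j + q + 1) - ξ j) * bspline ξ q j x +
        (ξ (j + q + 2) - x) / (ξ (j + q + 2) - ξ (j + 1)) * bspline ξ q (j + 1) x := rfl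
      have e3 : tailSpline ξ (q + 1) j x = bspline ξ (q + 1) j x + tailSpline ξ (q + 1) (j + 1) x := by
        rw [bspline_eq_sub hξ]; ring
      rw [e1, e3, e2]
      have e4 : j + 1 + q + 1 = j + q + 2 := by omega
      have e5 : j + (q + 1) + 1 = j + q + 2 := by omega
      rw [e4, e5]
      push_cast
      ring

theorem continuous_sub_mul_indicator_Ici (z : ℝ) :
    Continuous fun x => (x - z) * (Ici z).indicator (fun _ => (1 : ℝ)) x := by
  have : (fun x => (x - z) * (Ici z).indicator (fun _ => (1 : ℝ)) x) = fun x => max (x - z) 0 := by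
    funext x
    simp only [indicator, mem_Ici]
    split_ifs with h
    · rw [max_eq_left (by linarith), mul_one]
    · rw [max_eq_right (by linarith), mul_zero]
  rw [this]
  fun_prop

/-- A discontinuous tail in the recursion is a step function, and its weight vanishes exactly at the
jump; the product is a ramp. -/
theorem continuous_tailSpline {ξ : ℕ → ℝ} (hξ : Monotone ξ) :
    ∀ q j : ℕ, ξ j < ξ (j + q) → Continuous (tailSpline ξ q j) := by
  intro q
  induction q with
  | zero => intro j h; simp at h
  | succ q ih =>
    intro j h
    have hd : ξ (j + q + 1) - ξ j ≠ 0 := by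
      have e : j + (q + 1) = j + q + 1 := by omega
      rw [e] at h; linarith
    have e : tailSpline ξ (q + 1) j = fun x =>
        (ξ (j + q + 1) - ξ j)⁻¹ * ((x - ξ j) * tailSpline ξ q j x) +
        (ξ (j + q + 1) - ξ j)⁻¹ * ((ξ (j + q + 1) - x) * tailSpline ξ q (j + 1) x) := by
      funext x
      simp only [tailSpline]
      field_simp
      ring
    rw [e]
    have e2 : j + 1 + q = j + q + 1 := by omega
    refine (continuous_const.mul ?_).add (continuous_const.mul ?_)
    · rcases (hξ (Nat.le_add_right j q)).lt_or_eq with h1 | h1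
      · have := ih j h1; fun_prop
      · simp only [tailSpline_of_eq hξ q j h1]
        exact continuous_sub_mul_indicator_Ici _
    · rcases (hξ (Nat.le_add_right (j + 1) q)).lt_or_eq with h1 | h1
      · have := ih (j + 1) h1; fun_prop
      · simp only [tailSpline_of_eq hξ q (j + 1) h1]
        rw [← e2, ← h1]
        refine (continuous_sub_mul_indicator_Ici (ξ (j + 1))).neg.congr fun x => ?_
        rw [Pi.neg_apply]
        ring

theorem tailSpline_succ_knot (ξ : ℕ → ℝ) :
    ∀ (q j : ℕ) (x : ℝ), tailSpline ξ q (j + 1) x = tailSpline (fun i => ξ (i + 1)) q j x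
  | 0, j, x => rfl
  | q + 1, j, x => by
    simp only [tailSpline, tailSpline_succ_knot ξ q]
    have e1 : j + 1 + q + 1 = j + q + 1 + 1 := by omega
    rw [e1]

theorem measurable_bspline (ξ : ℕ → ℝ) : ∀ q j : ℕ, Measurable (bspline ξ q j)
  | 0, j => by
    have : bspline ξ 0 j = (Ico (ξ j) (ξ (j + 1))).indicator fun _ => 1 := rfl
    rw [this]
    exact measurable_const.indicator measurableSet_Ico
  | q + 1, j => by
    have h1 := measurable_bspline ξ q j
    have h2 := measurable_bspline ξ q (j + 1)
    have : bspline ξ (q + 1) j = fun x => (x - ξ j) / (ξ (j + q + 1) - ξ j) * bspline ξ q j x +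
      (ξ (j + q + 2) - x) / (ξ (j + q + 2) - ξ (j + 1)) * bspline ξ q (j + 1) x := rfl
    rw [this]
    fun_prop

theorem exists_abs_bspline_le (ξ : ℕ → ℝ) :
    ∀ q j : ℕ, ∃ C : ℝ, ∀ x ∈ Icc (0 : ℝ) 1, |bspline ξ q j x| ≤ C
  | 0, j => ⟨1, fun x _ => by
      simp only [bspline, indicator]; split_ifs <;> simp⟩
  | q + 1, j => by
    obtain ⟨C₁, h₁⟩ := exists_abs_bspline_le ξ q j
    obtain ⟨C₂, h₂⟩ := exists_abs_bspline_le ξ q (j + 1)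
    obtain ⟨D₁, g₁⟩ := (isCompact_Icc (a := (0 : ℝ)) (b := 1)).exists_bound_of_continuousOn
      (f := fun x => (x - ξ j) / (ξ (j + q + 1) - ξ j)) (by fun_prop)
    obtain ⟨D₂, g₂⟩ := (isCompact_Icc (a := (0 : ℝ)) (b := 1)).exists_bound_of_continuousOn
      (f := fun x => (ξ (j + q + 2) - x) / (ξ (j + q + 2) - ξ (j + 1))) (by fun_prop)
    refine ⟨D₁ * C₁ + D₂ * C₂, fun x hx => ?_⟩
    simp only [bspline]
    refine (abs_add_le _ _).trans (add_le_add ?_ ?_)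
    · rw [abs_mul]
      exact mul_le_mul (g₁ x hx) (h₁ x hx) (abs_nonneg _) ((abs_nonneg _).trans (g₁ x hx))
    · rw [abs_mul]
      exact mul_le_mul (g₂ x hx) (h₂ x hx) (abs_nonneg _) ((abs_nonneg _).trans (g₂ x hx))

theorem intervalIntegrable_bspline (ξ : ℕ → ℝ) (q j : ℕ) {a b : ℝ} (ha : a ∈ Icc (0 : ℝ) 1)
    (hb : b ∈ Icc (0 : ℝ) 1) : IntervalIntegrable (bspline ξ q j) volume a b := by
  obtain ⟨C, hC⟩ := exists_abs_bspline_le ξ q j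
  rw [intervalIntegrable_iff]
  refine Measure.integrableOn_of_bounded (M := C) (by simp) ?_ ?_
  · exact (measurable_bspline ξ q j).aestronglyMeasurable
  · refine (ae_restrict_iff' measurableSet_uIoc).2 (.of_forall fun x hx => hC x ?_)
    exact uIcc_subset_Icc ha hb (uIoc_subset_uIcc hx)

/-- The fundamental theorem of calculus with the knots as countable exceptional set: the tail is
continuous there although not differentiable. -/
theorem tailSpline_eq_integral {ξ : ℕ → ℝ} (hξ : Monotone ξ) {q j : ℕ} (h0 : 0 ≤ ξ j)
    (h : ξ j < ξ (j + q + 1)) {x : ℝ} (hx : x ∈ Icc (0 : ℝ) 1) :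
    tailSpline ξ (q + 1) j x =
      ∫ t in (0 : ℝ)..x, (q + 1) / (ξ (j + q + 1) - ξ j) * bspline ξ q j t := by
  rw [integral_eq_of_hasDerivAt_off_countable (tailSpline ξ (q + 1) j) _
    (countable_range ξ) (continuous_tailSpline hξ (q + 1) j h).continuousOn
    (fun t ht => hasDerivAt_tailSpline hξ (fun i hi => ht.2 ⟨i, hi.symm⟩) q j)
    ((intervalIntegrable_bspline ξ q j (by simp) hx).const_mul _),
    tailSpline_of_le hξ _ _ 0 h h0, sub_zero]

/-! ### Open knot vectors -/

/-- A higher degree adds one 0 in front and one 1 at the end, so knot indices shift by one. The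
additional final 1 agrees with the default value of `getD`, hence the identity needs no bound on
`j`. -/
theorem openKnot_succ (q : ℕ) (L : List ℝ) (j : ℕ) :
    openKnot (q + 1) L (j + 1) = openKnot q L j := by
  unfold openKnot
  rw [List.replicate_succ (n := q + 1), List.cons_append, List.cons_append, List.getD_cons_succ,
    List.replicate_succ' (n := q + 1) (a := (1 : ℝ)), ← List.append_assoc]
  simp only [List.getD_eq_getElem?_getD]
  rcases lt_trichotomy j (List.replicate (q + 1) (0 : ℝ) ++ L ++ List.replicate (q + 1) 1).length
    with h | h | h
  · rw [List.getElem?_append_left h]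
  · subst h; simp
  · rw [List.getElem?_eq_none h.le, List.getElem?_eq_none]
    simp only [List.length_append, List.length_replicate, List.length_singleton] at *
    omega

theorem openKnot_of_le {q : ℕ} {L : List ℝ} {j : ℕ} (h : j ≤ q) : openKnot q L j = 0 := by
  unfold openKnot
  rw [List.append_assoc, List.getD_eq_getElem?_getD, List.getElem?_append_left (by simp; omega),
    List.getElem?_replicate, if_pos (by omega)]
  rfl

theorem openKnot_of_ge {q : ℕ} {L : List ℝ} {j : ℕ} (h : L.length + q + 1 ≤ j) :
    openKnot q L j = 1 := by
  unfold openKnot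
  rw [List.getD_eq_getElem?_getD, List.getElem?_append_right (by simp; omega),
    List.getElem?_replicate]
  split_ifs <;> rfl

theorem InteriorKnots.sorted_open {m : ℕ} (K : InteriorKnots m) (q : ℕ) :
    (List.replicate (q + 1) (0 : ℝ) ++ K.knots ++ List.replicate (q + 1) (1 : ℝ)).Pairwise
      (· ≤ ·) := by
  rw [List.pairwise_append, List.pairwise_append]
  refine ⟨⟨List.pairwise_replicate.2 (Or.inr le_rfl), K.sorted, ?_⟩,
    List.pairwise_replicate.2 (Or.inr le_rfl), ?_⟩
  · intro a ha b hb
    rw [List.eq_of_mem_replicate ha]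
    exact (K.mem_Ioo b hb).1.le
  · intro a ha b hb
    rw [List.eq_of_mem_replicate hb]
    rcases List.mem_append.1 ha with ha | ha
    · rw [List.eq_of_mem_replicate ha]; exact zero_le_one
    · exact (K.mem_Ioo a ha).2.le

theorem InteriorKnots.mem_open_le_one {m : ℕ} (K : InteriorKnots m) (q : ℕ) {a : ℝ}
    (ha : a ∈ List.replicate (q + 1) (0 : ℝ) ++ K.knots ++ List.replicate (q + 1) (1 : ℝ)) :
    a ≤ 1 := by
  rcases List.mem_append.1 ha with ha | ha
  · rcases List.mem_append.1 ha with ha | ha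
    · rw [List.eq_of_mem_replicate ha]; exact zero_le_one
    · exact (K.mem_Ioo a ha).2.le
  · rw [List.eq_of_mem_replicate ha]

theorem InteriorKnots.monotone_openKnot {m : ℕ} (K : InteriorKnots m) (q : ℕ) :
    Monotone (openKnot q K.knots) := by
  refine monotone_nat_of_le_succ fun j => ?_
  have hs := K.sorted_open q
  have h1 := fun a => K.mem_open_le_one q (a := a)
  unfold openKnot
  generalize List.replicate (q + 1) (0 : ℝ) ++ K.knots ++ List.replicate (q + 1) (1 : ℝ) = l at *
  simp only [List.getD_eq_getElem?_getD]
  by_cases h : j + 1 < l.length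
  · rw [List.getElem?_eq_getElem h, List.getElem?_eq_getElem (by omega)]
    exact List.pairwise_iff_getElem.1 hs j (j + 1) (by omega) h (by omega)
  · rw [List.getElem?_eq_none (i := j + 1) (by omega)]
    by_cases h' : j < l.length
    · rw [List.getElem?_eq_getElem h']
      exact h1 _ (List.getElem_mem h')
    · rw [List.getElem?_eq_none (by omega)]

theorem le_count_of_getElem_eq {l : List ℝ} {j n : ℕ} {z : ℝ} (hn : j + n ≤ l.length)
    (h : ∀ i (hi : i < l.length), j ≤ i → i < j + n → l[i] = z) : n ≤ l.count z := by
  have h1 : (l.drop j).take n = List.replicate n z := by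
    refine List.eq_replicate_iff.2 ⟨by simp; omega, fun b hb => ?_⟩
    obtain ⟨i, hi, rfl⟩ := List.mem_iff_getElem.1 hb
    simp only [List.length_take, List.length_drop] at hi
    rw [List.getElem_take, List.getElem_drop]
    exact h _ _ (by omega) (by omega)
  have h2 : (List.replicate n z).Sublist l :=
    h1 ▸ (List.take_sublist _ _).trans (List.drop_sublist _ _)
  exact List.replicate_sublist_iff.1 h2

/-- Otherwise `q + 2` consecutive knots would coincide, while the endpoints occur `q + 1` times and
interior knots at most `m ≤ q + 1` times. This is the only place where the multiplicity bound
enters. -/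
theorem InteriorKnots.openKnot_lt {m : ℕ} (K : InteriorKnots m) {q : ℕ} (hm : m ≤ q + 1) {j : ℕ}
    (hj : j < K.knots.length + q + 1) :
    openKnot q K.knots j < openKnot q K.knots (j + q + 1) := by
  refine lt_of_le_of_ne (K.monotone_openKnot q (by omega)) fun he => ?_
  have hc : ∀ z, (List.replicate (q + 1) (0 : ℝ) ++ K.knots ++ List.replicate (q + 1) 1).count z
      ≤ q + 1 := by
    intro z
    simp only [List.count_append, List.count_replicate, beq_iff_eq]
    have hz := K.count_le z
    by_cases h0 : (0 : ℝ) = z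
    · subst h0
      have : K.knots.count 0 = 0 :=
        List.count_eq_zero.2 fun h => (lt_irrefl _ (K.mem_Ioo 0 h).1)
      simp [this]
    · by_cases h1 : (1 : ℝ) = z
      · subst h1
        have : K.knots.count 1 = 0 :=
          List.count_eq_zero.2 fun h => (lt_irrefl _ (K.mem_Ioo 1 h).2)
        simp [this]
      · simp only [h0, h1, if_false]; omega
  have := le_count_of_getElem_eq (j := j) (n := q + 2) (z := openKnot q K.knots j)
    (l := List.replicate (q + 1) (0 : ℝ) ++ K.knots ++ List.replicate (q + 1) 1)
    (by simp only [List.length_append, List.length_replicate]; omega)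
    (fun i hi h1 h2 => by
      have := eq_of_monotone_of_eq (K.monotone_openKnot q) he h1 (by omega)
      rw [← this, openKnot, List.getD_eq_getElem?_getD, List.getElem?_eq_getElem hi]; rfl)
  have := hc (openKnot q K.knots j)
  omega

/-! ### Univariate splines -/

/-- The span of the B-splines of degree `q`. -/
noncomputable def splineSpace (q : ℕ) (L : List ℝ) : Submodule ℝ (ℝ → ℝ) :=
  Submodule.span ℝ {f | ∃ i < L.length + q + 1, f = bspline (openKnot q L) q i}

theorem bspline_mem_splineSpace {q : ℕ} {L : List ℝ} {i : ℕ} (hi : i < L.length + q + 1) :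
    bspline (openKnot q L) q i ∈ splineSpace q L :=
  Submodule.subset_span ⟨i, hi, rfl⟩

theorem tailSpline_openKnot_succ (q : ℕ) (L : List ℝ) (k j : ℕ) (x : ℝ) :
    tailSpline (openKnot (q + 1) L) k (j + 1) x = tailSpline (openKnot q L) k j x := by
  rw [tailSpline_succ_knot]
  congr 1
  exact funext fun i => openKnot_succ q L i

/-- Descending induction on the starting index by adding one B-spline at a time. Past the last
B-spline the tail is the step at 1, which is zero only on the half-open interval; this is why the
identities between splines hold on `[0,1)`. -/
theorem exists_mem_splineSpace_eq_tailSpline {m : ℕ} (K : InteriorKnots m) (q : ℕ) :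
    ∀ n j : ℕ, j + n = K.knots.length + q + 1 → ∃ s ∈ splineSpace q K.knots,
      ∀ x ∈ Ico (0 : ℝ) 1, s x = tailSpline (openKnot q K.knots) q j x
  | 0, j, h => ⟨0, Submodule.zero_mem _, fun x hx => by
      rw [tailSpline_of_lt (K.monotone_openKnot q)]
      · rfl
      · rw [openKnot_of_ge (by omega)]; exact hx.2⟩
  | n + 1, j, h => by
    obtain ⟨s, hs, hsx⟩ := exists_mem_splineSpace_eq_tailSpline K q n (j + 1) (by omega)
    refine ⟨bspline (openKnot q K.knots) q j + s,
      Submodule.add_mem _ (bspline_mem_splineSpace (by omega)) hs, fun x hx => ?_⟩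
    rw [Pi.add_apply, hsx x hx, bspline_eq_sub (K.monotone_openKnot q)]
    ring

/-- The primitive is the tail of degree `q + 1` divided by the factor of the derivative formula. The
index `j + 1` accounts for the extra knot at 0. -/
theorem exists_splineSpace_succ_eq_integral {m : ℕ} (K : InteriorKnots m) {q : ℕ} (hm : m ≤ q + 1)
    {j : ℕ} (hj : j < K.knots.length + q + 1) :
    ∃ s ∈ splineSpace (q + 1) K.knots, ∀ x ∈ Ico (0 : ℝ) 1,
      s x = ∫ t in (0 : ℝ)..x, bspline (openKnot q K.knots) q j t := by
  obtain ⟨s, hs, hsx⟩ := exists_mem_splineSpace_eq_tailSpline K (q + 1)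
    (K.knots.length + q + 1 - j) (j + 1) (by omega)
  set ξ := openKnot q K.knots with hξ
  have hlt : ξ j < ξ (j + q + 1) := K.openKnot_lt hm hj
  have h0 : 0 ≤ ξ j := by
    rw [← openKnot_of_le (q := q) (L := K.knots) (Nat.zero_le q)]
    exact K.monotone_openKnot q (Nat.zero_le j)
  refine ⟨((ξ (j + q + 1) - ξ j) / (q + 1)) • s, Submodule.smul_mem _ _ hs, fun x hx => ?_⟩
  rw [Pi.smul_apply, hsx x hx, tailSpline_openKnot_succ,
    tailSpline_eq_integral (K.monotone_openKnot q) h0 hlt ⟨hx.1, hx.2.le⟩,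
    intervalIntegral.integral_const_mul, smul_eq_mul, ← mul_assoc]
  have h1 : ξ (j + q + 1) - ξ j ≠ 0 := by linarith
  have h2 : (q + 1 : ℝ) ≠ 0 := by positivity
  rw [div_mul_div_cancel₀ h2, div_self h1, one_mul]

/-- The two extreme tails have no B-spline as derivative but are constant on `[0,1)`: the full sum
is 1 (partition of unity) and a tail starting at the knot 1 is 0. There is one more tail than there
are B-splines, whence the bound `q + 3`. The explicit form of `s` serves for its integrability. -/
theorem exists_splineSpace_deriv_tailSpline {m : ℕ} (K : InteriorKnots m) {q : ℕ} (hm : m ≤ q + 1)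
    {j : ℕ} (hj : j < K.knots.length + q + 3) :
    ∃ s ∈ splineSpace q K.knots, (∃ c, ∃ i, s = fun x => c * bspline (openKnot q K.knots) q i x) ∧
      ∀ x ∈ Ico (0 : ℝ) 1,
      tailSpline (openKnot (q + 1) K.knots) (q + 1) j x =
        tailSpline (openKnot (q + 1) K.knots) (q + 1) j 0 + ∫ t in (0 : ℝ)..x, s t := by
  rcases j with _ | j
  · refine ⟨0, Submodule.zero_mem _, ⟨0, 0, by simp; rfl⟩, fun x hx => ?_⟩
    have h0 : openKnot (q + 1) K.knots 0 = openKnot (q + 1) K.knots (0 + (q + 1)) := by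
      rw [openKnot_of_le (by omega), openKnot_of_le (by omega)]
    rw [tailSpline_of_eq (K.monotone_openKnot _) _ _ h0,
      tailSpline_of_eq (K.monotone_openKnot _) _ _ h0, openKnot_of_le (by omega)]
    simp [hx.1]
  · simp only [tailSpline_openKnot_succ]
    by_cases h : j < K.knots.length + q + 1
    · have hlt := K.openKnot_lt hm h
      have h0 : 0 ≤ openKnot q K.knots j := by
        rw [← openKnot_of_le (q := q) (L := K.knots) (Nat.zero_le q)]
        exact K.monotone_openKnot q (Nat.zero_le j)
      refine ⟨((q + 1 : ℝ) / (openKnot q K.knots (j + q + 1) - openKnot q K.knots j)) •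
        bspline (openKnot q K.knots) q j, Submodule.smul_mem _ _ (bspline_mem_splineSpace h),
        ⟨_, j, rfl⟩, fun x hx => ?_⟩
      rw [tailSpline_of_le (K.monotone_openKnot q) _ _ 0 hlt h0, zero_add,
        tailSpline_eq_integral (K.monotone_openKnot q) h0 hlt ⟨hx.1, hx.2.le⟩]
      rfl
    · refine ⟨0, Submodule.zero_mem _, ⟨0, 0, by simp; rfl⟩, fun x hx => ?_⟩
      have h1 : openKnot q K.knots j = 1 := openKnot_of_ge (by omega)
      rw [tailSpline_of_lt (K.monotone_openKnot q) _ _ _ (h1 ▸ hx.2),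
        tailSpline_of_lt (K.monotone_openKnot q) _ _ _ (h1 ▸ zero_lt_one)]
      simp

theorem exists_splineSpace_deriv {m : ℕ} (K : InteriorKnots m) {q : ℕ} (hm : m ≤ q + 1)
    {j : ℕ} (hj : j < K.knots.length + q + 2) :
    ∃ s ∈ splineSpace q K.knots, ∀ x ∈ Ico (0 : ℝ) 1,
      bspline (openKnot (q + 1) K.knots) (q + 1) j x =
        bspline (openKnot (q + 1) K.knots) (q + 1) j 0 + ∫ t in (0 : ℝ)..x, s t := by
  obtain ⟨s, hs, ⟨c, i, hc⟩, h⟩ := exists_splineSpace_deriv_tailSpline K hm (j := j) (by omega)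
  obtain ⟨s', hs', ⟨c', i', hc'⟩, h'⟩ :=
    exists_splineSpace_deriv_tailSpline K hm (j := j + 1) (by omega)
  refine ⟨s - s', Submodule.sub_mem _ hs hs', fun x hx => ?_⟩
  have hx' : x ∈ Icc (0 : ℝ) 1 := ⟨hx.1, hx.2.le⟩
  simp only [bspline_eq_sub (K.monotone_openKnot _), h x hx, h' x hx, Pi.sub_apply]
  rw [intervalIntegral.integral_sub]
  · ring
  · rw [hc]; exact (intervalIntegrable_bspline _ _ _ (by simp) hx').const_mul _
  · rw [hc']; exact (intervalIntegrable_bspline _ _ _ (by simp) hx').const_mul _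

end Splines

/-! ### Tensor-product splines: derivatives and primitives in one variable. -/

section TensorSplines

open Set MeasureTheory

/-- The exchange of the two coordinates. -/
def swapPt (ζ : Pt) : Pt := ![ζ 1, ζ 0]

@[simp] theorem swapPt_zero (ζ : Pt) : swapPt ζ 0 = ζ 1 := rfl

@[simp] theorem swapPt_one (ζ : Pt) : swapPt ζ 1 = ζ 0 := rfl

@[simp] theorem swapPt_swapPt (ζ : Pt) : swapPt (swapPt ζ) = ζ := by
  ext i; fin_cases i <;> rfl

theorem int2_eq_int1_swap (g : Pt → ℝ) (ζ : Pt) :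
    int2 g ζ = int1 (fun ξ => g (swapPt ξ)) (swapPt ζ) := rfl

theorem int1_eq_int2_swap (g : Pt → ℝ) (ζ : Pt) :
    int1 g ζ = int2 (fun ξ => g (swapPt ξ)) (swapPt ζ) := rfl

variable {q₁ q₂ : ℕ} {L₁ L₂ : List ℝ} {f : Pt → ℝ}

/-- With this symmetry the results for the second variable follow from those for the first. -/
theorem tensorSpline_swap (hf : f ∈ tensorSpline q₁ q₂ L₁ L₂) :
    (fun ζ => f (swapPt ζ)) ∈ tensorSpline q₂ q₁ L₂ L₁ := by
  induction hf using Submodule.span_induction with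
  | mem f h =>
    obtain ⟨i, hi, j, hj, rfl⟩ := h
    exact Submodule.subset_span ⟨j, hj, i, hi, funext fun ζ => mul_comm _ _⟩
  | zero => exact Submodule.zero_mem _
  | add f g _ _ hf hg => exact Submodule.add_mem _ hf hg
  | smul c f _ hf => exact Submodule.smul_mem _ c hf

theorem measurable_tensorSpline (hf : f ∈ tensorSpline q₁ q₂ L₁ L₂) : Measurable f := by
  induction hf using Submodule.span_induction with
  | mem f h =>
    obtain ⟨i, hi, j, hj, rfl⟩ := h
    exact ((measurable_bspline _ _ _).comp (measurable_pi_apply 0)).mul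
      ((measurable_bspline _ _ _).comp (measurable_pi_apply 1))
  | zero => exact measurable_const
  | add f g _ _ hf hg => exact hf.add hg
  | smul c f _ hf => exact hf.const_smul c

theorem exists_abs_tensorSpline_le (hf : f ∈ tensorSpline q₁ q₂ L₁ L₂) :
    ∃ C : ℝ, ∀ ζ : Pt, ζ 0 ∈ Icc (0 : ℝ) 1 → ζ 1 ∈ Icc (0 : ℝ) 1 → |f ζ| ≤ C := by
  induction hf using Submodule.span_induction with
  | mem f h =>
    obtain ⟨i, hi, j, hj, rfl⟩ := h
    obtain ⟨C, hC⟩ := exists_abs_bspline_le (openKnot q₁ L₁) q₁ i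
    obtain ⟨D, hD⟩ := exists_abs_bspline_le (openKnot q₂ L₂) q₂ j
    refine ⟨C * D, fun ζ h0 h1 => ?_⟩
    rw [abs_mul]
    exact mul_le_mul (hC _ h0) (hD _ h1) (abs_nonneg _) ((abs_nonneg _).trans (hC _ h0))
  | zero => exact ⟨0, fun ζ _ _ => by simp⟩
  | add f g _ _ hf hg =>
    obtain ⟨C, hC⟩ := hf
    obtain ⟨D, hD⟩ := hg
    exact ⟨C + D, fun ζ h0 h1 => (abs_add_le _ _).trans (add_le_add (hC ζ h0 h1) (hD ζ h0 h1))⟩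
  | smul c f _ hf =>
    obtain ⟨C, hC⟩ := hf
    refine ⟨|c| * C, fun ζ h0 h1 => ?_⟩
    rw [Pi.smul_apply, smul_eq_mul, abs_mul]
    exact mul_le_mul_of_nonneg_left (hC ζ h0 h1) (abs_nonneg _)

theorem intervalIntegrable_tensorSpline (hf : f ∈ tensorSpline q₁ q₂ L₁ L₂) (y : ℝ) {x : ℝ}
    (hx : x ∈ Icc (0 : ℝ) 1) : IntervalIntegrable (fun t => f ![t, y]) volume 0 x := by
  induction hf using Submodule.span_induction with
  | mem f h =>
    obtain ⟨i, hi, j, hj, rfl⟩ := h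
    exact (intervalIntegrable_bspline (openKnot q₁ L₁) q₁ i (a := 0) (by simp) hx).mul_const
      (bspline (openKnot q₂ L₂) q₂ j y)
  | zero => exact intervalIntegrable_const
  | add f g _ _ hf hg => exact hf.add hg
  | smul c f _ hf => exact hf.const_mul c

theorem mul_bspline_mem_tensorSpline {s : ℝ → ℝ} (hs : s ∈ splineSpace q₁ L₁) {j : ℕ}
    (hj : j < L₂.length + q₂ + 1) :
    (fun ζ : Pt => s (ζ 0) * bspline (openKnot q₂ L₂) q₂ j (ζ 1)) ∈
      tensorSpline q₁ q₂ L₁ L₂ := by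
  induction hs using Submodule.span_induction with
  | mem f h =>
    obtain ⟨i, hi, rfl⟩ := h
    exact Submodule.subset_span ⟨i, hi, j, hj, rfl⟩
  | zero => convert Submodule.zero_mem _ using 1; funext ζ; simp
  | add f g _ _ hf hg =>
    convert Submodule.add_mem _ hf hg using 1; funext ζ; simp [add_mul]
  | smul c f _ hf =>
    convert Submodule.smul_mem _ c hf using 1; funext ζ; simp [mul_assoc]

variable {m : ℕ} {K₁ : InteriorKnots m}

theorem exists_tensorSpline_eq_int1 (hm : m ≤ q₁ + 1) (hf : f ∈ tensorSpline q₁ q₂ K₁.knots L₂) :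
    ∃ s ∈ tensorSpline (q₁ + 1) q₂ K₁.knots L₂, ∀ ζ : Pt, ζ 0 ∈ Ico (0 : ℝ) 1 →
      s ζ = int1 f ζ := by
  induction hf using Submodule.span_induction with
  | mem f h =>
    obtain ⟨i, hi, j, hj, rfl⟩ := h
    obtain ⟨s, hs, hsx⟩ := exists_splineSpace_succ_eq_integral K₁ hm hi
    refine ⟨_, mul_bspline_mem_tensorSpline hs hj, fun ζ h0 => ?_⟩
    rw [hsx _ h0]
    exact (intervalIntegral.integral_mul_const _ _).symm
  | zero => exact ⟨0, Submodule.zero_mem _, fun ζ _ => by simp [int1]⟩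
  | add f g hf' hg' hf hg =>
    obtain ⟨s, hs, hsx⟩ := hf
    obtain ⟨s', hs', hsx'⟩ := hg
    refine ⟨s + s', Submodule.add_mem _ hs hs', fun ζ h0 => ?_⟩
    have h0' : ζ 0 ∈ Icc (0 : ℝ) 1 := ⟨h0.1, h0.2.le⟩
    rw [Pi.add_apply, hsx ζ h0, hsx' ζ h0]
    exact (intervalIntegral.integral_add (intervalIntegrable_tensorSpline hf' _ h0')
      (intervalIntegrable_tensorSpline hg' _ h0')).symm
  | smul c f _ hf =>
    obtain ⟨s, hs, hsx⟩ := hf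
    refine ⟨c • s, Submodule.smul_mem _ c hs, fun ζ h0 => ?_⟩
    rw [Pi.smul_apply, hsx ζ h0]
    exact (intervalIntegral.integral_const_mul c _).symm

/-- Derivatives of splines are used only in integrated form, as boundary value plus primitive; this
covers low regularity, where a pointwise derivative may fail at the knots. -/
theorem exists_tensorSpline_deriv1 (hm : m ≤ q₁ + 1)
    (hf : f ∈ tensorSpline (q₁ + 1) q₂ K₁.knots L₂) :
    ∃ s ∈ tensorSpline q₁ q₂ K₁.knots L₂, ∀ ζ : Pt, ζ 0 ∈ Ico (0 : ℝ) 1 →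
      f ζ = f ![0, ζ 1] + int1 s ζ := by
  induction hf using Submodule.span_induction with
  | mem f h =>
    obtain ⟨i, hi, j, hj, rfl⟩ := h
    obtain ⟨s, hs, hsx⟩ := exists_splineSpace_deriv K₁ hm (j := i) (by omega)
    refine ⟨_, mul_bspline_mem_tensorSpline hs hj, fun ζ h0 => ?_⟩
    have : int1 (fun ζ : Pt => s (ζ 0) * bspline (openKnot q₂ L₂) q₂ j (ζ 1)) ζ =
      (∫ t in (0 : ℝ)..ζ 0, s t) * bspline (openKnot q₂ L₂) q₂ j (ζ 1) :=
      intervalIntegral.integral_mul_const (bspline (openKnot q₂ L₂) q₂ j (ζ 1)) s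
    beta_reduce
    rw [this, hsx _ h0]
    simp only [Matrix.cons_val_zero, Matrix.cons_val_one]
    ring
  | zero => exact ⟨0, Submodule.zero_mem _, fun ζ _ => by simp [int1]⟩
  | add f g hf' hg' hf hg =>
    obtain ⟨s, hs, hsx⟩ := hf
    obtain ⟨s', hs', hsx'⟩ := hg
    refine ⟨s + s', Submodule.add_mem _ hs hs', fun ζ h0 => ?_⟩
    have h0' : ζ 0 ∈ Icc (0 : ℝ) 1 := ⟨h0.1, h0.2.le⟩
    have : int1 (s + s') ζ = int1 s ζ + int1 s' ζ :=
      intervalIntegral.integral_add (intervalIntegrable_tensorSpline hs _ h0')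
      (intervalIntegrable_tensorSpline hs' _ h0')
    rw [Pi.add_apply, hsx ζ h0, hsx' ζ h0, this, Pi.add_apply]
    ring
  | smul c f _ hf =>
    obtain ⟨s, hs, hsx⟩ := hf
    refine ⟨c • s, Submodule.smul_mem _ c hs, fun ζ h0 => ?_⟩
    have : int1 (c • s) ζ = c * int1 s ζ := intervalIntegral.integral_const_mul c _
    rw [Pi.smul_apply, hsx ζ h0, this, Pi.smul_apply, smul_eq_mul, smul_eq_mul]
    ring

theorem exists_tensorSpline_eq_int2 (hm : m ≤ q₁ + 1) (hf : f ∈ tensorSpline q₂ q₁ L₂ K₁.knots) :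
    ∃ s ∈ tensorSpline q₂ (q₁ + 1) L₂ K₁.knots, ∀ ζ : Pt, ζ 1 ∈ Ico (0 : ℝ) 1 →
      s ζ = int2 f ζ := by
  obtain ⟨s, hs, hsx⟩ := exists_tensorSpline_eq_int1 hm (tensorSpline_swap hf)
  exact ⟨_, tensorSpline_swap hs, fun ζ h => (hsx (swapPt ζ) h).trans
    (int2_eq_int1_swap f ζ).symm⟩

theorem exists_tensorSpline_deriv2 (hm : m ≤ q₁ + 1)
    (hf : f ∈ tensorSpline q₂ (q₁ + 1) L₂ K₁.knots) :
    ∃ s ∈ tensorSpline q₂ q₁ L₂ K₁.knots, ∀ ζ : Pt, ζ 1 ∈ Ico (0 : ℝ) 1 →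
      f ζ = f ![ζ 0, 0] + int2 s ζ := by
  obtain ⟨s, hs, hsx⟩ := exists_tensorSpline_deriv1 hm (tensorSpline_swap hf)
  refine ⟨_, tensorSpline_swap hs, fun ζ h => ?_⟩
  have := hsx (swapPt ζ) h
  rw [swapPt_swapPt] at this
  rw [this, int1_eq_int2_swap, swapPt_swapPt]
  rfl

end TensorSplines

/-! ### The unit square: slices, and primitives as contractions of L². -/

section Square

open Set MeasureTheory

/-- Lebesgue measure on the parametric domain. -/
noncomputable abbrev sq : Measure Pt := volume.restrict paramDomain

/-- Lebesgue measure on the unit interval. -/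
noncomputable abbrev unitMeas : Measure ℝ := volume.restrict (Ioo 0 1)

instance : IsProbabilityMeasure unitMeas := ⟨by simp [unitMeas]⟩

theorem paramDomain_eq_pi : paramDomain = univ.pi fun _ : Fin 2 => Ioo (0 : ℝ) 1 := by
  ext ζ; simp [paramDomain]

theorem isOpen_paramDomain : IsOpen paramDomain := by
  rw [paramDomain_eq_pi]; exact isOpen_set_pi finite_univ fun _ _ => isOpen_Ioo

theorem measurableSet_paramDomain : MeasurableSet paramDomain := isOpen_paramDomain.measurableSet

theorem cons_mem_paramDomain {s t : ℝ} :
    (![s, t] : Pt) ∈ paramDomain ↔ s ∈ Ioo (0 : ℝ) 1 ∧ t ∈ Ioo (0 : ℝ) 1 := by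
  simp [paramDomain, Fin.forall_fin_two]

theorem eta_pt (ζ : Pt) : ![ζ 0, ζ 1] = ζ := by ext i; fin_cases i <;> rfl

theorem measurePreserving_finTwoArrow_sq :
    MeasurePreserving (MeasurableEquiv.finTwoArrow (α := ℝ)) sq (unitMeas.prod unitMeas) := by
  have h := (volume_preserving_finTwoArrow ℝ).restrict_preimage
    (s := Ioo (0 : ℝ) 1 ×ˢ Ioo (0 : ℝ) 1) (measurableSet_Ioo.prod measurableSet_Ioo)
  have e : (MeasurableEquiv.finTwoArrow (α := ℝ)) ⁻¹' (Ioo (0 : ℝ) 1 ×ˢ Ioo (0 : ℝ) 1) =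
      paramDomain := by
    ext ζ; simp [paramDomain, Fin.forall_fin_two]
  rw [e] at h
  rwa [unitMeas, Measure.prod_restrict]

instance : IsProbabilityMeasure sq :=
  ⟨by
    rw [← measurePreserving_finTwoArrow_sq.measure_preimage MeasurableSet.univ.nullMeasurableSet
      |>.trans measure_univ, preimage_univ]⟩

theorem measurePreserving_symm_sq :
    MeasurePreserving (fun z : ℝ × ℝ => (![z.1, z.2] : Pt)) (unitMeas.prod unitMeas) sq :=
  measurePreserving_finTwoArrow_sq.symm _

theorem measurePreserving_symm_swap_sq :
    MeasurePreserving (fun z : ℝ × ℝ => (![z.2, z.1] : Pt)) (unitMeas.prod unitMeas) sq :=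
  measurePreserving_symm_sq.comp Measure.measurePreserving_swap

theorem measurePreserving_swapPt : MeasurePreserving swapPt sq sq := by
  have h := measurePreserving_symm_swap_sq.comp measurePreserving_finTwoArrow_sq
  exact h

theorem measurableEmbedding_swapPt : MeasurableEmbedding swapPt := by
  have : Measurable swapPt := by unfold swapPt; fun_prop
  exact (MeasurableEquiv.mk ⟨swapPt, swapPt, swapPt_swapPt, swapPt_swapPt⟩ this this).measurableEmbedding

theorem swapPt_mem {ζ : Pt} : swapPt ζ ∈ paramDomain ↔ ζ ∈ paramDomain := by
  simp [paramDomain, Fin.forall_fin_two, and_comm]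

theorem measurableEmbedding_symm_swap :
    MeasurableEmbedding (fun z : ℝ × ℝ => (![z.2, z.1] : Pt)) :=
  (MeasurableEquiv.prodComm.trans (MeasurableEquiv.finTwoArrow (α := ℝ)).symm).measurableEmbedding

theorem ae_slice {P : Pt → Prop} (h : ∀ᵐ ζ ∂sq, P ζ) :
    ∀ᵐ t ∂unitMeas, ∀ᵐ s ∂unitMeas, P ![s, t] :=
  Measure.ae_ae_of_ae_prod (measurePreserving_symm_swap_sq.quasiMeasurePreserving.ae h)

/-- Once a slice is integrable, its primitive is controlled at every endpoint `s`, so statements on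
primitives arise almost everywhere in `t` and everywhere in `s`. In this form no measurability of
`P` is needed. -/
theorem ae_of_forall_slice {P : Pt → Prop}
    (h : ∀ᵐ t ∂unitMeas, ∀ s ∈ Ioo (0 : ℝ) 1, P ![s, t]) : ∀ᵐ ζ ∂sq, P ζ := by
  have q : Measure.QuasiMeasurePreserving (fun ζ : Pt => ζ 1) sq unitMeas :=
    Measure.quasiMeasurePreserving_snd.comp
      measurePreserving_finTwoArrow_sq.quasiMeasurePreserving
  filter_upwards [q.ae h, ae_restrict_mem measurableSet_paramDomain] with ζ h1 h2
  have := h1 (ζ 0) (h2 0)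
  rwa [eta_pt] at this

theorem integrable_prod {g : Pt → ℝ} (hg : Integrable g sq) :
    Integrable (fun z : ℝ × ℝ => g ![z.2, z.1]) (unitMeas.prod unitMeas) :=
  measurePreserving_symm_swap_sq.integrable_comp_of_integrable hg

theorem integrable_slice {g : Pt → ℝ} (hg : Integrable g sq) :
    ∀ᵐ t ∂unitMeas, Integrable (fun s => g ![s, t]) unitMeas :=
  (integrable_prod hg).prod_right_ae

theorem integral_sq {g : Pt → ℝ} (hg : Integrable g sq) :
    ∫ ζ, g ζ ∂sq = ∫ t, ∫ s, g ![s, t] ∂unitMeas ∂unitMeas := by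
  rw [← measurePreserving_symm_swap_sq.integral_comp measurableEmbedding_symm_swap g,
    integral_prod _ (integrable_prod hg)]

theorem Ioc_subset_unit {s : ℝ} (hs : s ∈ Ioo (0 : ℝ) 1) : uIoc 0 s ⊆ Ioo (0 : ℝ) 1 := by
  rw [uIoc_of_le hs.1.le]
  exact fun x hx => ⟨hx.1, hx.2.trans_lt hs.2⟩

theorem intervalIntegrable_of_unit {g : ℝ → ℝ} (hg : Integrable g unitMeas) {s : ℝ}
    (hs : s ∈ Ioo (0 : ℝ) 1) : IntervalIntegrable g volume 0 s :=
  intervalIntegrable_iff.2 (IntegrableOn.mono_set (t := Ioo 0 1) hg (Ioc_subset_unit hs))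

theorem intervalIntegrable_unit {g : ℝ → ℝ} (hg : Integrable g unitMeas) :
    IntervalIntegrable g volume 0 1 := by
  rw [intervalIntegrable_iff, uIoc_of_le zero_le_one, integrableOn_Ioc_iff_integrableOn_Ioo]
  exact hg

theorem integral_unit (g : ℝ → ℝ) : ∫ s, g s ∂unitMeas = ∫ s in (0 : ℝ)..1, g s := by
  rw [intervalIntegral.integral_of_le zero_le_one, integral_Ioc_eq_integral_Ioo]

/-! ### The primitive in the first variable -/

theorem int1_congr {f g : Pt → ℝ} (h : f =ᵐ[sq] g) : int1 f =ᵐ[sq] int1 g := by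
  refine ae_of_forall_slice ?_
  filter_upwards [ae_slice h] with t ht s hs
  exact intervalIntegral.integral_congr_ae_restrict
    (ae_mono (Measure.restrict_mono (Ioc_subset_unit hs) le_rfl) ht)

theorem int1_congr_on {f g : Pt → ℝ} (h : ∀ ζ ∈ paramDomain, f ζ = g ζ) {ζ : Pt}
    (hζ : ζ ∈ paramDomain) : int1 f ζ = int1 g ζ := by
  refine intervalIntegral.integral_congr_ae (.of_forall fun t ht => h _ ?_)
  exact cons_mem_paramDomain.2 ⟨Ioc_subset_unit (hζ 0) ht, hζ 1⟩

theorem int1_add {f g : Pt → ℝ} (hf : Integrable f sq) (hg : Integrable g sq) :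
    int1 (fun ζ => f ζ + g ζ) =ᵐ[sq] fun ζ => int1 f ζ + int1 g ζ := by
  refine ae_of_forall_slice ?_
  filter_upwards [integrable_slice hf, integrable_slice hg] with t h1 h2 s hs
  exact intervalIntegral.integral_add (intervalIntegrable_of_unit h1 hs)
    (intervalIntegrable_of_unit h2 hs)

theorem int1_neg (f : Pt → ℝ) (ζ : Pt) : int1 (fun ξ => -f ξ) ζ = -int1 f ζ :=
  intervalIntegral.integral_neg

/-- The variable endpoint is absorbed in the indicator of a measurable set, so the primitive is a
parameter integral of a jointly measurable function. -/
theorem aestronglyMeasurable_int1 {g : Pt → ℝ} (hg : AEStronglyMeasurable g sq) :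
    AEStronglyMeasurable (int1 g) sq := by
  obtain ⟨g', hg', hgg'⟩ := hg
  have hs : MeasurableSet {z : Pt × ℝ | z.2 ∈ Ioc 0 (z.1 0)} := by
    have e : {z : Pt × ℝ | z.2 ∈ Ioc 0 (z.1 0)} = {z | 0 < z.2} ∩ {z | z.2 ≤ z.1 0} := rfl
    rw [e]
    exact (measurableSet_lt (by fun_prop) (by fun_prop)).inter
      (measurableSet_le (by fun_prop) (by fun_prop))
  have hm : StronglyMeasurable fun z : Pt × ℝ =>
      {z : Pt × ℝ | z.2 ∈ Ioc 0 (z.1 0)}.indicator (fun z => g' ![z.2, z.1 1]) z :=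
    StronglyMeasurable.indicator (hg'.comp_measurable (by fun_prop)) hs
  refine ⟨_, hm.integral_prod_right' (ν := volume), ?_⟩
  filter_upwards [int1_congr hgg', ae_restrict_mem measurableSet_paramDomain] with ζ h1 h2
  rw [h1, int1, intervalIntegral.integral_of_le (h2 0).1.le, ← integral_indicator measurableSet_Ioc]
  rfl

theorem sq_intervalIntegral_le {g : ℝ → ℝ} (hg : Integrable g unitMeas)
    (hg2 : Integrable (fun x => g x ^ 2) unitMeas) {s : ℝ} (hs : s ∈ Ioo (0 : ℝ) 1) :
    (∫ x in (0 : ℝ)..s, g x) ^ 2 ≤ ∫ x, g x ^ 2 ∂unitMeas := by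
  have h1 : |∫ x in (0 : ℝ)..s, g x| ≤ ∫ x, |g x| ∂unitMeas := by
    rw [intervalIntegral.integral_of_le hs.1.le]
    refine (abs_integral_le_integral_abs).trans ?_
    refine setIntegral_mono_set (s := Ioc 0 s) (t := Ioo 0 1) hg.abs
      (.of_forall fun x => abs_nonneg _) ?_
    have := Ioc_subset_unit hs
    rw [uIoc_of_le hs.1.le] at this
    exact this.eventuallyLE
  set c := ∫ x, |g x| ∂unitMeas
  -- Cauchy–Schwarz on a probability space, as nonnegativity of the variance of |g|.
  have h2 : 0 ≤ ∫ x, (|g x| - c) ^ 2 ∂unitMeas := integral_nonneg fun x => sq_nonneg _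
  have h3 : ∫ x, (|g x| - c) ^ 2 ∂unitMeas = ∫ x, g x ^ 2 ∂unitMeas - 2 * c * c + c ^ 2 := by
    have : ∀ x, (|g x| - c) ^ 2 = g x ^ 2 - 2 * c * |g x| + c ^ 2 := fun x => by
      rw [sub_sq, sq_abs]; ring
    simp only [this]
    have hi : Integrable (fun x => 2 * c * |g x|) unitMeas := hg.abs.const_mul _
    have hd : Integrable (fun x => g x ^ 2 - 2 * c * |g x|) unitMeas := hg2.sub hi
    rw [integral_add hd (integrable_const _), integral_sub hg2 hi, integral_const_mul]
    simp [c]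
  have h4 : (∫ x in (0 : ℝ)..s, g x) ^ 2 ≤ c ^ 2 := by
    rw [← sq_abs]
    exact pow_le_pow_left₀ (abs_nonneg _) h1 2
  nlinarith

theorem memLp_iff {g : Pt → ℝ} :
    MemLp g 2 sq ↔ AEStronglyMeasurable g sq ∧ Integrable (fun ζ => g ζ ^ 2) sq :=
  ⟨fun h => ⟨h.1, h.integrable_sq⟩, fun h => (memLp_two_iff_integrable_sq h.1).2 h.2⟩

theorem integrable_of_memLp {g : Pt → ℝ} (hg : MemLp g 2 sq) : Integrable g sq :=
  hg.integrable (by norm_num)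

theorem int1_sq_aux {g : Pt → ℝ} (hg : MemLp g 2 sq) :
    ∀ᵐ ζ ∂sq, int1 g ζ ^ 2 ≤ ∫ x, g ![x, ζ 1] ^ 2 ∂unitMeas := by
  refine ae_of_forall_slice ?_
  filter_upwards [integrable_slice (integrable_of_memLp hg),
    integrable_slice hg.integrable_sq] with t h1 h2 s hs
  exact sq_intervalIntegral_le h1 h2 hs

theorem integrable_slice_sq {g : Pt → ℝ} (hg : MemLp g 2 sq) :
    Integrable (fun ζ : Pt => ∫ x, g ![x, ζ 1] ^ 2 ∂unitMeas) sq := by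
  have h := ((integrable_prod hg.integrable_sq).integral_prod_left).comp_fst unitMeas
  rwa [← measurePreserving_symm_swap_sq.integrable_comp_emb measurableEmbedding_symm_swap]

theorem memLp_int1 {g : Pt → ℝ} (hg : MemLp g 2 sq) : MemLp (int1 g) 2 sq := by
  refine memLp_iff.2 ⟨aestronglyMeasurable_int1 hg.1, ?_⟩
  refine (integrable_slice_sq hg).mono' ((aestronglyMeasurable_int1 hg.1).pow 2) ?_
  filter_upwards [int1_sq_aux hg] with ζ h
  rwa [Real.norm_of_nonneg (sq_nonneg _)]

/-- Each primitive is dominated by the L² norm of the whole slice, which does not depend on the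
first coordinate; the interval has length one, so the constant is 1. -/
theorem integral_int1_sq_le {g : Pt → ℝ} (hg : MemLp g 2 sq) :
    ∫ ζ, int1 g ζ ^ 2 ∂sq ≤ ∫ ζ, g ζ ^ 2 ∂sq := by
  refine (integral_mono_ae (memLp_int1 hg).integrable_sq (integrable_slice_sq hg)
    (int1_sq_aux hg)).trans_eq ?_
  rw [integral_sq (integrable_slice_sq hg), integral_sq hg.integrable_sq]
  simp

theorem memLp_swap {g : Pt → ℝ} (hg : MemLp g 2 sq) : MemLp (fun ζ => g (swapPt ζ)) 2 sq :=
  hg.comp_measurePreserving measurePreserving_swapPt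

theorem integral_swap (g : Pt → ℝ) : ∫ ζ, g (swapPt ζ) ∂sq = ∫ ζ, g ζ ∂sq :=
  measurePreserving_swapPt.integral_comp measurableEmbedding_swapPt g

theorem ae_swap {P : Pt → Prop} (h : ∀ᵐ ζ ∂sq, P ζ) : ∀ᵐ ζ ∂sq, P (swapPt ζ) :=
  measurePreserving_swapPt.quasiMeasurePreserving.ae h

theorem memLp_int2 {g : Pt → ℝ} (hg : MemLp g 2 sq) : MemLp (int2 g) 2 sq :=
  memLp_swap (memLp_int1 (memLp_swap hg))

theorem integral_int2_sq_le {g : Pt → ℝ} (hg : MemLp g 2 sq) :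
    ∫ ζ, int2 g ζ ^ 2 ∂sq ≤ ∫ ζ, g ζ ^ 2 ∂sq := by
  have h1 := integral_swap fun ζ => int1 (fun ξ => g (swapPt ξ)) ζ ^ 2
  have h2 := integral_swap fun ζ => g ζ ^ 2
  have h3 := integral_int1_sq_le (memLp_swap hg)
  rw [← h1, h2] at h3
  exact h3

theorem int2_congr_on {f g : Pt → ℝ} (h : ∀ ζ ∈ paramDomain, f ζ = g ζ) {ζ : Pt}
    (hζ : ζ ∈ paramDomain) : int2 f ζ = int2 g ζ := by
  simp only [int2_eq_int1_swap]
  exact int1_congr_on (fun ξ hξ => h _ (swapPt_mem.2 hξ)) (swapPt_mem.2 hζ)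

theorem int1_int2_comm {g : Pt → ℝ} (hg : Integrable g sq) {ζ : Pt} (hζ : ζ ∈ paramDomain) :
    int1 (int2 g) ζ = int2 (int1 g) ζ := by
  have h0 := Ioc_subset_unit (hζ 0)
  have h1 := Ioc_subset_unit (hζ 1)
  rw [uIoc_of_le (hζ 0).1.le] at h0
  rw [uIoc_of_le (hζ 1).1.le] at h1
  simp only [int1, int2, intervalIntegral.integral_of_le (hζ 0).1.le, Matrix.cons_val_zero,
    Matrix.cons_val_one, intervalIntegral.integral_of_le (hζ 1).1.le]
  refine integral_integral_swap ?_
  have h := measurePreserving_symm_sq.integrable_comp_of_integrable hg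
  rw [unitMeas, Measure.prod_restrict] at h
  rw [Measure.prod_restrict]
  exact IntegrableOn.mono_set (t := Ioo 0 1 ×ˢ Ioo 0 1) h (prod_mono h0 h1)

end Square

/-! ### Bounded C¹ coefficients, test functions and integration by parts. -/

section Coefficients

open Set MeasureTheory

/-! ### Integration by parts -/

/-- Product rule for absolutely continuous functions. The difficulty is that nothing is assumed on
`a` at the endpoint 0; only the bound on its derivative in the open interval is available. -/
theorem integral_primitive_mul {a a' g : ℝ → ℝ} {C : ℝ}
    (ha : ∀ x ∈ Ioo (0 : ℝ) 1, HasDerivAt a (a' x) x) (ha' : ContinuousOn a' (Ioo 0 1))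
    (hC : ∀ x ∈ Ioo (0 : ℝ) 1, |a' x| ≤ C) (hg : Integrable g unitMeas) {s : ℝ}
    (hs : s ∈ Ioo (0 : ℝ) 1) :
    ∫ x in (0 : ℝ)..s, (a x * g x + a' x * ∫ y in (0 : ℝ)..x, g y) =
      a s * ∫ y in (0 : ℝ)..s, g y := by
  have hint : Integrable a' unitMeas :=
    Integrable.of_bound (ha'.aestronglyMeasurable measurableSet_Ioo) C
      ((ae_restrict_iff' measurableSet_Ioo).2 (.of_forall hC))
  have hi := intervalIntegrable_of_unit hint hs
  have hgi := intervalIntegrable_of_unit hg hs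
  have h0 : (0 : ℝ) ∈ uIcc 0 s := left_mem_uIcc
  set b : ℝ → ℝ := fun x => ∫ y in (0 : ℝ)..x, g y with hb
  -- The absolutely continuous extension of `a` to 0, recovered from its value at `s`.
  set α : ℝ → ℝ := fun x => (a s - ∫ y in (0 : ℝ)..s, a' y) + ∫ y in (0 : ℝ)..x, a' y with hα
  have hαac : AbsolutelyContinuousOnInterval α 0 s :=
    (LipschitzOnWith.absolutelyContinuousOnInterval
      (f := fun _ => a s - ∫ y in (0 : ℝ)..s, a' y) (K := 0) (by simp [LipschitzOnWith])).add
      (hi.absolutelyContinuousOnInterval_intervalIntegral h0)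
  have hbac := hgi.absolutelyContinuousOnInterval_intervalIntegral h0
  have hαa : ∀ x ∈ Ioc 0 s, α x = a x := by
    intro x hx
    have hsub : uIcc x s ⊆ Ioo 0 1 := by
      rw [uIcc_of_le hx.2]; exact fun y hy => ⟨hx.1.trans_le hy.1, hy.2.trans_lt hs.2⟩
    have hxs : IntervalIntegrable a' volume x s := (ha'.mono hsub).intervalIntegrable
    have h1 := intervalIntegral.integral_eq_sub_of_hasDerivAt (fun y hy => ha y (hsub hy)) hxs
    have h2 := intervalIntegral.integral_add_adjacent_intervals
      (hi.trans hxs.symm) hxs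
    simp only [hα]
    linarith
  have key := hαac.integral_deriv_mul_eq_sub hbac
  have e1 : α s = a s := hαa s ⟨hs.1, le_rfl⟩
  rw [e1, intervalIntegral.integral_same, mul_zero, sub_zero] at key
  rw [← key]
  refine intervalIntegral.integral_congr_ae ?_
  filter_upwards [hgi.ae_hasDerivAt_integral, hi.ae_hasDerivAt_integral] with x h1 h2 hx
  have hx' := uIoc_subset_uIcc hx
  have h3 : deriv b x = g x := (h1 hx' 0 h0).deriv
  have h4 : deriv α x = a' x := ((h2 hx' 0 h0).const_add _).deriv
  rw [uIoc_of_le hs.1.le] at hx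
  rw [h3, h4, hαa x hx]
  ring

theorem integral_primitive_mul_deriv {g ψ : ℝ → ℝ} (hg : IntervalIntegrable g volume 0 1)
    (hψ : ContDiff ℝ 1 ψ) (h0 : ψ 0 = 0) (h1 : ψ 1 = 0) (c : ℝ) :
    ∫ s in (0 : ℝ)..1, (c + ∫ x in (0 : ℝ)..s, g x) * deriv ψ s =
      -∫ s in (0 : ℝ)..1, g s * ψ s := by
  have hm : (0 : ℝ) ∈ uIcc (0 : ℝ) 1 := left_mem_uIcc
  have hac : AbsolutelyContinuousOnInterval (fun s => c + ∫ x in (0 : ℝ)..s, g x) 0 1 :=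
    (LipschitzOnWith.absolutelyContinuousOnInterval
      (f := fun _ => c) (K := 0) (by simp [LipschitzOnWith])).add
      (hg.absolutelyContinuousOnInterval_intervalIntegral hm)
  rw [hac.integral_mul_deriv_eq_deriv_mul hψ.contDiffOn.absolutelyContinuousOnInterval, h0, h1,
    mul_zero, mul_zero, sub_zero, zero_sub]
  congr 1
  refine intervalIntegral.integral_congr_ae ?_
  filter_upwards [hg.ae_hasDerivAt_integral] with x hx h
  rw [((hx (uIoc_subset_uIcc h) 0 hm).const_add c).deriv]

/-! ### Bounded coefficients -/

/-- Bounded measurable functions on the parametric domain. -/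
def BddMeas (a : Pt → ℝ) : Prop :=
  AEStronglyMeasurable a sq ∧ ∃ C : ℝ, ∀ ζ ∈ paramDomain, |a ζ| ≤ C

/-- Functions on the parametric domain which are continuously differentiable and bounded together
with their first derivatives. -/
def IsCoef (a : Pt → ℝ) : Prop :=
  ContDiffOn ℝ 1 a paramDomain ∧ ∃ C : ℝ, ∀ ζ ∈ paramDomain, |a ζ| ≤ C ∧ ∀ k, |pd k a ζ| ≤ C

theorem BddMeas.memLp_mul {a g : Pt → ℝ} (ha : BddMeas a) (hg : MemLp g 2 sq) :
    MemLp (fun ζ => a ζ * g ζ) 2 sq := by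
  obtain ⟨h, C, hC⟩ := ha
  refine MemLp.of_le_mul (c := C) hg (h.mul hg.1) ?_
  filter_upwards [ae_restrict_mem measurableSet_paramDomain] with ζ hζ
  rw [norm_mul]
  exact mul_le_mul_of_nonneg_right (hC ζ hζ) (norm_nonneg _)

theorem BddMeas.memLp {a : Pt → ℝ} (ha : BddMeas a) : MemLp a 2 sq := by
  have := ha.memLp_mul (memLp_const 1)
  simpa using this

theorem mem_nhds_paramDomain {ζ : Pt} (hζ : ζ ∈ paramDomain) : paramDomain ∈ nhds ζ :=
  isOpen_paramDomain.mem_nhds hζ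

theorem differentiableAt_of_contDiffOn {a : Pt → ℝ} (ha : ContDiffOn ℝ 1 a paramDomain) {ζ : Pt}
    (hζ : ζ ∈ paramDomain) : DifferentiableAt ℝ a ζ :=
  (ha.contDiffAt (mem_nhds_paramDomain hζ)).differentiableAt (by norm_num)

theorem continuousOn_pd {a : Pt → ℝ} (ha : ContDiffOn ℝ 1 a paramDomain) (k : Fin 2) :
    ContinuousOn (pd k a) paramDomain :=
  (ha.continuousOn_fderiv_of_isOpen isOpen_paramDomain (by norm_num)).clm_apply
    continuousOn_const

theorem IsCoef.bddMeas {a : Pt → ℝ} (ha : IsCoef a) : BddMeas a :=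
  ⟨ha.1.continuousOn.aestronglyMeasurable measurableSet_paramDomain,
    ha.2.imp fun _ h ζ hζ => (h ζ hζ).1⟩

theorem IsCoef.bddMeas_pd {a : Pt → ℝ} (ha : IsCoef a) (k : Fin 2) : BddMeas (pd k a) :=
  ⟨(continuousOn_pd ha.1 k).aestronglyMeasurable measurableSet_paramDomain,
    ha.2.imp fun _ h ζ hζ => (h ζ hζ).2 k⟩

theorem pd_congr {a b : Pt → ℝ} (h : ∀ ζ ∈ paramDomain, a ζ = b ζ) (k : Fin 2) {ζ : Pt}
    (hζ : ζ ∈ paramDomain) : pd k a ζ = pd k b ζ := by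
  unfold pd
  rw [Filter.EventuallyEq.fderiv_eq]
  filter_upwards [mem_nhds_paramDomain hζ] with ξ hξ using h ξ hξ

theorem pd_mul {a b : Pt → ℝ} {k : Fin 2} {ζ : Pt} (ha : DifferentiableAt ℝ a ζ)
    (hb : DifferentiableAt ℝ b ζ) :
    pd k (fun ξ => a ξ * b ξ) ζ = pd k a ζ * b ζ + a ζ * pd k b ζ := by
  unfold pd
  rw [fderiv_fun_mul ha hb]
  simp
  ring

theorem pd_add {a b : Pt → ℝ} {k : Fin 2} {ζ : Pt} (ha : DifferentiableAt ℝ a ζ)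
    (hb : DifferentiableAt ℝ b ζ) :
    pd k (fun ξ => a ξ + b ξ) ζ = pd k a ζ + pd k b ζ := by
  unfold pd
  rw [fderiv_fun_add ha hb]
  simp

theorem pd_neg {a : Pt → ℝ} {k : Fin 2} {ζ : Pt} :
    pd k (fun ξ => -a ξ) ζ = -pd k a ζ := by
  unfold pd
  rw [fderiv_fun_neg]
  simp

theorem IsCoef.mul {a b : Pt → ℝ} (ha : IsCoef a) (hb : IsCoef b) :
    IsCoef fun ζ => a ζ * b ζ := by
  obtain ⟨h, C, hC⟩ := ha
  obtain ⟨h', C', hC'⟩ := hb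
  refine ⟨h.mul h', 2 * (C * C'), fun ζ hζ => ?_⟩
  obtain ⟨h1, h2⟩ := hC ζ hζ
  obtain ⟨h1', h2'⟩ := hC' ζ hζ
  have hC0 : 0 ≤ C := (abs_nonneg _).trans h1
  have hC0' : 0 ≤ C' := (abs_nonneg _).trans h1'
  refine ⟨?_, fun k => ?_⟩
  · rw [abs_mul]
    have := mul_le_mul h1 h1' (abs_nonneg _) hC0
    have := mul_nonneg hC0 hC0'
    linarith
  · rw [pd_mul (differentiableAt_of_contDiffOn h hζ) (differentiableAt_of_contDiffOn h' hζ)]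
    refine (abs_add_le _ _).trans ?_
    rw [abs_mul, abs_mul]
    have := mul_le_mul (h2 k) h1' (abs_nonneg _) hC0
    have := mul_le_mul h1 (h2' k) (abs_nonneg _) hC0
    linarith

theorem IsCoef.add {a b : Pt → ℝ} (ha : IsCoef a) (hb : IsCoef b) :
    IsCoef fun ζ => a ζ + b ζ := by
  obtain ⟨h, C, hC⟩ := ha
  obtain ⟨h', C', hC'⟩ := hb
  refine ⟨h.add h', C + C', fun ζ hζ => ⟨?_, fun k => ?_⟩⟩
  · exact (abs_add_le _ _).trans (add_le_add (hC ζ hζ).1 (hC' ζ hζ).1)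
  · rw [pd_add (differentiableAt_of_contDiffOn h hζ) (differentiableAt_of_contDiffOn h' hζ)]
    exact (abs_add_le _ _).trans (add_le_add ((hC ζ hζ).2 k) ((hC' ζ hζ).2 k))

theorem IsCoef.neg {a : Pt → ℝ} (ha : IsCoef a) : IsCoef fun ζ => -a ζ := by
  obtain ⟨h, C, hC⟩ := ha
  exact ⟨h.neg, C, fun ζ hζ => by simpa only [abs_neg, pd_neg] using hC ζ hζ⟩

theorem IsCoef.sub {a b : Pt → ℝ} (ha : IsCoef a) (hb : IsCoef b) :
    IsCoef fun ζ => a ζ - b ζ := by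
  simpa only [sub_eq_add_neg] using ha.add hb.neg

theorem IsCoef.inv {a : Pt → ℝ} (ha : IsCoef a) {c : ℝ} (hc : 0 < c)
    (h : ∀ ζ ∈ paramDomain, c ≤ |a ζ|) : IsCoef fun ζ => (a ζ)⁻¹ := by
  obtain ⟨h', C, hC⟩ := ha
  have hne : ∀ ζ ∈ paramDomain, a ζ ≠ 0 := fun ζ hζ => abs_pos.1 (hc.trans_le (h ζ hζ))
  have hle : ∀ ζ ∈ paramDomain, |(a ζ)⁻¹| ≤ c⁻¹ := fun ζ hζ => by
    rw [abs_inv]; exact inv_anti₀ hc (h ζ hζ)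
  refine ⟨h'.inv hne, c⁻¹ + c⁻¹ * c⁻¹ * C, fun ζ hζ => ?_⟩
  have hC0 : 0 ≤ C := (abs_nonneg _).trans (hC ζ hζ).1
  have hc0 : 0 < c⁻¹ := inv_pos.2 hc
  refine ⟨(hle ζ hζ).trans (by have := mul_nonneg (mul_pos hc0 hc0).le hC0; linarith), fun k => ?_⟩
  have hd := differentiableAt_of_contDiffOn h' hζ
  have hdi : DifferentiableAt ℝ (fun ξ => (a ξ)⁻¹) ζ :=
    differentiableAt_of_contDiffOn (h'.inv hne) hζ
  have h1 : pd k (fun ξ => a ξ * (a ξ)⁻¹) ζ = 0 := by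
    rw [pd_congr (b := fun _ => 1) (fun ξ hξ => mul_inv_cancel₀ (hne ξ hξ)) k hζ]
    simp [pd]
  rw [pd_mul hd hdi] at h1
  have h2 : pd k (fun ξ => (a ξ)⁻¹) ζ = -((a ζ)⁻¹ * (a ζ)⁻¹ * pd k a ζ) := by
    have := hne ζ hζ
    have h3 : pd k (fun ξ => (a ξ)⁻¹) ζ = (a ζ)⁻¹ * (a ζ * pd k (fun ξ => (a ξ)⁻¹) ζ) := by
      field_simp
    rw [h3, show a ζ * pd k (fun ξ => (a ξ)⁻¹) ζ = -(pd k a ζ * (a ζ)⁻¹) by linarith]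
    ring
  rw [h2, abs_neg, abs_mul, abs_mul]
  have := mul_le_mul (mul_le_mul (hle ζ hζ) (hle ζ hζ) (abs_nonneg _) hc0.le) ((hC ζ hζ).2 k)
    (abs_nonneg _) (mul_pos hc0 hc0).le
  linarith

theorem IsCoef.congr_on {a b : Pt → ℝ} (ha : IsCoef a) (h : ∀ ζ ∈ paramDomain, a ζ = b ζ) :
    IsCoef b := by
  obtain ⟨h', C, hC⟩ := ha
  refine ⟨h'.congr fun ζ hζ => (h ζ hζ).symm, C, fun ζ hζ => ?_⟩
  rw [← h ζ hζ]
  exact ⟨(hC ζ hζ).1, fun k => pd_congr h k hζ ▸ (hC ζ hζ).2 k⟩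

theorem hasDerivAt_slice {a : Pt → ℝ} {s t : ℝ} (ha : DifferentiableAt ℝ a ![s, t]) :
    HasDerivAt (fun x => a ![x, t]) (pd 0 a ![s, t]) s := by
  have h1 : HasDerivAt (fun x : ℝ => (![x, t] : Pt)) (Pi.single 0 1) s := by
    refine hasDerivAt_pi.2 fun i => ?_
    fin_cases i
    · simpa using hasDerivAt_id' s
    · simpa using hasDerivAt_const s t
  exact ha.hasFDerivAt.comp_hasDerivAt s h1

theorem continuousOn_slice {a : Pt → ℝ} (ha : ContinuousOn a paramDomain) {t : ℝ}
    (ht : t ∈ Ioo (0 : ℝ) 1) : ContinuousOn (fun s => a ![s, t]) (Ioo 0 1) :=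
  ha.comp (by fun_prop) fun _ hs => cons_mem_paramDomain.2 ⟨hs, ht⟩

/-- The product rule for primitives: `∫_0^{ζ₁} (a g + ∂₁a ∫_0^{ζ₁} g) = a ∫_0^{ζ₁} g`. -/
theorem int1_product {a g : Pt → ℝ} (ha : IsCoef a) (hg : Integrable g sq) :
    int1 (fun ζ => a ζ * g ζ + pd 0 a ζ * int1 g ζ) =ᵐ[sq] fun ζ => a ζ * int1 g ζ := by
  refine ae_of_forall_slice ?_
  filter_upwards [integrable_slice hg, ae_restrict_mem measurableSet_Ioo] with t h1 ht s hs
  obtain ⟨h, C, hC⟩ := ha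
  exact integral_primitive_mul (a := fun s => a ![s, t]) (a' := fun s => pd 0 a ![s, t])
    (g := fun s => g ![s, t])
    (fun x hx => hasDerivAt_slice
      (differentiableAt_of_contDiffOn h (cons_mem_paramDomain.2 ⟨hx, ht⟩)))
    (continuousOn_slice (continuousOn_pd h 0) ht)
    (fun x hx => (hC _ (cons_mem_paramDomain.2 ⟨hx, ht⟩)).2 0) h1 hs

/-! ### Test functions -/

/-- Continuously differentiable functions with compact support in the parametric domain. -/
structure IsTest (ψ : Pt → ℝ) : Prop where
  contDiff : ContDiff ℝ 1 ψ
  hasCompactSupport : HasCompactSupport ψ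
  tsupport_subset : tsupport ψ ⊆ paramDomain

theorem IsTest.continuous_pd {ψ : Pt → ℝ} (hψ : IsTest ψ) (k : Fin 2) : Continuous (pd k ψ) :=
  (hψ.contDiff.continuous_fderiv (by norm_num)).clm_apply continuous_const

theorem IsTest.bddMeas {ψ : Pt → ℝ} (hψ : IsTest ψ) : BddMeas ψ := by
  obtain ⟨C, hC⟩ := hψ.contDiff.continuous.bounded_above_of_compact_support hψ.hasCompactSupport
  exact ⟨hψ.contDiff.continuous.aestronglyMeasurable, C, fun ζ _ => hC ζ⟩

theorem IsTest.bddMeas_pd {ψ : Pt → ℝ} (hψ : IsTest ψ) (k : Fin 2) : BddMeas (pd k ψ) := by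
  obtain ⟨C, hC⟩ := (hψ.continuous_pd k).bounded_above_of_compact_support
    (hψ.hasCompactSupport.fderiv_apply ℝ _)
  exact ⟨(hψ.continuous_pd k).aestronglyMeasurable, C, fun ζ _ => hC ζ⟩

theorem IsTest.eq_zero {ψ : Pt → ℝ} (hψ : IsTest ψ) {ζ : Pt} (hζ : ζ ∉ paramDomain) : ψ ζ = 0 :=
  image_eq_zero_of_notMem_tsupport fun h => hζ (hψ.tsupport_subset h)

theorem contDiff_mul_of_tsupport_subset {n : WithTop ℕ∞} {a ψ : Pt → ℝ}
    (ha : ContDiffOn ℝ n a paramDomain) (hψ : ContDiff ℝ n ψ) (h : tsupport ψ ⊆ paramDomain) :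
    ContDiff ℝ n fun ζ => a ζ * ψ ζ := by
  refine contDiff_iff_contDiffAt.2 fun ζ => ?_
  by_cases hζ : ζ ∈ tsupport ψ
  · exact (ha.contDiffAt (mem_nhds_paramDomain (h hζ))).mul hψ.contDiffAt
  · refine (contDiffAt_const (c := (0 : ℝ))).congr_of_eventuallyEq ?_
    filter_upwards [(isClosed_tsupport ψ).isOpen_compl.mem_nhds hζ] with ξ hξ
    rw [image_eq_zero_of_notMem_tsupport hξ, mul_zero]

theorem IsTest.coef_mul {a ψ : Pt → ℝ} (hψ : IsTest ψ) (ha : ContDiffOn ℝ 1 a paramDomain) :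
    IsTest fun ζ => a ζ * ψ ζ :=
  ⟨contDiff_mul_of_tsupport_subset ha hψ.contDiff hψ.tsupport_subset,
    hψ.hasCompactSupport.mul_left, tsupport_mul_subset_right.trans hψ.tsupport_subset⟩

theorem IsTest.swap {ψ : Pt → ℝ} (hψ : IsTest ψ) : IsTest fun ζ => ψ (swapPt ζ) := by
  have hc : Continuous swapPt := by unfold swapPt; fun_prop
  have hd : ContDiff ℝ 1 swapPt := by
    rw [contDiff_pi]; intro i; fin_cases i <;> simp [swapPt] <;> fun_prop
  let e : Pt ≃ₜ Pt := ⟨⟨swapPt, swapPt, swapPt_swapPt, swapPt_swapPt⟩, hc, hc⟩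
  refine ⟨hψ.contDiff.comp hd, hψ.hasCompactSupport.comp_homeomorph e, fun ζ hζ => ?_⟩
  have h1 : swapPt ζ ∈ tsupport ψ := tsupport_comp_subset_preimage ψ hc hζ
  exact swapPt_mem.1 (hψ.tsupport_subset h1)

theorem pd_swap {ψ : Pt → ℝ} {ζ : Pt} (hψ : DifferentiableAt ℝ ψ (swapPt ζ)) :
    pd 0 (fun ξ => ψ (swapPt ξ)) ζ = pd 1 ψ (swapPt ζ) := by
  have h0 : DifferentiableAt ℝ (fun ξ => ψ (swapPt ξ)) ![ζ 0, ζ 1] := by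
    rw [eta_pt]
    refine hψ.comp ζ ?_
    refine differentiableAt_pi.2 fun i => ?_
    fin_cases i <;> simp [swapPt] <;> fun_prop
  have h1 := hasDerivAt_slice h0
  rw [eta_pt] at h1
  have h2 : HasDerivAt (fun x : ℝ => (![ζ 1, x] : Pt)) (Pi.single 1 1) (ζ 0) := by
    refine hasDerivAt_pi.2 fun i => ?_
    fin_cases i
    · simpa using hasDerivAt_const (ζ 0) (ζ 1)
    · simpa using hasDerivAt_id' (ζ 0)
  have h3 := HasFDerivAt.comp_hasDerivAt (ζ 0) (f := fun x : ℝ => (![ζ 1, x] : Pt))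
    (l := ψ) (l' := fderiv ℝ ψ (swapPt ζ)) hψ.hasFDerivAt h2
  exact h1.unique h3

/-- Being a function of the other variable plus a primitive of `g` means having weak derivative `g`:
integrate by parts on almost every slice. No regularity of `c` is needed, as it is constant on each
slice. -/
theorem integral_mul_pd_zero {f g ψ : Pt → ℝ} {c : ℝ → ℝ} (hf : MemLp f 2 sq) (hg : MemLp g 2 sq)
    (hfg : f =ᵐ[sq] fun ζ => c (ζ 1) + int1 g ζ) (hψ : IsTest ψ) :
    ∫ ζ, f ζ * pd 0 ψ ζ ∂sq = -∫ ζ, g ζ * ψ ζ ∂sq := by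
  have i1 : Integrable (fun ζ => f ζ * pd 0 ψ ζ) sq := by
    simpa only [mul_comm] using integrable_of_memLp ((hψ.bddMeas_pd 0).memLp_mul hf)
  have i2 : Integrable (fun ζ => g ζ * ψ ζ) sq := by
    simpa only [mul_comm] using integrable_of_memLp (hψ.bddMeas.memLp_mul hg)
  rw [integral_sq i1, integral_sq i2, ← integral_neg]
  refine integral_congr_ae ?_
  filter_upwards [ae_slice hfg, integrable_slice (integrable_of_memLp hg)] with t h1 h2
  have hd : ∀ s, HasDerivAt (fun x => ψ ![x, t]) (pd 0 ψ ![s, t]) s := fun s =>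
    hasDerivAt_slice (hψ.contDiff.differentiable (by norm_num) _)
  have h3 := integral_primitive_mul_deriv (g := fun s => g ![s, t]) (ψ := fun s => ψ ![s, t])
    (intervalIntegrable_unit h2) (hψ.contDiff.comp (by
      rw [contDiff_pi]; intro i; fin_cases i <;> simp <;> fun_prop))
    (hψ.eq_zero (by simp [cons_mem_paramDomain])) (hψ.eq_zero (by simp [cons_mem_paramDomain]))
    (c t)
  rw [← integral_unit, ← integral_unit] at h3
  rw [← h3]
  refine integral_congr_ae ?_
  filter_upwards [h1] with s hs
  rw [hs, (hd s).deriv]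
  rfl

theorem integral_mul_pd_one {f g ψ : Pt → ℝ} {c : ℝ → ℝ} (hf : MemLp f 2 sq) (hg : MemLp g 2 sq)
    (hfg : f =ᵐ[sq] fun ζ => c (ζ 0) + int2 g ζ) (hψ : IsTest ψ) :
    ∫ ζ, f ζ * pd 1 ψ ζ ∂sq = -∫ ζ, g ζ * ψ ζ ∂sq := by
  rw [← integral_swap, ← integral_swap fun ζ => g ζ * ψ ζ,
    ← integral_mul_pd_zero (c := c) (memLp_swap hf) (memLp_swap hg) ?_ hψ.swap]
  · simp only [pd_swap (hψ.contDiff.differentiable (by norm_num) _)]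
  · filter_upwards [ae_swap hfg] with ζ hζ
    rw [hζ, int2_eq_int1_swap, swapPt_swapPt]
    rfl

end Coefficients

/-! ### The parametrization: bounds up to the boundary, change of variables, pulled-back test
functions. -/

section Geometry

open Set MeasureTheory Filter Topology

/-- Derivatives within `closure U` need not be unique at the boundary. Each boundary point still has
a neighbourhood with some continuous field of derivatives; this is locally bounded and agrees with
`fderiv` inside `U`, and compactness gives a global bound. -/
theorem exists_norm_fderiv_le {E : Type*} [NormedAddCommGroup E] [NormedSpace ℝ E] {U : Set Pt}
    (hU : IsOpen U) (hc : IsCompact (closure U)) {f : Pt → E} (hf : ContDiffOn ℝ 1 f (closure U)) :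
    ∃ C : ℝ, ∀ x ∈ U, ‖fderiv ℝ f x‖ ≤ C := by
  suffices h : ∃ C : ℝ, ∀ x ∈ U ∩ closure U, ‖fderiv ℝ f x‖ ≤ C by
    obtain ⟨C, hC⟩ := h
    exact ⟨C, fun x hx => hC x ⟨hx, subset_closure hx⟩⟩
  refine hc.induction_on (p := fun s => ∃ C : ℝ, ∀ x ∈ U ∩ s, ‖fderiv ℝ f x‖ ≤ C) ⟨0, by simp⟩
    ?_ ?_ ?_
  · rintro s t hst ⟨C, hC⟩
    exact ⟨C, fun x hx => hC x ⟨hx.1, hst hx.2⟩⟩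
  · rintro s t ⟨C, hC⟩ ⟨D, hD⟩
    refine ⟨max C D, fun x hx => ?_⟩
    rcases hx.2 with h | h
    · exact (hC x ⟨hx.1, h⟩).trans (le_max_left _ _)
    · exact (hD x ⟨hx.1, h⟩).trans (le_max_right _ _)
  · intro x hx
    obtain ⟨u, hu, -, f', hf', hcont⟩ :=
      (contDiffWithinAt_succ_iff_hasFDerivWithinAt (n := 0) (by simp)).1 (by simpa using hf x hx)
    rw [insert_eq_of_mem hx] at hu
    have hb : ∀ᶠ y in 𝓝[insert x u] x, ‖f' y‖ < ‖f' x‖ + 1 :=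
      (hcont.continuousWithinAt.insert.norm).eventually_lt_const (by linarith)
    obtain ⟨V, hV, hxV, hVu⟩ := mem_nhdsWithin.1 hu
    obtain ⟨W, hW, hxW, hWu⟩ := mem_nhdsWithin.1 hb
    refine ⟨V ∩ W, mem_nhdsWithin_of_mem_nhds ((hV.inter hW).mem_nhds ⟨hxV, hxW⟩), ‖f' x‖ + 1, ?_⟩
    rintro y ⟨hyU, hyV, hyW⟩
    have hyu : y ∈ u := hVu ⟨hyV, subset_closure hyU⟩
    have hnu : u ∈ 𝓝 y := by
      filter_upwards [(hU.inter hV).mem_nhds ⟨hyU, hyV⟩] with z hz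
      exact hVu ⟨hz.2, subset_closure hz.1⟩
    rw [((hf' y hyu).hasFDerivAt hnu).fderiv]
    exact le_of_lt (hWu ⟨hyW, mem_insert_of_mem _ hyu⟩)

theorem convex_paramDomain : Convex ℝ paramDomain := by
  rw [paramDomain_eq_pi]; exact convex_pi fun _ _ => convex_Ioo 0 1

theorem isCompact_closure_paramDomain : IsCompact (closure paramDomain) := by
  refine IsCompact.closure_of_subset
    (isCompact_univ_pi fun _ : Fin 2 => isCompact_Icc (a := (0 : ℝ)) (b := 1)) ?_
  rw [paramDomain_eq_pi]
  exact pi_mono fun _ _ => Ioo_subset_Icc_self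

theorem nonempty_paramDomain : paramDomain.Nonempty := ⟨fun _ => 1 / 2, fun _ => by norm_num⟩

theorem uniqueDiffOn_closure_paramDomain : UniqueDiffOn ℝ (closure paramDomain) := by
  refine uniqueDiffOn_convex convex_paramDomain.closure ?_
  exact nonempty_paramDomain.mono (interior_maximal subset_closure isOpen_paramDomain)

theorem norm_single_le (k : Fin 2) : ‖(Pi.single k 1 : Pt)‖ ≤ 1 := by
  rw [pi_norm_le_iff_of_nonneg zero_le_one]
  intro i
  by_cases h : i = k
  · subst h; simp
  · simp [h]

theorem abs_pd_le (a : Pt → ℝ) (k : Fin 2) (ζ : Pt) : |pd k a ζ| ≤ ‖fderiv ℝ a ζ‖ := by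
  refine ((fderiv ℝ a ζ).le_opNorm _).trans ?_
  exact mul_le_of_le_one_right (norm_nonneg _) (norm_single_le k)

theorem isCoef_of_contDiffOn_closure {a : Pt → ℝ} (ha : ContDiffOn ℝ 1 a (closure paramDomain)) :
    IsCoef a := by
  obtain ⟨C, hC⟩ := isCompact_closure_paramDomain.exists_bound_of_continuousOn ha.continuousOn
  obtain ⟨D, hD⟩ := exists_norm_fderiv_le isOpen_paramDomain isCompact_closure_paramDomain ha
  refine ⟨ha.mono subset_closure, max C D, fun ζ hζ => ⟨?_, fun k => ?_⟩⟩
  · exact (hC ζ (subset_closure hζ)).trans (le_max_left _ _)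
  · exact (abs_pd_le a k ζ).trans ((hD ζ hζ).trans (le_max_right _ _))

theorem pd_apply {f : Pt → Pt} {x : Pt} (hf : DifferentiableAt ℝ f x) (k i : Fin 2) :
    pd k (fun y => f y i) x = fderiv ℝ f x (Pi.single k 1) i := by
  have h := hasFDerivAt_pi'.1 hf.hasFDerivAt i
  unfold pd
  rw [h.fderiv]
  rfl

theorem apply_eq_sum_single (L : Pt →L[ℝ] ℝ) (v : Pt) : L v = ∑ k, v k * L (Pi.single k 1) := by
  conv_lhs => rw [← eta_pt v]
  have : (![v 0, v 1] : Pt) = v 0 • Pi.single 0 1 + v 1 • Pi.single 1 1 := by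
    ext i; fin_cases i <;> simp
  rw [this, map_add, map_smul, map_smul, Fin.sum_univ_two]
  rfl

theorem pd_comp {a : Pt → ℝ} {f : Pt → Pt} {x : Pt} (hf : DifferentiableAt ℝ f x)
    (ha : DifferentiableAt ℝ a (f x)) (l : Fin 2) :
    pd l (fun y => a (f y)) x = ∑ k, pd k a (f x) * pd l (fun y => f y k) x := by
  have h : pd l (fun y => a (f y)) x = fderiv ℝ a (f x) (fderiv ℝ f x (Pi.single l 1)) := by
    unfold pd
    have hc : HasFDerivAt (fun y => a (f y)) ((fderiv ℝ a (f x)).comp (fderiv ℝ f x)) x :=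
      ha.hasFDerivAt.comp x hf.hasFDerivAt
    rw [hc.fderiv]
    rfl
  rw [h, apply_eq_sum_single]
  refine Finset.sum_congr rfl fun k _ => ?_
  rw [pd_apply hf, mul_comm]
  rfl

theorem det_fderiv {f : Pt → Pt} {x : Pt} (hf : DifferentiableAt ℝ f x) :
    (fderiv ℝ f x).det = (jac f x).det := by
  have : LinearMap.toMatrix' (fderiv ℝ f x : Pt →ₗ[ℝ] Pt) = jac f x := by
    ext i j
    rw [LinearMap.toMatrix'_apply]
    simp only [jac, Matrix.of_apply, pd_apply hf]
    congr 2
  rw [← this, LinearMap.det_toMatrix']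

theorem mem_physDomain {F : Pt → Pt} {ζ : Pt} (hζ : ζ ∈ paramDomain) : F ζ ∈ physDomain F :=
  ⟨ζ, hζ, rfl⟩

namespace IsParametrization

variable {F G : Pt → Pt} (hF : IsParametrization F G)
include hF

theorem contDiffOn_two : ContDiffOn ℝ 2 F paramDomain :=
  (hF.contDiffOn.mono subset_closure).of_le (by norm_num)

theorem differentiableAt {ζ : Pt} (hζ : ζ ∈ paramDomain) : DifferentiableAt ℝ F ζ :=
  (hF.contDiffOn_two.contDiffAt (mem_nhds_paramDomain hζ)).differentiableAt (by norm_num)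

theorem injOn : InjOn F paramDomain := fun x hx y hy h => by
  rw [← hF.left_inv x hx, ← hF.left_inv y hy, h]

theorem isCoef_jac (i j : Fin 2) : IsCoef fun ζ => jac F ζ i j := by
  have h1 : ContDiffOn ℝ 1 (fun ζ => fderivWithin ℝ F (closure paramDomain) ζ (Pi.single j 1) i)
      (closure paramDomain) := by
    have h := (hF.contDiffOn.fderivWithin (m := 1) uniqueDiffOn_closure_paramDomain
      (by norm_num)).clm_apply (contDiffOn_const (c := (Pi.single j 1 : Pt)))
    exact contDiffOn_pi.1 h i
  refine (isCoef_of_contDiffOn_closure h1).congr_on fun ζ hζ => ?_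
  rw [fderivWithin_of_mem_nhds (mem_of_superset (mem_nhds_paramDomain hζ) subset_closure)]
  simp only [jac, Matrix.of_apply]
  rw [pd_apply (hF.differentiableAt hζ)]

/-- Differentiating G∘F = id, with G differentiable only within the closure of the image, shows that
DF is injective and hence surjective; a strictly differentiable map with surjective derivative is
open. -/
theorem isOpen_physDomain : IsOpen (physDomain F) := by
  refine isOpen_iff_mem_nhds.2 ?_
  rintro _ ⟨ζ, hζ, rfl⟩
  have hs : HasStrictFDerivAt F (fderiv ℝ F ζ) ζ :=
    (hF.contDiffOn_two.contDiffAt (mem_nhds_paramDomain hζ)).hasStrictFDerivAt (by norm_num)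
  have hx : F ζ ∈ closure (physDomain F) := subset_closure ⟨ζ, hζ, rfl⟩
  have hG : HasFDerivWithinAt G (fderivWithin ℝ G (closure (physDomain F)) (F ζ))
      (closure (physDomain F)) (F ζ) :=
    ((hF.contDiffOn_inv _ hx).differentiableWithinAt (by norm_num)).hasFDerivWithinAt
  have hcomp := hG.comp ζ (hs.hasFDerivAt.hasFDerivWithinAt (s := paramDomain))
    fun ξ hξ => subset_closure ⟨ξ, hξ, rfl⟩
  have hid : HasFDerivAt (G ∘ F) (ContinuousLinearMap.id ℝ Pt) ζ := by
    refine (hasFDerivAt_id ζ).congr_of_eventuallyEq ?_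
    filter_upwards [mem_nhds_paramDomain hζ] with ξ hξ using hF.left_inv ξ hξ
  have he := (hcomp.hasFDerivAt (mem_nhds_paramDomain hζ)).unique hid
  have hinj : Function.Injective (fderiv ℝ F ζ : Pt →ₗ[ℝ] Pt) := by
    intro v w hvw
    have h1 := congrArg (fun L : Pt →L[ℝ] Pt => L v) he
    have h2 := congrArg (fun L : Pt →L[ℝ] Pt => L w) he
    simp only [ContinuousLinearMap.comp_apply, ContinuousLinearMap.id_apply] at h1 h2
    rw [← h1, ← h2]
    exact congrArg _ hvw
  have hsurj := LinearMap.range_eq_top.2 (LinearMap.injective_iff_surjective.1 hinj)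
  rw [← hs.map_nhds_eq_of_surj hsurj]
  exact image_mem_map (mem_nhds_paramDomain hζ)

theorem measurableSet_physDomain : MeasurableSet (physDomain F) :=
  hF.isOpen_physDomain.measurableSet

theorem isCompact_closure_physDomain : IsCompact (closure (physDomain F)) :=
  (isCompact_closure_paramDomain.image_of_continuousOn hF.contDiffOn.continuousOn).closure_of_subset
    (image_mono subset_closure)

theorem inv_mem {x : Pt} (hx : x ∈ physDomain F) : G x ∈ paramDomain := by
  obtain ⟨ζ, hζ, rfl⟩ := hx
  rwa [hF.left_inv ζ hζ]

theorem right_inv {x : Pt} (hx : x ∈ physDomain F) : F (G x) = x := by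
  obtain ⟨ζ, hζ, rfl⟩ := hx
  rw [hF.left_inv ζ hζ]

theorem differentiableAt_inv {x : Pt} (hx : x ∈ physDomain F) : DifferentiableAt ℝ G x :=
  (hF.contDiffOn_inv.contDiffAt (mem_of_superset (hF.isOpen_physDomain.mem_nhds hx)
    subset_closure)).differentiableAt (by norm_num)

theorem sum_pd_comp_inv {a : Pt → ℝ} {ζ : Pt} (hζ : ζ ∈ paramDomain)
    (ha : DifferentiableAt ℝ a ζ) (l : Fin 2) :
    ∑ k, pd k (fun y => a (G y)) (F ζ) * pd l (fun ξ => F ξ k) ζ = pd l a ζ := by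
  have hG := hF.differentiableAt_inv (mem_physDomain hζ)
  have ha' : DifferentiableAt ℝ a (G (F ζ)) := by rwa [hF.left_inv ζ hζ]
  have hd : DifferentiableAt ℝ (fun y => a (G y)) (F ζ) := ha'.comp (F ζ) hG
  rw [← pd_comp (hF.differentiableAt hζ) hd]
  exact pd_congr (fun ξ hξ => by rw [hF.left_inv ξ hξ]) l hζ

theorem jac_inv_mul_jac {ζ : Pt} (hζ : ζ ∈ paramDomain) : jac G (F ζ) * jac F ζ = 1 := by
  ext i l
  have h := hF.sum_pd_comp_inv hζ (a := fun ξ => ξ i) (by fun_prop) l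
  rw [Matrix.mul_apply]
  refine h.trans ?_
  have : pd l (fun ξ : Pt => ξ i) ζ = (Pi.single l 1 : Pt) i := by
    rw [pd_apply (f := fun ξ => ξ) differentiableAt_id]
    simp
  rw [this, Matrix.one_apply, Pi.single_apply]

/-- The entries of DG are bounded up to the boundary, hence so is det DG = 1/det DF. -/
theorem exists_le_abs_det : ∃ c > 0, ∀ ζ ∈ paramDomain, c ≤ |(jac F ζ).det| := by
  obtain ⟨C, hC⟩ := exists_norm_fderiv_le hF.isOpen_physDomain hF.isCompact_closure_physDomain
    (hF.contDiffOn_inv.of_le (by norm_num))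
  have hent : ∀ ζ ∈ paramDomain, ∀ i j, |jac G (F ζ) i j| ≤ C := by
    intro ζ hζ i j
    have hx : F ζ ∈ physDomain F := mem_physDomain hζ
    simp only [jac, Matrix.of_apply]
    rw [pd_apply (hF.differentiableAt_inv hx)]
    refine (norm_le_pi_norm (fderiv ℝ G (F ζ) (Pi.single j 1)) i).trans ?_
    refine ((fderiv ℝ G (F ζ)).le_opNorm _).trans ?_
    exact (mul_le_of_le_one_right (norm_nonneg _) (norm_single_le j)).trans (hC _ hx)
  have hC0 : 0 ≤ C := by
    obtain ⟨ζ, hζ⟩ := nonempty_paramDomain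
    exact (abs_nonneg _).trans (hent ζ hζ 0 0)
  refine ⟨(2 * (C * C) + 1)⁻¹, by positivity, fun ζ hζ => ?_⟩
  have h1 : |(jac G (F ζ)).det| * |(jac F ζ).det| = 1 := by
    rw [← abs_mul, ← Matrix.det_mul, hF.jac_inv_mul_jac hζ, Matrix.det_one, abs_one]
  have h2 : |(jac G (F ζ)).det| ≤ 2 * (C * C) + 1 := by
    rw [Matrix.det_fin_two]
    refine (abs_sub _ _).trans ?_
    rw [abs_mul, abs_mul]
    have := mul_le_mul (hent ζ hζ 0 0) (hent ζ hζ 1 1) (abs_nonneg _) hC0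
    have := mul_le_mul (hent ζ hζ 0 1) (hent ζ hζ 1 0) (abs_nonneg _) hC0
    linarith
  refine (inv_le_iff_one_le_mul₀ (by positivity)).2 (h1.symm.le.trans ?_)
  rw [mul_comm]
  exact mul_le_mul_of_nonneg_left h2 (abs_nonneg _)

theorem det_ne_zero {ζ : Pt} (hζ : ζ ∈ paramDomain) : (jac F ζ).det ≠ 0 := by
  obtain ⟨c, hc, h⟩ := hF.exists_le_abs_det
  exact abs_pos.1 (hc.trans_le (h ζ hζ))

theorem isCoef_det : IsCoef fun ζ => (jac F ζ).det := by
  simp only [Matrix.det_fin_two]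
  exact ((hF.isCoef_jac 0 0).mul (hF.isCoef_jac 1 1)).sub
    ((hF.isCoef_jac 0 1).mul (hF.isCoef_jac 1 0))

theorem isCoef_det_inv : IsCoef fun ζ => ((jac F ζ).det)⁻¹ := by
  obtain ⟨c, hc, h⟩ := hF.exists_le_abs_det
  exact hF.isCoef_det.inv hc h

theorem isCoef_adjJac (i j : Fin 2) : IsCoef fun ζ => adjJac F ζ i j := by
  simp only [adjJac, Matrix.adjugate_fin_two]
  fin_cases i <;> fin_cases j
  · exact hF.isCoef_jac 1 1
  · exact (hF.isCoef_jac 0 1).neg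
  · exact (hF.isCoef_jac 1 0).neg
  · exact hF.isCoef_jac 0 0

/-- The transforms contain det J, the change of variables |det J|. The square is connected and the
determinant does not vanish, so both differ by a constant sign. -/
theorem exists_sign_det : ∃ ε : ℝ, ε ^ 2 = 1 ∧
    ∀ ζ ∈ paramDomain, |(jac F ζ).det| = ε * (jac F ζ).det := by
  have hcont := hF.isCoef_det.1.continuousOn
  by_cases h : ∀ ζ ∈ paramDomain, 0 ≤ (jac F ζ).det
  · exact ⟨1, by norm_num, fun ζ hζ => by rw [abs_of_nonneg (h ζ hζ), one_mul]⟩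
  · push Not at h
    obtain ⟨ζ₀, hζ₀, h₀⟩ := h
    refine ⟨-1, by norm_num, fun ζ hζ => ?_⟩
    have : (jac F ζ).det ≤ 0 := by
      by_contra! h1
      obtain ⟨ξ, hξ, h2⟩ := convex_paramDomain.isPreconnected.intermediate_value hζ₀ hζ hcont
        ⟨h₀.le, h1.le⟩
      exact hF.det_ne_zero hξ h2
    rw [abs_of_nonpos this]; ring

/-! ### Change of variables -/

theorem hasFDerivWithinAt {ζ : Pt} (hζ : ζ ∈ paramDomain) :
    HasFDerivWithinAt F (fderiv ℝ F ζ) paramDomain ζ :=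
  (hF.differentiableAt hζ).hasFDerivAt.hasFDerivWithinAt

theorem integral_physDomain (g : Pt → ℝ) :
    ∫ x in physDomain F, g x = ∫ ζ, |(jac F ζ).det| * g (F ζ) ∂sq := by
  rw [physDomain, integral_image_eq_integral_abs_det_fderiv_smul volume measurableSet_paramDomain
    (fun ζ hζ => hF.hasFDerivWithinAt hζ) hF.injOn]
  refine setIntegral_congr_fun measurableSet_paramDomain fun ζ hζ => ?_
  simp only [smul_eq_mul, det_fderiv (hF.differentiableAt hζ)]

theorem integrableOn_physDomain (g : Pt → ℝ) :
    IntegrableOn g (physDomain F) ↔ Integrable (fun ζ => g (F ζ)) sq := by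
  rw [physDomain, integrableOn_image_iff_integrableOn_abs_det_fderiv_smul volume
    measurableSet_paramDomain (fun ζ hζ => hF.hasFDerivWithinAt hζ) hF.injOn,
    integrableOn_congr_fun (g := fun ζ => |(jac F ζ).det| * g (F ζ))
    (fun ζ hζ => by simp only [smul_eq_mul, det_fderiv (hF.differentiableAt hζ)])
    measurableSet_paramDomain]
  obtain ⟨hm, C, hC⟩ := hF.isCoef_det.bddMeas
  obtain ⟨hm', C', hC'⟩ := hF.isCoef_det_inv.bddMeas
  constructor <;> intro h
  · have h1 := h.bdd_mul (c := C') hm'.norm (by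
      filter_upwards [ae_restrict_mem measurableSet_paramDomain] with ζ hζ
      rw [norm_norm]; exact hC' ζ hζ)
    refine h1.congr ?_
    filter_upwards [ae_restrict_mem measurableSet_paramDomain] with ζ hζ
    have := abs_pos.2 (hF.det_ne_zero hζ)
    rw [Real.norm_eq_abs, abs_inv, inv_mul_cancel_left₀ this.ne']
  · exact Integrable.bdd_mul (c := C) h hm.norm (by
      filter_upwards [ae_restrict_mem measurableSet_paramDomain] with ζ hζ
      rw [Real.norm_eq_abs, abs_abs]; exact hC ζ hζ)

/-- The exceptional set is the image under the differentiable map G of a null set. The converse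
transfer uses F in the same way. -/
theorem ae_comp {P : Pt → Prop} (h : ∀ᵐ x ∂volume.restrict (physDomain F), P x) :
    ∀ᵐ ζ ∂sq, P (F ζ) := by
  rw [ae_restrict_iff' hF.measurableSet_physDomain, ae_iff] at h
  rw [ae_restrict_iff' measurableSet_paramDomain, ae_iff]
  have h0 := addHaar_image_eq_zero_of_differentiableOn_of_addHaar_eq_zero volume (f := G)
    (fun x hx => (hF.differentiableAt_inv (Classical.not_imp.1 hx).1).differentiableWithinAt) h
  refine measure_mono_null (fun ζ hζ => ?_) h0
  obtain ⟨h1, h2⟩ := Classical.not_imp.1 hζ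
  exact ⟨F ζ, Classical.not_imp.2 ⟨mem_physDomain h1, h2⟩, hF.left_inv ζ h1⟩

theorem ae_comp_inv {P : Pt → Prop} (h : ∀ᵐ ζ ∂sq, P ζ) :
    ∀ᵐ x ∂volume.restrict (physDomain F), P (G x) := by
  rw [ae_restrict_iff' measurableSet_paramDomain, ae_iff] at h
  rw [ae_restrict_iff' hF.measurableSet_physDomain, ae_iff]
  have h0 := addHaar_image_eq_zero_of_differentiableOn_of_addHaar_eq_zero volume (f := F)
    (fun x hx => (hF.differentiableAt (Classical.not_imp.1 hx).1).differentiableWithinAt) h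
  refine measure_mono_null (fun x hx => ?_) h0
  obtain ⟨h1, h2⟩ := Classical.not_imp.1 hx
  exact ⟨G x, Classical.not_imp.2 ⟨hF.inv_mem h1, h2⟩, hF.right_inv h1⟩

theorem ae_of_ae_comp {P : Pt → Prop} (h : ∀ᵐ ζ ∂sq, P (F ζ)) :
    ∀ᵐ x ∂volume.restrict (physDomain F), P x := by
  filter_upwards [hF.ae_comp_inv h, ae_restrict_mem hF.measurableSet_physDomain] with x hx h1
  rwa [hF.right_inv h1] at hx

theorem aestronglyMeasurable_comp {f : Pt → ℝ}
    (hf : AEStronglyMeasurable f (volume.restrict (physDomain F))) :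
    AEStronglyMeasurable (fun ζ => f (F ζ)) sq := by
  have hFm : AEMeasurable F sq :=
    hF.contDiffOn_two.continuousOn.aemeasurable measurableSet_paramDomain
  obtain ⟨f', hf', hff'⟩ := hf
  refine ⟨fun ζ => f' (hFm.mk F ζ), hf'.comp_measurable hFm.measurable_mk, ?_⟩
  filter_upwards [hF.ae_comp hff', hFm.ae_eq_mk] with ζ h1 h2
  rw [h1, h2]

theorem aestronglyMeasurable_comp_inv {f : Pt → ℝ} (hf : AEStronglyMeasurable f sq) :
    AEStronglyMeasurable (fun x => f (G x)) (volume.restrict (physDomain F)) := by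
  have hGm : AEMeasurable G (volume.restrict (physDomain F)) :=
    (hF.contDiffOn_inv.continuousOn.mono subset_closure).aemeasurable hF.measurableSet_physDomain
  obtain ⟨f', hf', hff'⟩ := hf
  refine ⟨fun ζ => f' (hGm.mk G ζ), hf'.comp_measurable hGm.measurable_mk, ?_⟩
  filter_upwards [hF.ae_comp_inv hff', hGm.ae_eq_mk] with ζ h1 h2
  rw [h1, h2]

theorem memLp_comp {f : Pt → ℝ} (hf : MemLp f 2 (volume.restrict (physDomain F))) :
    MemLp (fun ζ => f (F ζ)) 2 sq :=
  memLp_iff.2 ⟨hF.aestronglyMeasurable_comp hf.1,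
    (hF.integrableOn_physDomain fun x => f x ^ 2).1 hf.integrable_sq⟩

theorem memLp_of_comp {f : Pt → ℝ} (hf : MemLp (fun ζ => f (F ζ)) 2 sq) :
    MemLp f 2 (volume.restrict (physDomain F)) := by
  have hm : AEStronglyMeasurable f (volume.restrict (physDomain F)) := by
    refine (hF.aestronglyMeasurable_comp_inv hf.1).congr ?_
    filter_upwards [ae_restrict_mem hF.measurableSet_physDomain] with x hx
    rw [hF.right_inv hx]
  exact (memLp_two_iff_integrable_sq hm).2
    ((hF.integrableOn_physDomain fun x => f x ^ 2).2 hf.integrable_sq)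

/-! ### Pulled-back test functions -/

/-- The extension of φ∘F by zero is supported in the compact set G(supp φ) inside the square.
Smoothness is limited by F; two derivatives suffice for mixed derivatives to commute. -/
theorem pullback_test {φ : Pt → ℝ} (hφ : ContDiff ℝ ∞ φ) (hc : HasCompactSupport φ)
    (hs : tsupport φ ⊆ physDomain F) :
    ∃ ψ : Pt → ℝ, IsTest ψ ∧ ContDiff ℝ 2 ψ ∧ ∀ ζ ∈ paramDomain, ψ ζ = φ (F ζ) := by
  have hsub : Function.support (paramDomain.indicator fun ζ => φ (F ζ)) ⊆ G '' tsupport φ := by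
    intro ζ hζ
    have h1 : ζ ∈ paramDomain := by
      by_contra h; exact hζ (indicator_of_notMem h _)
    rw [Function.mem_support, indicator_of_mem h1] at hζ
    exact ⟨F ζ, subset_tsupport φ hζ, hF.left_inv ζ h1⟩
  have hcomp : IsCompact (G '' tsupport φ) :=
    hc.isCompact.image_of_continuousOn
      (hF.contDiffOn_inv.continuousOn.mono (hs.trans subset_closure))
  have hts : tsupport (paramDomain.indicator fun ζ => φ (F ζ)) ⊆ paramDomain := by
    refine (closure_minimal hsub hcomp.isClosed).trans ?_
    rintro _ ⟨x, hx, rfl⟩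
    exact hF.inv_mem (hs hx)
  have h2 : ContDiff ℝ 2 (paramDomain.indicator fun ζ => φ (F ζ)) := by
    refine contDiff_iff_contDiffAt.2 fun ζ => ?_
    by_cases hζ : ζ ∈ tsupport (paramDomain.indicator fun ζ => φ (F ζ))
    · have h3 := mem_nhds_paramDomain (hts hζ)
      refine ContDiffAt.congr_of_eventuallyEq ((contDiff_infty.1 hφ 2).contDiffAt.comp ζ
        (hF.contDiffOn_two.contDiffAt h3)) ?_
      filter_upwards [h3] with ξ hξ
      rw [indicator_of_mem hξ]; rfl
    · refine (contDiffAt_const (c := (0 : ℝ))).congr_of_eventuallyEq ?_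
      filter_upwards [(isClosed_tsupport _).isOpen_compl.mem_nhds hζ] with ξ hξ
      exact image_eq_zero_of_notMem_tsupport hξ
  exact ⟨_, ⟨h2.of_le (by norm_num), HasCompactSupport.of_support_subset_isCompact hcomp hsub, hts⟩,
    h2, fun ζ hζ => indicator_of_mem hζ _⟩

end IsParametrization

end Geometry

/-! ### The transforms Y₂ and Y₃ and their inverses. -/

section Transforms

open Set MeasureTheory Filter

/-- Matrix fields all of whose entries are bounded coefficients. -/
def MatCoef (M : Pt → Mat) : Prop := ∀ i j, IsCoef fun ζ => M ζ i j

/-- The entrywise partial derivative of a matrix field. -/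
noncomputable def dMat (k : Fin 2) (M : Pt → Mat) (ζ : Pt) : Mat :=
  Matrix.of fun i j => pd k (fun ξ => M ξ i j) ζ

/-- The primitive of a vector field in the first variable. -/
noncomputable def int1v (g : Pt → Fin 2 → ℝ) (ζ : Pt) : Fin 2 → ℝ :=
  fun i => int1 (fun ξ => g ξ i) ζ

/-- The operator `g ↦ M g + ∂₁M ∫_0^{ζ₁} g d1 = ∂₁ (M ∫_0^{ζ₁} g d1)`. -/
noncomputable def primOp (M : Pt → Mat) (g : Pt → Fin 2 → ℝ) (ζ : Pt) : Fin 2 → ℝ :=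
  M ζ *ᵥ g ζ + dMat 0 M ζ *ᵥ int1v g ζ

/-- Square-integrable vector fields on the parametric domain. -/
def VecL2 (g : Pt → Fin 2 → ℝ) : Prop := ∀ i, MemLp (fun ζ => g ζ i) 2 sq

theorem ae_mem_paramDomain : ∀ᵐ ζ ∂sq, ζ ∈ paramDomain :=
  ae_restrict_mem measurableSet_paramDomain

theorem VecL2.add {g h : Pt → Fin 2 → ℝ} (hg : VecL2 g) (hh : VecL2 h) :
    VecL2 fun ζ => g ζ + h ζ := fun i => (hg i).add (hh i)

theorem VecL2.sub {g h : Pt → Fin 2 → ℝ} (hg : VecL2 g) (hh : VecL2 h) :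
    VecL2 fun ζ => g ζ - h ζ := fun i => (hg i).sub (hh i)

theorem VecL2.mulVec {M : Pt → Mat} (hM : ∀ i j, BddMeas fun ζ => M ζ i j)
    {g : Pt → Fin 2 → ℝ} (hg : VecL2 g) : VecL2 fun ζ => M ζ *ᵥ g ζ := fun i => by
  simp only [Matrix.mulVec_eq_sum, Finset.sum_apply, Fin.sum_univ_two, Pi.smul_apply,
    Matrix.transpose_apply, op_smul_eq_smul, smul_eq_mul]
  simp only [mul_comm (g _ _)]
  exact ((hM i 0).memLp_mul (hg 0)).add ((hM i 1).memLp_mul (hg 1))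

theorem VecL2.int1v {g : Pt → Fin 2 → ℝ} (hg : VecL2 g) : VecL2 (int1v g) :=
  fun i => memLp_int1 (hg i)

theorem MatCoef.bddMeas {M : Pt → Mat} (hM : MatCoef M) (i j : Fin 2) :
    BddMeas fun ζ => M ζ i j := (hM i j).bddMeas

theorem MatCoef.bddMeas_dMat {M : Pt → Mat} (hM : MatCoef M) (k i j : Fin 2) :
    BddMeas fun ζ => dMat k M ζ i j := (hM i j).bddMeas_pd k

theorem VecL2.primOp {M : Pt → Mat} (hM : MatCoef M) {g : Pt → Fin 2 → ℝ} (hg : VecL2 g) :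
    VecL2 (primOp M g) :=
  (hg.mulVec hM.bddMeas).add (hg.int1v.mulVec (hM.bddMeas_dMat 0))

theorem int1v_congr {g h : Pt → Fin 2 → ℝ} (hgh : g =ᵐ[sq] h) : int1v g =ᵐ[sq] int1v h := by
  have : ∀ i, int1 (fun ξ => g ξ i) =ᵐ[sq] int1 (fun ξ => h ξ i) := fun i =>
    int1_congr (by filter_upwards [hgh] with ζ hζ using congrFun hζ i)
  filter_upwards [this 0, this 1] with ζ h0 h1
  ext i; fin_cases i
  · exact h0
  · exact h1

theorem primOp_congr (M : Pt → Mat) {g h : Pt → Fin 2 → ℝ} (hgh : g =ᵐ[sq] h) :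
    primOp M g =ᵐ[sq] primOp M h := by
  filter_upwards [hgh, int1v_congr hgh] with ζ h1 h2
  rw [primOp, primOp, h1, h2]

theorem mulVec_apply_two (A : Mat) (v : Fin 2 → ℝ) (i : Fin 2) :
    (A *ᵥ v) i = A i 0 * v 0 + A i 1 * v 1 := by
  simp [Matrix.mulVec, dotProduct, Fin.sum_univ_two]

/-- Entrywise, `int1_product`: the operator is the derivative of M∫g d1, which vanishes at ζ₁ = 0.
-/
theorem int1v_primOp {M : Pt → Mat} (hM : MatCoef M) {g : Pt → Fin 2 → ℝ} (hg : VecL2 g) :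
    int1v (primOp M g) =ᵐ[sq] fun ζ => M ζ *ᵥ int1v g ζ := by
  have key : ∀ i, int1 (fun ζ => primOp M g ζ i) =ᵐ[sq] fun ζ => (M ζ *ᵥ int1v g ζ) i := by
    intro i
    have hint : ∀ j, Integrable (fun ζ => M ζ i j * g ζ j +
        pd 0 (fun ξ => M ξ i j) ζ * int1 (fun ξ => g ξ j) ζ) sq := fun j =>
      integrable_of_memLp (((hM i j).bddMeas.memLp_mul (hg j)).add
        (((hM i j).bddMeas_pd 0).memLp_mul (memLp_int1 (hg j))))
    have h1 := int1_product (hM i 0) (integrable_of_memLp (hg 0))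
    have h2 := int1_product (hM i 1) (integrable_of_memLp (hg 1))
    have h3 := int1_add (hint 0) (hint 1)
    have e : (fun ζ => primOp M g ζ i) = fun ζ =>
        (M ζ i 0 * g ζ 0 + pd 0 (fun ξ => M ξ i 0) ζ * int1 (fun ξ => g ξ 0) ζ) +
        (M ζ i 1 * g ζ 1 + pd 0 (fun ξ => M ξ i 1) ζ * int1 (fun ξ => g ξ 1) ζ) := by
      funext ζ
      simp only [primOp, Pi.add_apply, mulVec_apply_two, dMat, Matrix.of_apply, StrongSym.int1v]
      ring
    rw [e]
    filter_upwards [h1, h2, h3] with ζ h1 h2 h3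
    rw [h3, h1, h2, mulVec_apply_two]
    rfl
  filter_upwards [key 0, key 1] with ζ h0 h1
  ext i; fin_cases i
  · exact h0
  · exact h1

theorem dMat_mul {M N : Pt → Mat} (hM : MatCoef M) (hN : MatCoef N)
    (h : ∀ ζ ∈ paramDomain, M ζ * N ζ = 1) (k : Fin 2) {ζ : Pt} (hζ : ζ ∈ paramDomain) :
    dMat k M ζ * N ζ + M ζ * dMat k N ζ = 0 := by
  have hd : ∀ i j, DifferentiableAt ℝ (fun ξ => M ξ i j) ζ :=
    fun i j => differentiableAt_of_contDiffOn (hM i j).1 hζ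
  have hd' : ∀ i j, DifferentiableAt ℝ (fun ξ => N ξ i j) ζ :=
    fun i j => differentiableAt_of_contDiffOn (hN i j).1 hζ
  ext i j
  have h1 : pd k (fun ξ => M ξ i 0 * N ξ 0 j + M ξ i 1 * N ξ 1 j) ζ = 0 := by
    rw [pd_congr (b := fun _ => (1 : Mat) i j) (fun ξ hξ => by
      rw [← h ξ hξ, Matrix.mul_apply, Fin.sum_univ_two]) k hζ]
    simp [pd]
  rw [pd_add ((hd _ _).fun_mul (hd' _ _)) ((hd _ _).fun_mul (hd' _ _)), pd_mul (hd _ _) (hd' _ _),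
    pd_mul (hd _ _) (hd' _ _)] at h1
  simp only [Matrix.add_apply, Matrix.mul_apply, Fin.sum_univ_two, dMat, Matrix.of_apply,
    Matrix.zero_apply]
  linarith

/-- Formally ∂₁(N M ∫g d1) = g. Both transforms are inverted through this identity. -/
theorem primOp_primOp {M N : Pt → Mat} (hM : MatCoef M) (hN : MatCoef N)
    (h : ∀ ζ ∈ paramDomain, N ζ * M ζ = 1) {g : Pt → Fin 2 → ℝ} (hg : VecL2 g) :
    primOp N (primOp M g) =ᵐ[sq] g := by
  filter_upwards [int1v_primOp hM hg, ae_mem_paramDomain] with ζ h1 hζ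
  have h2 := dMat_mul hN hM h 0 hζ
  rw [primOp, h1]
  simp only [primOp, Matrix.mulVec_add, Matrix.mulVec_mulVec]
  rw [h ζ hζ, Matrix.one_mulVec, add_assoc, ← Matrix.add_mulVec, add_comm (N ζ * _), h2,
    Matrix.zero_mulVec, add_zero]

/-! ### The adjugate of the Jacobian and its inverse -/

/-- The inverse `J̃⁻¹` of the adjugate, as a matrix field on the parametric domain. -/
noncomputable def invAdj (F : Pt → Pt) (ζ : Pt) : Mat := (adjJac F ζ)⁻¹

theorem pd_comm {f : Pt → ℝ} {ζ : Pt} (hf : ContDiffAt ℝ 2 f ζ) :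
    pd 0 (pd 1 f) ζ = pd 1 (pd 0 f) ζ := by
  have hd : DifferentiableAt ℝ (fderiv ℝ f) ζ :=
    (hf.fderiv_right (m := 1) (by norm_num)).differentiableAt (by norm_num)
  have h : ∀ k l, pd k (pd l f) ζ = fderiv ℝ (fderiv ℝ f) ζ (Pi.single k 1) (Pi.single l 1) := by
    intro k l
    unfold pd
    have h1 := hd.hasFDerivAt.clm_apply (hasFDerivAt_const (Pi.single l 1 : Pt) ζ)
    rw [h1.fderiv]
    simp
  rw [h, h]
  exact (hf.isSymmSndFDerivAt (by simp)) _ _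

namespace IsParametrization

variable {F G : Pt → Pt} (hF : IsParametrization F G)
include hF

theorem det_adjJac {ζ : Pt} (hζ : ζ ∈ paramDomain) : IsUnit (adjJac F ζ).det := by
  rw [adjJac, Matrix.det_adjugate]
  exact (pow_ne_zero _ (hF.det_ne_zero hζ)).isUnit

theorem adjJac_mul_invAdj {ζ : Pt} (hζ : ζ ∈ paramDomain) : adjJac F ζ * invAdj F ζ = 1 :=
  Matrix.mul_nonsing_inv _ (hF.det_adjJac hζ)

theorem invAdj_mul_adjJac {ζ : Pt} (hζ : ζ ∈ paramDomain) : invAdj F ζ * adjJac F ζ = 1 :=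
  Matrix.nonsing_inv_mul _ (hF.det_adjJac hζ)

theorem invAdj_eq {ζ : Pt} (hζ : ζ ∈ paramDomain) :
    invAdj F ζ = ((jac F ζ).det)⁻¹ • jac F ζ := by
  refine (Matrix.inv_eq_right_inv ?_)
  rw [Matrix.mul_smul, adjJac, Matrix.adjugate_mul, smul_smul, inv_mul_cancel₀ (hF.det_ne_zero hζ),
    one_smul]

theorem matCoef_adjJac : MatCoef (adjJac F) := hF.isCoef_adjJac

theorem matCoef_invAdj : MatCoef (invAdj F) := fun i j =>
  (hF.isCoef_det_inv.mul (hF.isCoef_jac i j)).congr_on fun ζ hζ => by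
    rw [hF.invAdj_eq hζ]; rfl

end IsParametrization

/-! ### The transform of the displacements -/

theorem Y3_eq (F : Pt → Pt) (v : Pt → Fin 2 → ℝ) :
    Y3 F v = primOp (adjJac F) fun ξ => (jac F ξ).det • v (F ξ) := by
  funext ζ i
  simp only [Y3, primOp, Pi.add_apply, mulVec_apply_two, dMat, Matrix.of_apply, int1v,
    Fin.sum_univ_two, Pi.smul_apply, smul_eq_mul]
  ring

theorem primOp_congr_on (M : Pt → Mat) {g h : Pt → Fin 2 → ℝ}
    (hgh : ∀ ζ ∈ paramDomain, g ζ = h ζ) {ζ : Pt} (hζ : ζ ∈ paramDomain) :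
    primOp M g ζ = primOp M h ζ := by
  have : int1v g ζ = int1v h ζ := funext fun i =>
    int1_congr_on (fun ξ hξ => congrFun (hgh ξ hξ) i) hζ
  rw [primOp, primOp, hgh ζ hζ, this]

namespace IsParametrization

variable {F G : Pt → Pt} (hF : IsParametrization F G)
include hF

theorem vecL2_smul_comp {v : Pt → Fin 2 → ℝ} (hv : MemL2 (physDomain F) v) :
    VecL2 fun ξ => (jac F ξ).det • v (F ξ) := fun i =>
  hF.isCoef_det.bddMeas.memLp_mul (hF.memLp_comp (hv i))

theorem Y3_unique {v w : Pt → Fin 2 → ℝ} (hv : MemL2 (physDomain F) v) (h : Y3 F v =ᵐ[sq] w) :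
    ∀ᵐ ζ ∂sq, (jac F ζ).det • v (F ζ) = primOp (invAdj F) w ζ := by
  rw [Y3_eq] at h
  filter_upwards [primOp_congr (invAdj F) h, primOp_primOp hF.matCoef_adjJac hF.matCoef_invAdj
    (fun ζ hζ => hF.invAdj_mul_adjJac hζ) (hF.vecL2_smul_comp hv)] with ζ h1 h2
  rw [← h1, h2]

/-- The choice operator needs only one preimage; it is obtained by applying the operator with J̃⁻¹
in place of J̃ and dividing by the determinant. -/
theorem Y3Inv_spec {w : Pt → Fin 2 → ℝ} (hw : VecL2 w) :
    MemL2 (physDomain F) (Y3Inv F w) ∧ Y3 F (Y3Inv F w) =ᵐ[sq] w := by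
  refine Classical.epsilon_spec (p := fun v => MemL2 (physDomain F) v ∧ Y3 F v =ᵐ[sq] w)
    ⟨fun x => ((jac F (G x)).det)⁻¹ • primOp (invAdj F) w (G x), fun i => ?_, ?_⟩
  · refine hF.memLp_of_comp ?_
    refine (hF.isCoef_det_inv.bddMeas.memLp_mul (hw.primOp hF.matCoef_invAdj i)).ae_eq ?_
    filter_upwards [ae_mem_paramDomain] with ζ hζ
    rw [hF.left_inv ζ hζ]; rfl
  · rw [Y3_eq]
    filter_upwards [ae_mem_paramDomain, primOp_primOp hF.matCoef_invAdj hF.matCoef_adjJac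
      (fun ζ hζ => hF.adjJac_mul_invAdj hζ) hw] with ζ hζ h
    rw [← h]
    refine primOp_congr_on _ (fun ξ hξ => ?_) hζ
    rw [hF.left_inv ξ hξ, smul_smul, mul_inv_cancel₀ (hF.det_ne_zero hξ), one_smul]

end IsParametrization

/-! ### The transform of the stresses -/

/-- The Piola transform `(S ∘ F) J̃ᵀ`. -/
noncomputable def piola (F : Pt → Pt) (S : Pt → Mat) (ζ : Pt) : Mat := S (F ζ) * (adjJac F ζ)ᵀ

/-- A column of a matrix field. -/
def colField (j : Fin 2) (V : Pt → Mat) (ζ : Pt) : Fin 2 → ℝ := fun i => V ζ i j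

theorem adjJac_eq (F : Pt → Pt) (ζ : Pt) :
    adjJac F ζ = !![pd 1 (fun ξ => F ξ 1) ζ, -pd 1 (fun ξ => F ξ 0) ζ;
      -pd 0 (fun ξ => F ξ 1) ζ, pd 0 (fun ξ => F ξ 0) ζ] := by
  rw [adjJac, Matrix.adjugate_fin_two]
  rfl

theorem dMat_adjJac (F : Pt → Pt) (k : Fin 2) (ζ : Pt) :
    dMat k (adjJac F) ζ = !![pd k (pd 1 fun ξ => F ξ 1) ζ, -pd k (pd 1 fun ξ => F ξ 0) ζ;
      -pd k (pd 0 fun ξ => F ξ 1) ζ, pd k (pd 0 fun ξ => F ξ 0) ζ] := by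
  ext i j
  fin_cases i <;> fin_cases j <;> simp [dMat, adjJac_eq, pd_neg]

/-- The second columns of Airy(F₁), Airy(F₂) consist, up to sign and order, of the entries of ∂₁J̃,
and the integrands are the second column of the Piola field. Thus this column has the same structure
as Y₃. In the first column ∂₂J̃ appears in place of ∂₁J̃, as `colField_zero_Y2Γ` records. -/
theorem colField_one_Y2Γ (F : Pt → Pt) (S : Pt → Mat) :
    colField 1 (Y2Γ F S) = primOp (adjJac F) (colField 1 (piola F S)) := by
  have e : ∀ n : Fin 2, (fun ξ => colField 1 (piola F S) ξ n) =
      fun ξ => adjJac F ξ 1 0 * S (F ξ) n 0 + adjJac F ξ 1 1 * S (F ξ) n 1 := by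
    intro n; funext ξ
    simp only [colField, piola, Matrix.mul_apply, Fin.sum_univ_two, Matrix.transpose_apply]
    ring
  funext ζ i
  simp only [primOp, Pi.add_apply, mulVec_apply_two, int1v, e, dMat_adjJac]
  simp only [colField, Y2Γ, piola, Matrix.add_apply, Matrix.mul_apply, Fin.sum_univ_two,
    Matrix.transpose_apply, Matrix.smul_apply, smul_eq_mul, airy]
  have h0 : Fin.rev (0 : Fin 2) = 1 := rfl
  have h1 : Fin.rev (1 : Fin 2) = 0 := rfl
  rw [h0, h1]
  simp only [Fin.val_zero, Fin.val_one, pow_zero, pow_one, one_mul, neg_one_mul, int1_neg]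
  fin_cases i <;> simp <;> ring

theorem colField_zero_Y2Γ (F : Pt → Pt) (S : Pt → Mat) (ζ : Pt) :
    colField 0 (Y2Γ F S) ζ = adjJac F ζ *ᵥ colField 0 (piola F S) ζ -
      dMat 1 (adjJac F) ζ *ᵥ int1v (colField 1 (piola F S)) ζ := by
  have e : ∀ n : Fin 2, (fun ξ => colField 1 (piola F S) ξ n) =
      fun ξ => adjJac F ξ 1 0 * S (F ξ) n 0 + adjJac F ξ 1 1 * S (F ξ) n 1 := by
    intro n; funext ξ
    simp only [colField, piola, Matrix.mul_apply, Fin.sum_univ_two, Matrix.transpose_apply]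
    ring
  funext i
  simp only [Pi.sub_apply, mulVec_apply_two, int1v, e, dMat_adjJac]
  simp only [colField, Y2Γ, piola, Matrix.add_apply, Matrix.mul_apply, Fin.sum_univ_two,
    Matrix.transpose_apply, Matrix.smul_apply, smul_eq_mul, airy]
  have h0 : Fin.rev (0 : Fin 2) = 1 := rfl
  have h1 : Fin.rev (1 : Fin 2) = 0 := rfl
  rw [h0, h1]
  simp only [Fin.val_zero, Fin.val_one, pow_zero, pow_one, one_mul, neg_one_mul, int1_neg]
  fin_cases i <;> simp <;> ring

/-- The Piola transform of the inverse image of `V`, first column. -/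
noncomputable def piolaCol0 (F : Pt → Pt) (V : Pt → Mat) (ζ : Pt) : Fin 2 → ℝ :=
  invAdj F ζ *ᵥ colField 0 V ζ - dMat 1 (invAdj F) ζ *ᵥ int1v (colField 1 V) ζ

/-- Square-integrable symmetric matrix fields on the parametric domain. -/
structure SymL2 (V : Pt → Mat) : Prop where
  memLp : ∀ i j, MemLp (fun ζ => V ζ i j) 2 sq
  isSymm : ∀ᵐ ζ ∂sq, (V ζ).IsSymm

theorem SymL2.vecL2 {V : Pt → Mat} (hV : SymL2 V) (j : Fin 2) : VecL2 (colField j V) :=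
  fun i => hV.memLp i j

namespace IsParametrization

variable {F G : Pt → Pt} (hF : IsParametrization F G)
include hF

theorem vecL2_piola {S : Pt → Mat}
    (hS : ∀ i j, MemLp (fun x => S x i j) 2 (volume.restrict (physDomain F))) (j : Fin 2) :
    VecL2 (colField j (piola F S)) := fun i => by
  simp only [colField, piola, Matrix.mul_apply, Fin.sum_univ_two, Matrix.transpose_apply]
  simp only [mul_comm (S _ _ _)]
  exact ((hF.isCoef_adjJac j 0).bddMeas.memLp_mul (hF.memLp_comp (hS i 0))).add
    ((hF.isCoef_adjJac j 1).bddMeas.memLp_mul (hF.memLp_comp (hS i 1)))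

/-- The system is triangular: the second column is solved alone, and its primitive is then
eliminated from the first, where differentiating J̃⁻¹J̃ = 1 in the second variable cancels the
coupling. -/
theorem Y2Γ_unique {S V : Pt → Mat}
    (hS : ∀ i j, MemLp (fun x => S x i j) 2 (volume.restrict (physDomain F)))
    (h : Y2Γ F S =ᵐ[sq] V) :
    ∀ᵐ ζ ∂sq, colField 0 (piola F S) ζ = piolaCol0 F V ζ ∧
      colField 1 (piola F S) ζ = primOp (invAdj F) (colField 1 V) ζ := by
  have h1 : primOp (adjJac F) (colField 1 (piola F S)) =ᵐ[sq] colField 1 V := by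
    rw [← colField_one_Y2Γ]
    filter_upwards [h] with ζ hζ
    funext i
    rw [colField, hζ]; rfl
  have hP := hF.vecL2_piola hS 1
  filter_upwards [h, primOp_congr (invAdj F) h1, int1v_congr h1,
    int1v_primOp hF.matCoef_adjJac hP, primOp_primOp hF.matCoef_adjJac hF.matCoef_invAdj
    (fun ζ hζ => hF.invAdj_mul_adjJac hζ) hP, ae_mem_paramDomain] with ζ h2 h3 h4 h5 h6 hζ
  refine ⟨?_, by rw [← h3, h6]⟩
  have h7 : colField 0 V ζ = colField 0 (Y2Γ F S) ζ := by
    funext i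
    rw [colField, ← h2]; rfl
  have h8 := dMat_mul hF.matCoef_invAdj hF.matCoef_adjJac (fun ζ hζ => hF.invAdj_mul_adjJac hζ)
    1 hζ
  rw [piolaCol0, ← h4, h5, h7, colField_zero_Y2Γ, Matrix.mulVec_sub, Matrix.mulVec_mulVec,
    Matrix.mulVec_mulVec, Matrix.mulVec_mulVec, hF.invAdj_mul_adjJac hζ, Matrix.one_mulVec,
    sub_sub, ← Matrix.add_mulVec, add_comm (invAdj F ζ * _), h8, Matrix.zero_mulVec, sub_zero]

theorem isSymm_airy {ζ : Pt} (hζ : ζ ∈ paramDomain) (n : Fin 2) :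
    (airy (fun ξ => F ξ n) ζ).IsSymm := by
  have h : ContDiffAt ℝ 2 (fun ξ => F ξ n) ζ :=
    contDiffAt_pi.1 (hF.contDiffOn_two.contDiffAt (mem_nhds_paramDomain hζ)) n
  have := pd_comm h
  ext i j
  fin_cases i <;> fin_cases j <;> simp [airy, this]

theorem comp_eq_piola_mul (S : Pt → Mat) {ζ : Pt} (hζ : ζ ∈ paramDomain) :
    S (F ζ) = piola F S ζ * (invAdj F ζ)ᵀ := by
  rw [piola, Matrix.mul_assoc, ← Matrix.transpose_mul, hF.invAdj_mul_adjJac hζ,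
    Matrix.transpose_one, Matrix.mul_one]

/-- The Airy terms are symmetric by Schwarz' theorem, so the remaining congruence J̃SJ̃ᵀ is
symmetric and can be undone. -/
theorem isSymm_of_Y2Γ {S : Pt → Mat} {ζ : Pt} (hζ : ζ ∈ paramDomain)
    (h : (Y2Γ F S ζ).IsSymm) : (S (F ζ)).IsSymm := by
  have h1 : (adjJac F ζ * S (F ζ) * (adjJac F ζ)ᵀ).IsSymm := by
    have e : adjJac F ζ * S (F ζ) * (adjJac F ζ)ᵀ = Y2Γ F S ζ -
      ∑ n : Fin 2, int1 (fun ξ => (-1) ^ (n : ℕ) * ∑ l, adjJac F ξ 1 l * S (F ξ) (Fin.rev n) l) ζ •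
        airy (fun ξ => F ξ n) ζ := by
      rw [Y2Γ, add_sub_cancel_right]
    rw [e, Fin.sum_univ_two]
    exact h.sub (((hF.isSymm_airy hζ 0).smul _).add ((hF.isSymm_airy hζ 1).smul _))
  have h2 : S (F ζ) = invAdj F ζ * (adjJac F ζ * S (F ζ) * (adjJac F ζ)ᵀ) * (invAdj F ζ)ᵀ := by
    have e1 : (adjJac F ζ)ᵀ * (invAdj F ζ)ᵀ = 1 := by
      rw [← Matrix.transpose_mul, hF.invAdj_mul_adjJac hζ, Matrix.transpose_one]
    simp only [Matrix.mul_assoc]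
    rw [e1, Matrix.mul_one, ← Matrix.mul_assoc, hF.invAdj_mul_adjJac hζ, Matrix.one_mul]
  rw [h2, Matrix.IsSymm, Matrix.transpose_mul, Matrix.transpose_mul, Matrix.transpose_transpose,
    h1.eq, ← Matrix.mul_assoc]

theorem vecL2_piolaCol0 {V : Pt → Mat} (hV : SymL2 V) : VecL2 (piolaCol0 F V) :=
  ((hV.vecL2 0).mulVec hF.matCoef_invAdj.bddMeas).sub
    ((hV.vecL2 1).int1v.mulVec (hF.matCoef_invAdj.bddMeas_dMat 1))

/-- The formulas forced by uniqueness define a Piola field columnwise, and hence a preimage. Its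
symmetry is not visible from the two columns and is inherited from V through `isSymm_of_Y2Γ`. -/
theorem Y2ΓInv_spec {V : Pt → Mat} (hV : SymL2 V) :
    MemL2Sym (physDomain F) (Y2ΓInv F V) ∧ Y2Γ F (Y2ΓInv F V) =ᵐ[sq] V := by
  let P : Pt → Mat := fun ζ => Matrix.of fun i j =>
    ![piolaCol0 F V ζ, primOp (invAdj F) (colField 1 V) ζ] j i
  let S : Pt → Mat := fun x => P (G x) * (invAdj F (G x))ᵀ
  have hP : ∀ ζ ∈ paramDomain, piola F S ζ = P ζ := fun ζ hζ => by
    simp only [piola, S]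
    rw [hF.left_inv ζ hζ, Matrix.mul_assoc, ← Matrix.transpose_mul, hF.adjJac_mul_invAdj hζ,
      Matrix.transpose_one, Matrix.mul_one]
  have h1 : ∀ ζ ∈ paramDomain, colField 1 (piola F S) ζ = primOp (invAdj F) (colField 1 V) ζ :=
    fun ζ hζ => by funext i; rw [colField, hP ζ hζ]; rfl
  have h0 : ∀ ζ ∈ paramDomain, colField 0 (piola F S) ζ = piolaCol0 F V ζ :=
    fun ζ hζ => by funext i; rw [colField, hP ζ hζ]; rfl
  have hY : Y2Γ F S =ᵐ[sq] V := by
    filter_upwards [ae_mem_paramDomain, primOp_primOp hF.matCoef_invAdj hF.matCoef_adjJac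
      (fun ζ hζ => hF.adjJac_mul_invAdj hζ) (hV.vecL2 1),
      int1v_primOp hF.matCoef_invAdj (hV.vecL2 1)] with ζ hζ h2 h3
    have e1 : colField 1 (Y2Γ F S) ζ = colField 1 V ζ := by
      rw [colField_one_Y2Γ, ← h2]
      exact primOp_congr_on _ h1 hζ
    have e0 : colField 0 (Y2Γ F S) ζ = colField 0 V ζ := by
      have h4 : int1v (colField 1 (piola F S)) ζ = int1v (primOp (invAdj F) (colField 1 V)) ζ :=
        funext fun i => int1_congr_on (fun ξ hξ => congrFun (h1 ξ hξ) i) hζ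
      have h8 := dMat_mul hF.matCoef_adjJac hF.matCoef_invAdj
        (fun ζ hζ => hF.adjJac_mul_invAdj hζ) 1 hζ
      rw [colField_zero_Y2Γ, h0 ζ hζ, h4, h3, piolaCol0, Matrix.mulVec_sub, Matrix.mulVec_mulVec,
        Matrix.mulVec_mulVec, Matrix.mulVec_mulVec, hF.adjJac_mul_invAdj hζ, Matrix.one_mulVec,
        sub_sub, ← Matrix.add_mulVec, add_comm (adjJac F ζ * _), h8, Matrix.zero_mulVec, sub_zero]
    ext i j
    fin_cases j
    · exact congrFun e0 i
    · exact congrFun e1 i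
  refine Classical.epsilon_spec (p := fun S => MemL2Sym (physDomain F) S ∧ Y2Γ F S =ᵐ[sq] V)
    ⟨S, ⟨fun i j => hF.memLp_of_comp ?_, hF.ae_of_ae_comp ?_⟩, hY⟩
  · have hp : MemLp (fun ζ => invAdj F ζ j 0 * piolaCol0 F V ζ i +
        invAdj F ζ j 1 * primOp (invAdj F) (colField 1 V) ζ i) 2 sq :=
      ((hF.matCoef_invAdj.bddMeas j 0).memLp_mul (hF.vecL2_piolaCol0 hV i)).add
        ((hF.matCoef_invAdj.bddMeas j 1).memLp_mul ((hV.vecL2 1).primOp hF.matCoef_invAdj i))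
    refine hp.ae_eq ?_
    filter_upwards [ae_mem_paramDomain] with ζ hζ
    simp only [S, P]
    rw [hF.left_inv ζ hζ]
    simp [Matrix.mul_apply, Fin.sum_univ_two, mul_comm]
  · filter_upwards [ae_mem_paramDomain, hY, hV.isSymm] with ζ hζ h2 h3
    exact hF.isSymm_of_Y2Γ hζ (h2 ▸ h3)

theorem Y2ΓInv_piola {V : Pt → Mat} (hV : SymL2 V) :
    ∀ᵐ ζ ∂sq, colField 0 (piola F (Y2ΓInv F V)) ζ = piolaCol0 F V ζ ∧
      colField 1 (piola F (Y2ΓInv F V)) ζ = primOp (invAdj F) (colField 1 V) ζ :=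
  hF.Y2Γ_unique (hF.Y2ΓInv_spec hV).1.1 (hF.Y2ΓInv_spec hV).2

/-! ### The correction term -/

/-- The first column of J̃⁻¹ is ∂₁F/det J, so the contraction over k in T is, by the chain rule, a
parametric derivative in the first direction divided by det J. This is the trace term in the
divergence of the uncorrected transform. -/
theorem det_smul_T (W : Pt → Mat) {ζ : Pt} (hζ : ζ ∈ paramDomain) :
    (jac F ζ).det • T F G W (F ζ) = dMat 0 (invAdj F) ζ *ᵥ fun i => W ![0, ζ 1] i 0 := by
  funext m
  have h : ∀ i, ∑ k, pd k (fun y => adjJacInv F G y m i) (F ζ) * adjJacInv F G (F ζ) k 0 =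
      ((jac F ζ).det)⁻¹ * dMat 0 (invAdj F) ζ m i := by
    intro i
    have h1 := hF.sum_pd_comp_inv hζ (a := fun ξ => invAdj F ξ m i)
      (differentiableAt_of_contDiffOn (hF.matCoef_invAdj m i).1 hζ) 0
    have h2 : ∀ k, adjJacInv F G (F ζ) k 0 =
        ((jac F ζ).det)⁻¹ * pd 0 (fun ξ => F ξ k) ζ := fun k => by
      change invAdj F (G (F ζ)) k 0 = _
      rw [hF.left_inv ζ hζ, hF.invAdj_eq hζ]; rfl
    simp only [h2, Fin.sum_univ_two] at h1 ⊢
    rw [dMat, Matrix.of_apply, ← h1]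
    change pd 0 (fun y => invAdj F (G y) m i) (F ζ) * _ +
      pd 1 (fun y => invAdj F (G y) m i) (F ζ) * _ = _
    ring
  have hd := hF.det_ne_zero hζ
  have e : T F G W (F ζ) m = ∑ i, (∑ k, pd k (fun y => adjJacInv F G y m i) (F ζ) *
      adjJacInv F G (F ζ) k 0) * W ![0, ζ 1] i 0 := by
    rw [T, hF.left_inv ζ hζ]
    simp only [Finset.sum_mul]
  rw [Pi.smul_apply, e, smul_eq_mul]
  simp only [h, Fin.sum_univ_two, mulVec_apply_two]
  field_simp

end IsParametrization

end Transforms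

/-! ### Weak divergence of transformed fields. -/

section WeakDivergence

open Set MeasureTheory Filter

theorem IsTest.pd_test {ψ : Pt → ℝ} (hψ : IsTest ψ) (h2 : ContDiff ℝ 2 ψ) (k : Fin 2) :
    IsTest (pd k ψ) :=
  ⟨(h2.fderiv_right (m := 1) (by norm_num)).clm_apply contDiff_const,
    hψ.hasCompactSupport.fderiv_apply ℝ _,
    (tsupport_fderiv_apply_subset ℝ _).trans hψ.tsupport_subset⟩

/-- The weak form of `∂₁(k v₀ - ∂₂k R) + ∂₂(k v₁ + ∂₁k R) = ∂₁(k Z)` for `R = ∫_0^{ζ₁} v₁` and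
`Z = v₀ + ∂₂R`. -/
theorem integral_commutation {k v₀ v₁ a b : Pt → ℝ} {c e : ℝ → ℝ} (hk : IsCoef k)
    (hv₀ : MemLp v₀ 2 sq) (hv₁ : MemLp v₁ 2 sq) (ha : MemLp a 2 sq) (hb : MemLp b 2 sq)
    (h₀ : v₀ =ᵐ[sq] fun ζ => c (ζ 1) + int1 a ζ) (h₁ : v₁ =ᵐ[sq] fun ζ => e (ζ 0) + int2 b ζ)
    {ψ : Pt → ℝ} (hψ : IsTest ψ) (hψ2 : ContDiff ℝ 2 ψ) :
    ∫ ζ, ((k ζ * v₀ ζ - pd 1 k ζ * int1 v₁ ζ) * pd 0 ψ ζ +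
        (k ζ * v₁ ζ + pd 0 k ζ * int1 v₁ ζ) * pd 1 ψ ζ) ∂sq =
      -∫ ζ, (k ζ * (a ζ + b ζ) + pd 0 k ζ * int1 (fun ξ => a ξ + b ξ) ζ +
        pd 0 k ζ * c (ζ 1)) * ψ ζ ∂sq := by
  -- Formally the two factors are kZ - ∂₂(kR) and ∂₁(kR); the terms in kR form a curl, and ∂₁(kZ)
  -- remains. To avoid differentiating R classically, the weak derivatives ∂₁R = v₁, ∂₂R = ∫b and
  -- ∂₁Z = a + b are tested with k∂₂ψ, k∂₁ψ and kψ.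
  set R := int1 v₁ with hR
  set Z : Pt → ℝ := fun ζ => v₀ ζ + int1 b ζ with hZ
  set χ : Pt → ℝ := fun ζ => k ζ * pd 1 ψ ζ with hχ
  set θ : Pt → ℝ := fun ζ => k ζ * pd 0 ψ ζ with hθ
  set η : Pt → ℝ := fun ζ => k ζ * ψ ζ with hη
  have tχ : IsTest χ := (hψ.pd_test hψ2 1).coef_mul hk.1
  have tθ : IsTest θ := (hψ.pd_test hψ2 0).coef_mul hk.1
  have tη : IsTest η := hψ.coef_mul hk.1
  have lR : MemLp R 2 sq := memLp_int1 hv₁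
  have lZ : MemLp Z 2 sq := hv₀.add (memLp_int1 hb)
  have lab : MemLp (fun ζ => a ζ + b ζ) 2 sq := ha.add hb
  have hc : MemLp (fun ζ : Pt => c (ζ 1)) 2 sq := by
    refine (hv₀.sub (memLp_int1 ha)).ae_eq ?_
    filter_upwards [h₀] with ζ hζ
    rw [Pi.sub_apply, hζ, add_sub_cancel_right]
  have he : MemLp (fun ζ : Pt => e (ζ 0)) 2 sq := by
    refine (hv₁.sub (memLp_int2 hb)).ae_eq ?_
    filter_upwards [h₁] with ζ hζ
    rw [Pi.sub_apply, hζ, add_sub_cancel_right]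
  have key1 := integral_mul_pd_zero (c := fun _ => 0) lR hv₁ (.of_forall fun ζ => by simp [hR]) tχ
  have key2 := integral_mul_pd_one (c := fun s => ∫ t in (0 : ℝ)..s, e t) lR (memLp_int1 hb) (by
    filter_upwards [int1_congr h₁, int1_add (integrable_of_memLp he)
      (integrable_of_memLp (memLp_int2 hb)), ae_mem_paramDomain] with ζ g1 g2 hζ
    rw [hR, g1, g2, int1_int2_comm (integrable_of_memLp hb) hζ]
    rfl) tθ
  have hZae : Z =ᵐ[sq] fun ζ => c (ζ 1) + int1 (fun ξ => a ξ + b ξ) ζ := by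
    filter_upwards [h₀, int1_add (integrable_of_memLp ha) (integrable_of_memLp hb)] with ζ g1 g2
    rw [hZ, g2]
    simp only [g1]
    ring
  have key3 := integral_mul_pd_zero lZ lab hZae tη
  have int : ∀ {u w : Pt → ℝ}, BddMeas w → MemLp u 2 sq → Integrable (fun ζ => u ζ * w ζ) sq :=
    fun hw hu => by simpa only [mul_comm] using integrable_of_memLp (hw.memLp_mul hu)
  have i1 := int (tχ.bddMeas_pd 0) lR
  have i1' := int tχ.bddMeas hv₁
  have i2 := int (tθ.bddMeas_pd 1) lR
  have i2' := int tθ.bddMeas (memLp_int1 hb)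
  have i3 := int (tη.bddMeas_pd 0) lZ
  have i3' := int tη.bddMeas lab
  have j1 := int (hψ.bddMeas_pd 0)
    ((hk.bddMeas.memLp_mul hv₀).sub ((hk.bddMeas_pd 1).memLp_mul lR))
  have j2 := int (hψ.bddMeas_pd 1)
    ((hk.bddMeas.memLp_mul hv₁).add ((hk.bddMeas_pd 0).memLp_mul lR))
  have j3 := int hψ.bddMeas (((hk.bddMeas.memLp_mul lab).add
    ((hk.bddMeas_pd 0).memLp_mul (memLp_int1 lab))).add ((hk.bddMeas_pd 0).memLp_mul hc))
  simp only [Pi.sub_apply, Pi.add_apply] at j1 j2 j3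
  have hsum : ∫ ζ, (R ζ * pd 0 χ ζ + v₁ ζ * χ ζ) ∂sq - ∫ ζ, (R ζ * pd 1 θ ζ + int1 b ζ * θ ζ) ∂sq +
      ∫ ζ, (Z ζ * pd 0 η ζ + (a ζ + b ζ) * η ζ) ∂sq = 0 := by
    rw [integral_add i1 i1', integral_add i2 i2', integral_add i3 i3', key1, key2, key3]
    ring
  have I1 : Integrable (fun ζ => R ζ * pd 0 χ ζ + v₁ ζ * χ ζ) sq := i1.add i1'
  have I2 : Integrable (fun ζ => R ζ * pd 1 θ ζ + int1 b ζ * θ ζ) sq := i2.add i2'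
  have I3 : Integrable (fun ζ => Z ζ * pd 0 η ζ + (a ζ + b ζ) * η ζ) sq := i3.add i3'
  have I12 : Integrable (fun ζ => (R ζ * pd 0 χ ζ + v₁ ζ * χ ζ) -
    (R ζ * pd 1 θ ζ + int1 b ζ * θ ζ)) sq := I1.sub I2
  have J12 : Integrable (fun ζ => (k ζ * v₀ ζ - pd 1 k ζ * R ζ) * pd 0 ψ ζ +
    (k ζ * v₁ ζ + pd 0 k ζ * R ζ) * pd 1 ψ ζ) sq := j1.add j2
  rw [← integral_sub I1 I2, ← integral_add I12 I3] at hsum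
  rw [eq_neg_iff_add_eq_zero, ← integral_add J12 j3, ← hsum]
  refine integral_congr_ae ?_
  filter_upwards [hZae, ae_mem_paramDomain] with ζ hz hζ
  have dk := differentiableAt_of_contDiffOn hk.1 hζ
  have dψ := fun k => (hψ.pd_test hψ2 k).contDiff.differentiable (by norm_num) ζ
  have e1 : pd 0 χ ζ = pd 0 k ζ * pd 1 ψ ζ + k ζ * pd 0 (pd 1 ψ) ζ := pd_mul dk (dψ 1)
  have e2 : pd 1 θ ζ = pd 1 k ζ * pd 0 ψ ζ + k ζ * pd 1 (pd 0 ψ) ζ := pd_mul dk (dψ 0)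
  have e3 : pd 0 η ζ = pd 0 k ζ * ψ ζ + k ζ * pd 0 ψ ζ :=
    pd_mul dk (hψ.contDiff.differentiable (by norm_num) ζ)
  -- The second derivatives of ψ occur only as kR(∂₁∂₂ψ - ∂₂∂₁ψ).
  have e4 : pd 0 (pd 1 ψ) ζ = pd 1 (pd 0 ψ) ζ := pd_comm hψ2.contDiffAt
  have e5 : int1 (fun ξ => a ξ + b ξ) ζ = Z ζ - c (ζ 1) := by rw [hz]; ring
  have e6 : v₀ ζ = Z ζ - int1 b ζ := by simp only [hZ]; ring
  rw [e1, e2, e3, e4, e5, e6]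
  simp only [hχ, hθ, hη]
  ring

namespace IsParametrization

variable {F G : Pt → Pt} (hF : IsParametrization F G)
include hF

/-- Piola identity: J̃ᵀ∇̂(φ∘F) = det(J) (∇φ)∘F. The change of variables brings in |det J|, whose
sign factors out of both integrals. -/
theorem hasWeakDiv_of_pullback {S : Pt → Mat} {d : Pt → Fin 2 → ℝ}
    (h : ∀ ψ : Pt → ℝ, IsTest ψ → ContDiff ℝ 2 ψ → ∀ i,
      ∫ ζ, (piola F S ζ i 0 * pd 0 ψ ζ + piola F S ζ i 1 * pd 1 ψ ζ) ∂sq =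
        -∫ ζ, (jac F ζ).det * d (F ζ) i * ψ ζ ∂sq) :
    HasWeakDiv (physDomain F) S d := by
  intro φ hφ hc hs i
  obtain ⟨ψ, hψ, hψ2, hψφ⟩ := hF.pullback_test hφ hc hs
  obtain ⟨ε, -, hε⟩ := hF.exists_sign_det
  rw [hF.integral_physDomain, hF.integral_physDomain]
  have e1 : ∫ ζ, |(jac F ζ).det| * (d (F ζ) i * φ (F ζ)) ∂sq =
      ε * ∫ ζ, (jac F ζ).det * d (F ζ) i * ψ ζ ∂sq := by
    rw [← integral_const_mul]
    refine setIntegral_congr_fun measurableSet_paramDomain fun ζ hζ => ?_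
    simp only [hε ζ hζ, hψφ ζ hζ]
    ring
  have e2 : ∫ ζ, |(jac F ζ).det| * ∑ j, S (F ζ) i j * pd j φ (F ζ) ∂sq =
      ε * ∫ ζ, (piola F S ζ i 0 * pd 0 ψ ζ + piola F S ζ i 1 * pd 1 ψ ζ) ∂sq := by
    rw [← integral_const_mul]
    refine setIntegral_congr_fun measurableSet_paramDomain fun ζ hζ => ?_
    have hp : ∀ l, pd l ψ ζ = pd 0 φ (F ζ) * jac F ζ 0 l + pd 1 φ (F ζ) * jac F ζ 1 l := by
      intro l
      rw [pd_congr hψφ l hζ, pd_comp (hF.differentiableAt hζ)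
        (hφ.contDiffAt.differentiableAt (by norm_num)), Fin.sum_univ_two]
      rfl
    simp only [hε ζ hζ]
    simp only [hp, piola, Matrix.mul_apply, Fin.sum_univ_two, Matrix.transpose_apply,
      adjJac, Matrix.adjugate_fin_two, Matrix.det_fin_two]
    simp
    ring
  rw [e1, e2, h ψ hψ hψ2 i]
  ring

/-- The commutation of the weak divergence with the transforms. -/
theorem hasWeakDiv_Y2ΓInv {V : Pt → Mat} (hV : SymL2 V) {a b : Pt → Fin 2 → ℝ}
    {c e : ℝ → Fin 2 → ℝ} (ha : VecL2 a) (hb : VecL2 b)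
    (h₀ : ∀ i, ∀ᵐ ζ ∂sq, V ζ i 0 = c (ζ 1) i + int1 (fun ξ => a ξ i) ζ)
    (h₁ : ∀ i, ∀ᵐ ζ ∂sq, V ζ i 1 = e (ζ 0) i + int2 (fun ξ => b ξ i) ζ)
    {d : Pt → Fin 2 → ℝ}
    (hd : ∀ᵐ ζ ∂sq, (jac F ζ).det • d (F ζ) =
      primOp (invAdj F) (fun ξ => a ξ + b ξ) ζ + dMat 0 (invAdj F) ζ *ᵥ c (ζ 1)) :
    HasWeakDiv (physDomain F) (Y2ΓInv F V) d := by
  refine hF.hasWeakDiv_of_pullback fun ψ hψ hψ2 i => ?_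
  have key := fun l => integral_commutation (c := fun t => c t l) (e := fun s => e s l)
    (hF.matCoef_invAdj i l) (hV.memLp l 0) (hV.memLp l 1) (ha l) (hb l) (h₀ l) (h₁ l) hψ hψ2
  set K := invAdj F with hK
  have int : ∀ {u w : Pt → ℝ}, BddMeas w → MemLp u 2 sq → Integrable (fun ζ => u ζ * w ζ) sq :=
    fun hw hu => by simpa only [mul_comm] using integrable_of_memLp (hw.memLp_mul hu)
  have hKm : MatCoef K := hF.matCoef_invAdj
  have hc : ∀ l, MemLp (fun ζ : Pt => c (ζ 1) l) 2 sq := fun l => by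
    refine ((hV.memLp l 0).sub (memLp_int1 (ha l))).ae_eq ?_
    filter_upwards [h₀ l] with ζ hζ
    rw [Pi.sub_apply, hζ, add_sub_cancel_right]
  have il : ∀ l, Integrable (fun ζ =>
      (K ζ i l * V ζ l 0 - pd 1 (fun ξ => K ξ i l) ζ * int1 (fun ξ => V ξ l 1) ζ) * pd 0 ψ ζ +
      (K ζ i l * V ζ l 1 + pd 0 (fun ξ => K ξ i l) ζ * int1 (fun ξ => V ξ l 1) ζ) * pd 1 ψ ζ)
      sq := fun l =>
    (int (hψ.bddMeas_pd 0) (((hKm i l).bddMeas.memLp_mul (hV.memLp l 0)).sub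
      (((hKm i l).bddMeas_pd 1).memLp_mul (memLp_int1 (hV.memLp l 1))))).add
    (int (hψ.bddMeas_pd 1) (((hKm i l).bddMeas.memLp_mul (hV.memLp l 1)).add
      (((hKm i l).bddMeas_pd 0).memLp_mul (memLp_int1 (hV.memLp l 1)))))
  have ir : ∀ l, Integrable (fun ζ => (K ζ i l * (a ζ l + b ζ l) +
      pd 0 (fun ξ => K ξ i l) ζ * int1 (fun ξ => a ξ l + b ξ l) ζ +
      pd 0 (fun ξ => K ξ i l) ζ * c (ζ 1) l) * ψ ζ) sq := fun l =>
    int hψ.bddMeas ((((hKm i l).bddMeas.memLp_mul ((ha l).add (hb l))).add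
      (((hKm i l).bddMeas_pd 0).memLp_mul (memLp_int1 ((ha l).add (hb l))))).add
      (((hKm i l).bddMeas_pd 0).memLp_mul (hc l)))
  have eL : ∫ ζ, (piola F (Y2ΓInv F V) ζ i 0 * pd 0 ψ ζ +
      piola F (Y2ΓInv F V) ζ i 1 * pd 1 ψ ζ) ∂sq = _ :=
    (integral_congr_ae (by
      filter_upwards [hF.Y2ΓInv_piola hV] with ζ h
      have h0 := congrFun h.1 i
      have h1 := congrFun h.2 i
      simp only [colField, piolaCol0, primOp, Pi.sub_apply, Pi.add_apply, mulVec_apply_two, dMat,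
        Matrix.of_apply, int1v] at h0 h1
      rw [h0, h1]
      simp only [← hK]
      ring)).trans (integral_add (il 0) (il 1))
  have eR : ∫ ζ, (jac F ζ).det * d (F ζ) i * ψ ζ ∂sq = _ :=
    (integral_congr_ae (by
      filter_upwards [hd] with ζ h
      have h0 := congrFun h i
      simp only [primOp, Pi.smul_apply, Pi.add_apply, mulVec_apply_two, dMat, Matrix.of_apply,
        int1v, smul_eq_mul] at h0
      rw [h0]
      ring)).trans (integral_add (ir 0) (ir 1))
  rw [eL, eR, key 0, key 1]
  ring

end IsParametrization

/-! ### Uniqueness and linearity of the weak divergence -/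

theorem integrableOn_of_memLp {D : Set Pt} {f ψ : Pt → ℝ}
    (hf : MemLp f 2 (volume.restrict D)) (hψ : Continuous ψ) (hc : HasCompactSupport ψ) :
    Integrable (fun x => f x * ψ x) (volume.restrict D) := by
  have h2 : MemLp ψ 2 (volume.restrict D) := (hψ.memLp_of_hasCompactSupport hc).restrict D
  exact hf.integrable_mul h2

theorem HasWeakDiv.sub {D : Set Pt} {σ τ : Pt → Mat} {c d : Pt → Fin 2 → ℝ}
    (hσ : MemL2Sym D σ) (hτ : MemL2Sym D τ) (hc : MemL2 D c) (hd : MemL2 D d)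
    (h₁ : HasWeakDiv D σ c) (h₂ : HasWeakDiv D τ d) : HasWeakDiv D (σ - τ) (c - d) := by
  intro φ hφ hs hD i
  have hpd : ∀ j, Continuous (pd j φ) := fun j =>
    ((hφ.continuous_fderiv (by simp)).clm_apply continuous_const)
  have hpc : ∀ j, HasCompactSupport (pd j φ) := fun j => hs.fderiv_apply ℝ _
  have i1 := integrableOn_of_memLp (hc i) hφ.continuous hs
  have i2 := integrableOn_of_memLp (hd i) hφ.continuous hs
  have j1 := integrable_finsetSum Finset.univ fun j _ =>
    integrableOn_of_memLp (hσ.1 i j) (hpd j) (hpc j)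
  have j2 := integrable_finsetSum Finset.univ fun j _ =>
    integrableOn_of_memLp (hτ.1 i j) (hpd j) (hpc j)
  simp only [Pi.sub_apply, Matrix.sub_apply, sub_mul, Finset.sum_sub_distrib]
  rw [integral_sub i1 i2, integral_sub j1 j2, h₁ φ hφ hs hD i, h₂ φ hφ hs hD i]
  ring

theorem HasWeakDiv.unique {D : Set Pt} (hD : IsOpen D) {τ : Pt → Mat} {c d : Pt → Fin 2 → ℝ}
    (hc : MemL2 D c) (hd : MemL2 D d) (h₁ : HasWeakDiv D τ c) (h₂ : HasWeakDiv D τ d) :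
    c =ᵐ[volume.restrict D] d := by
  have key : ∀ i, ∀ᵐ x ∂volume.restrict D, c x i = d x i := by
    intro i
    rw [ae_restrict_iff' hD.measurableSet]
    have hm : MemLp (fun x => c x i - d x i) 2 (volume.restrict D) := (hc i).sub (hd i)
    have hloc : LocallyIntegrableOn (fun x => c x i - d x i) D volume :=
      locallyIntegrableOn_of_locallyIntegrable_restrict (hm.locallyIntegrable (by norm_num))
    have := hD.ae_eq_zero_of_integral_contDiff_smul_eq_zero hloc fun φ hφ hs hsD => by
      have i1 := integrableOn_of_memLp (hc i) hφ.continuous hs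
      have i2 := integrableOn_of_memLp (hd i) hφ.continuous hs
      have e : ∫ x, φ x • (c x i - d x i) = ∫ x in D, (c x i * φ x - d x i * φ x) := by
        rw [← setIntegral_eq_integral_of_forall_compl_eq_zero (s := D) fun x hx => by
          rw [image_eq_zero_of_notMem_tsupport fun h => hx (hsD h), zero_smul]]
        refine integral_congr_ae (.of_forall fun x => ?_)
        simp only [smul_eq_mul]; ring
      rw [e, integral_sub i1 i2, h₁ φ hφ hs hsD i, h₂ φ hφ hs hsD i, sub_self]
    filter_upwards [this] with x hx h using sub_eq_zero.1 (hx h)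
  filter_upwards [key 0, key 1] with x h0 h1
  ext i; fin_cases i
  · exact h0
  · exact h1

end WeakDivergence

/-! ### L² bounds for the transforms, the corrected divergence, and the discrete complex. -/

section Estimates

open Set MeasureTheory Filter

/-- The squared Euclidean norm. -/
def nsq (v : Fin 2 → ℝ) : ℝ := v 0 ^ 2 + v 1 ^ 2

theorem nsq_nonneg (v : Fin 2 → ℝ) : 0 ≤ nsq v := add_nonneg (sq_nonneg _) (sq_nonneg _)

theorem nsq_add_le (v w : Fin 2 → ℝ) : nsq (v + w) ≤ 2 * nsq v + 2 * nsq w := by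
  simp only [nsq, Pi.add_apply]
  nlinarith [sq_nonneg (v 0 - w 0), sq_nonneg (v 1 - w 1)]

theorem nsq_sub_le (v w : Fin 2 → ℝ) : nsq (v - w) ≤ 2 * nsq v + 2 * nsq w := by
  simp only [nsq, Pi.sub_apply]
  nlinarith [sq_nonneg (v 0 + w 0), sq_nonneg (v 1 + w 1)]

/-- The squared `L²` norm of a vector field on the parametric domain. -/
noncomputable def energy (g : Pt → Fin 2 → ℝ) : ℝ := ∫ ζ, nsq (g ζ) ∂sq

theorem energy_nonneg (g : Pt → Fin 2 → ℝ) : 0 ≤ energy g := integral_nonneg fun _ => nsq_nonneg _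

theorem VecL2.integrable_nsq {g : Pt → Fin 2 → ℝ} (hg : VecL2 g) :
    Integrable (fun ζ => nsq (g ζ)) sq := (hg 0).integrable_sq.add (hg 1).integrable_sq

theorem energy_congr {g h : Pt → Fin 2 → ℝ} (hgh : g =ᵐ[sq] h) : energy g = energy h :=
  integral_congr_ae (by filter_upwards [hgh] with ζ hζ using by rw [hζ])

theorem energy_int1v_le {g : Pt → Fin 2 → ℝ} (hg : VecL2 g) : energy (int1v g) ≤ energy g := by
  simp only [energy, nsq]
  rw [integral_add (hg 0).integrable_sq (hg 1).integrable_sq,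
    integral_add (hg.int1v 0).integrable_sq (hg.int1v 1).integrable_sq]
  exact add_le_add (integral_int1_sq_le (hg 0)) (integral_int1_sq_le (hg 1))

theorem exists_nsq_mulVec_le {M : Pt → Mat} (hM : ∀ i j, BddMeas fun ζ => M ζ i j) :
    ∃ C : ℝ, 0 ≤ C ∧ ∀ ζ ∈ paramDomain, ∀ v, nsq (M ζ *ᵥ v) ≤ C * nsq v := by
  choose C hC using fun i j => (hM i j).2
  refine ⟨C 0 0 ^ 2 + C 0 1 ^ 2 + C 1 0 ^ 2 + C 1 1 ^ 2, by positivity, fun ζ hζ v => ?_⟩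
  have hsq : ∀ i j, M ζ i j ^ 2 ≤ C i j ^ 2 := fun i j => sq_le_sq' (abs_le.1 (hC i j ζ hζ)).1
    (abs_le.1 (hC i j ζ hζ)).2
  have hcs : ∀ i, (M ζ *ᵥ v) i ^ 2 ≤ (M ζ i 0 ^ 2 + M ζ i 1 ^ 2) * nsq v := fun i => by
    rw [mulVec_apply_two, nsq]
    nlinarith [sq_nonneg (M ζ i 0 * v 1 - M ζ i 1 * v 0)]
  have h2 : nsq (M ζ *ᵥ v) ≤
      (M ζ 0 0 ^ 2 + M ζ 0 1 ^ 2 + M ζ 1 0 ^ 2 + M ζ 1 1 ^ 2) * nsq v := by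
    rw [nsq]
    have := hcs 0
    have := hcs 1
    linarith
  refine h2.trans (mul_le_mul_of_nonneg_right ?_ (nsq_nonneg v))
  linarith [hsq 0 0, hsq 0 1, hsq 1 0, hsq 1 1]

/-- The constant precedes the fields in the quantifier order: it depends on the coefficients only.
This makes the later bounds independent of the knots. -/
theorem exists_energy_combination_le {M N : Pt → Mat} (hM : ∀ i j, BddMeas fun ζ => M ζ i j)
    (hN : ∀ i j, BddMeas fun ζ => N ζ i j) :
    ∃ C : ℝ, 0 ≤ C ∧ ∀ g h f : Pt → Fin 2 → ℝ, VecL2 g → VecL2 h →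
      (∀ᵐ ζ ∂sq, nsq (f ζ) ≤ 2 * nsq (M ζ *ᵥ g ζ) + 2 * nsq (N ζ *ᵥ h ζ)) →
      energy f ≤ C * (energy g + energy h) := by
  obtain ⟨A, hA, hMA⟩ := exists_nsq_mulVec_le hM
  obtain ⟨B, hB, hNB⟩ := exists_nsq_mulVec_le hN
  refine ⟨2 * A + 2 * B, by positivity, fun g h f hg hh hf => ?_⟩
  rw [energy, energy, energy, ← integral_add hg.integrable_nsq hh.integrable_nsq,
    ← integral_const_mul]
  refine integral_mono_of_nonneg (.of_forall fun _ => nsq_nonneg _)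
    ((hg.integrable_nsq.add hh.integrable_nsq).const_mul _) ?_
  filter_upwards [hf, ae_mem_paramDomain] with ζ h1 hζ
  refine h1.trans ?_
  have e1 := hMA ζ hζ (g ζ)
  have e2 := hNB ζ hζ (h ζ)
  have e3 := mul_nonneg hA (nsq_nonneg (h ζ))
  have e4 := mul_nonneg hB (nsq_nonneg (g ζ))
  nlinarith

theorem exists_energy_primOp_le {M : Pt → Mat} (hM : MatCoef M) :
    ∃ C : ℝ, 0 ≤ C ∧ ∀ g, VecL2 g → energy (primOp M g) ≤ C * energy g := by
  obtain ⟨C, hC, h⟩ := exists_energy_combination_le hM.bddMeas (hM.bddMeas_dMat 0)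
  refine ⟨C * 2, by positivity, fun g hg => ?_⟩
  refine (h g (int1v g) (primOp M g) hg hg.int1v (.of_forall fun ζ => nsq_add_le _ _)).trans ?_
  have := mul_le_mul_of_nonneg_left (energy_int1v_le hg) hC
  linarith

/-- The squared Frobenius norm. -/
def frobSq (M : Mat) : ℝ := ∑ i, ∑ j, M i j * M i j

theorem frobSq_nonneg (M : Mat) : 0 ≤ frobSq M :=
  Finset.sum_nonneg fun _ _ => Finset.sum_nonneg fun _ _ => mul_self_nonneg _

theorem frobSq_sub_le (M N : Mat) : frobSq (M - N) ≤ 2 * frobSq M + 2 * frobSq N := by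
  simp only [frobSq, Finset.mul_sum, ← Finset.sum_add_distrib]
  refine Finset.sum_le_sum fun i _ => Finset.sum_le_sum fun j _ => ?_
  rw [Matrix.sub_apply]
  nlinarith [sq_nonneg (M i j + N i j)]

namespace IsParametrization

variable {F G : Pt → Pt} (hF : IsParametrization F G)
include hF

theorem integrable_frobSq {S : Pt → Mat}
    (hS : ∀ i j, MemLp (fun x => S x i j) 2 (volume.restrict (physDomain F))) :
    Integrable (fun ζ => frobSq (S (F ζ))) sq :=
  integrable_finsetSum _ fun i _ => integrable_finsetSum _ fun j _ =>
    (hF.memLp_comp (hS i j)).integrable_mul (hF.memLp_comp (hS i j))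

theorem exists_integral_Y2ΓInv_le :
    ∃ C : ℝ, 0 ≤ C ∧ ∀ V, SymL2 V → ∫ ζ, frobSq (Y2ΓInv F V (F ζ)) ∂sq ≤
      C * (energy (colField 0 V) + energy (colField 1 V)) := by
  have hK := hF.matCoef_invAdj
  obtain ⟨A, hA, h₁⟩ := exists_energy_combination_le hK.bddMeas (hK.bddMeas_dMat 1)
  obtain ⟨B, hB, h₂⟩ := exists_energy_primOp_le hK
  obtain ⟨C, hC, h₃⟩ := exists_nsq_mulVec_le hK.bddMeas
  refine ⟨C * (A + B), by positivity, fun V hV => ?_⟩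
  have hp0 := hF.vecL2_piolaCol0 hV
  have hp1 := (hV.vecL2 1).primOp hK
  have e1 : energy (piolaCol0 F V) ≤ A * (energy (colField 0 V) + energy (colField 1 V)) := by
    refine (h₁ (colField 0 V) (int1v (colField 1 V)) (piolaCol0 F V) (hV.vecL2 0)
      (hV.vecL2 1).int1v (.of_forall fun ζ => nsq_sub_le _ _)).trans ?_
    exact mul_le_mul_of_nonneg_left (by linarith [energy_int1v_le (hV.vecL2 1)]) hA
  have e2 := h₂ _ (hV.vecL2 1)
  have e3 : ∫ ζ, frobSq (Y2ΓInv F V (F ζ)) ∂sq ≤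
      C * (energy (piolaCol0 F V) + energy (primOp (invAdj F) (colField 1 V))) := by
    rw [energy, energy, ← integral_add hp0.integrable_nsq hp1.integrable_nsq, ← integral_const_mul]
    refine integral_mono_of_nonneg (.of_forall fun _ => frobSq_nonneg _)
      ((hp0.integrable_nsq.add hp1.integrable_nsq).const_mul _) ?_
    filter_upwards [hF.Y2ΓInv_piola hV, ae_mem_paramDomain] with ζ h hζ
    have h0 := h₃ ζ hζ (piola F (Y2ΓInv F V) ζ 0)
    have h1 := h₃ ζ hζ (piola F (Y2ΓInv F V) ζ 1)
    rw [← h.1, ← h.2, hF.comp_eq_piola_mul (Y2ΓInv F V) hζ]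
    simp only [nsq, mulVec_apply_two, colField, frobSq, Fin.sum_univ_two, Matrix.mul_apply,
      Matrix.transpose_apply] at h0 h1 ⊢
    nlinarith
  refine e3.trans ?_
  have e4 := mul_nonneg hB (energy_nonneg (colField 0 V))
  rw [mul_assoc]
  exact mul_le_mul_of_nonneg_left (by linarith) hC

theorem innerMat_eq (S : Pt → Mat) :
    innerMat (physDomain F) S S = ∫ ζ, |(jac F ζ).det| * frobSq (S (F ζ)) ∂sq :=
  hF.integral_physDomain _

/-! ### The divergence of the discrete stresses -/

theorem memL2_T {W : Pt → Mat} (hc : ∀ i, BddMeas fun ζ : Pt => W ![0, ζ 1] i 0) :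
    MemL2 (physDomain F) (T F G W) := fun m => by
  refine hF.memLp_of_comp ?_
  have h : MemLp (fun ζ => ((jac F ζ).det)⁻¹ *
      (dMat 0 (invAdj F) ζ *ᵥ fun i => W ![0, ζ 1] i 0) m) 2 sq :=
    hF.isCoef_det_inv.bddMeas.memLp_mul
      (VecL2.mulVec (hF.matCoef_invAdj.bddMeas_dMat 0) (fun i => (hc i).memLp) m)
  refine h.ae_eq ?_
  filter_upwards [ae_mem_paramDomain] with ζ hζ
  rw [← hF.det_smul_T W hζ, Pi.smul_apply, smul_eq_mul, inv_mul_cancel_left₀ (hF.det_ne_zero hζ)]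

end IsParametrization

/-- The correction `diag(∫_0^{ζ₁} y₁ d1, ∫_0^{ζ₂} y₂ d2)` with `y = Y_3^s(T(W))`. -/
noncomputable def correction (F G : Pt → Pt) (W : Pt → Mat) (ζ : Pt) : Mat :=
  !![int1 (fun ξ => Y3 F (T F G W) ξ 0) ζ, 0; 0, int2 (fun ξ => Y3 F (T F G W) ξ 1) ζ]

theorem MemL2Sym.sub {D : Set Pt} {σ τ : Pt → Mat} (hσ : MemL2Sym D σ) (hτ : MemL2Sym D τ) :
    MemL2Sym D (σ - τ) := by
  refine ⟨fun i j => (hσ.1 i j).sub (hτ.1 i j), ?_⟩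
  filter_upwards [hσ.2, hτ.2] with x h1 h2 using h1.sub h2

theorem symL2_diag {u w : Pt → ℝ} (hu : MemLp u 2 sq) (hw : MemLp w 2 sq) :
    SymL2 fun ζ => !![u ζ, 0; 0, w ζ] := by
  refine ⟨fun i j => ?_, .of_forall fun ζ => ?_⟩
  · fin_cases i <;> fin_cases j
    · exact hu
    · exact MemLp.zero
    · exact MemLp.zero
    · exact hw
  · ext i j; fin_cases i <;> fin_cases j <;> rfl

/-- A parametric stress field whose entries are primitives of square-integrable functions. -/
structure IsPrimitive (W : Pt → Mat) (a b : Pt → Fin 2 → ℝ) : Prop where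
  symL2 : SymL2 W
  bddMeas : ∀ i, BddMeas fun ζ : Pt => W ![0, ζ 1] i 0
  vecL2_left : VecL2 a
  vecL2_right : VecL2 b
  eq_left : ∀ ζ ∈ paramDomain, ∀ i, W ζ i 0 = W ![0, ζ 1] i 0 + int1 (fun ξ => a ξ i) ζ
  eq_right : ∀ ζ ∈ paramDomain, ∀ i, W ζ i 1 = W ![ζ 0, 0] i 1 + int2 (fun ξ => b ξ i) ζ

namespace IsParametrization

variable {F G : Pt → Pt} (hF : IsParametrization F G)
include hF

theorem symL2_correction {W : Pt → Mat} (hc : ∀ i, BddMeas fun ζ : Pt => W ![0, ζ 1] i 0) :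
    SymL2 (correction F G W) := by
  have hy : VecL2 (Y3 F (T F G W)) := by
    rw [Y3_eq]
    exact (hF.vecL2_smul_comp (hF.memL2_T hc)).primOp hF.matCoef_adjJac
  exact symL2_diag (memLp_int1 (hy 0)) (memLp_int2 (hy 1))

/-- The first column of the diagonal field vanishes at ζ₁ = 0, so no trace term appears (`c = 0`).
Its parametric divergence is Y₃(T(W)), which the inverse of Y₃ takes back to T(W). -/
theorem hasWeakDiv_correction {W : Pt → Mat} (hc : ∀ i, BddMeas fun ζ : Pt => W ![0, ζ 1] i 0) :
    HasWeakDiv (physDomain F) (Y2ΓInv F (correction F G W)) (T F G W) := by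
  have hT := hF.memL2_T hc
  set y := Y3 F (T F G W) with hyd
  have hy : VecL2 y := by
    rw [hyd, Y3_eq]
    exact (hF.vecL2_smul_comp hT).primOp hF.matCoef_adjJac
  refine hF.hasWeakDiv_Y2ΓInv (hF.symL2_correction hc) (a := fun ξ => ![y ξ 0, 0])
    (b := fun ξ => ![0, y ξ 1]) (c := 0) (e := 0) ?_ ?_ ?_ ?_ ?_
  · intro i; fin_cases i
    · exact hy 0
    · exact MemLp.zero
  · intro i; fin_cases i
    · exact MemLp.zero
    · exact hy 1
  · intro i
    refine .of_forall fun ζ => ?_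
    fin_cases i <;> simp [correction, int1, hyd]
  · intro i
    refine .of_forall fun ζ => ?_
    fin_cases i <;> simp [correction, int2, hyd]
  · have e : (fun ξ => ![y ξ 0, 0] + ![0, y ξ 1]) = y := by
      funext ξ i; fin_cases i <;> simp
    rw [e]
    filter_upwards [hF.Y3_unique hT (.of_forall fun _ => rfl)] with ζ h
    rw [h, ← hyd]
    simp

theorem memL2Sym_Y2Tilde {W : Pt → Mat} {a b : Pt → Fin 2 → ℝ} (hW : IsPrimitive W a b) :
    MemL2Sym (physDomain F) (Y2Tilde F G W) :=
  (hF.Y2ΓInv_spec hW.symL2).1.sub (hF.Y2ΓInv_spec (hF.symL2_correction hW.bddMeas)).1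

/-- `∇ · Ỹ_2^s(W) = (Y_3^s)⁻¹(∇̂ · W)`. -/
theorem hasWeakDiv_Y2Tilde {W : Pt → Mat} {a b : Pt → Fin 2 → ℝ} (hW : IsPrimitive W a b) :
    HasWeakDiv (physDomain F) (Y2Tilde F G W) (Y3Inv F fun ζ => a ζ + b ζ) := by
  have hab : VecL2 fun ζ => a ζ + b ζ := hW.vecL2_left.add hW.vecL2_right
  obtain ⟨hv, hY⟩ := hF.Y3Inv_spec hab
  have hT := hF.memL2_T hW.bddMeas
  -- Without the correction the trace of the first column leaves the additional term T(W).
  have h1 : HasWeakDiv (physDomain F) (Y2ΓInv F W) (Y3Inv F (fun ζ => a ζ + b ζ) + T F G W) := by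
    refine hF.hasWeakDiv_Y2ΓInv hW.symL2 (c := fun t i => W ![0, t] i 0)
      (e := fun s i => W ![s, 0] i 1) hW.vecL2_left hW.vecL2_right (fun i => ?_) (fun i => ?_) ?_
    · filter_upwards [ae_mem_paramDomain] with ζ hζ using hW.eq_left ζ hζ i
    · filter_upwards [ae_mem_paramDomain] with ζ hζ using hW.eq_right ζ hζ i
    · filter_upwards [hF.Y3_unique hv hY, ae_mem_paramDomain] with ζ h hζ
      rw [Pi.add_apply, smul_add, h, hF.det_smul_T W hζ]
  have hvT : MemL2 (physDomain F) (Y3Inv F (fun ζ => a ζ + b ζ) + T F G W) :=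
    fun i => (hv i).add (hT i)
  have := HasWeakDiv.sub (hF.Y2ΓInv_spec hW.symL2).1
    (hF.Y2ΓInv_spec (hF.symL2_correction hW.bddMeas)).1 hvT hT h1
    (hF.hasWeakDiv_correction hW.bddMeas)
  rwa [add_sub_cancel_right] at this

end IsParametrization

/-! ### Discrete spaces -/

theorem bddMeas_tensorSpline {q₁ q₂ : ℕ} {L₁ L₂ : List ℝ} {f : Pt → ℝ}
    (hf : f ∈ tensorSpline q₁ q₂ L₁ L₂) : BddMeas f := by
  obtain ⟨C, hC⟩ := exists_abs_tensorSpline_le hf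
  exact ⟨(measurable_tensorSpline hf).aestronglyMeasurable, C, fun ζ hζ =>
    hC ζ ⟨(hζ 0).1.le, (hζ 0).2.le⟩ ⟨(hζ 1).1.le, (hζ 1).2.le⟩⟩

theorem bddMeas_tensorSpline_trace {q₁ q₂ : ℕ} {L₁ L₂ : List ℝ} {f : Pt → ℝ}
    (hf : f ∈ tensorSpline q₁ q₂ L₁ L₂) : BddMeas fun ζ => f ![0, ζ 1] := by
  obtain ⟨C, hC⟩ := exists_abs_tensorSpline_le hf
  exact ⟨((measurable_tensorSpline hf).comp (by fun_prop)).aestronglyMeasurable, C, fun ζ hζ =>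
    hC _ (by simp) ⟨(hζ 1).1.le, (hζ 1).2.le⟩⟩

theorem mem_Ico_of_mem {ζ : Pt} (hζ : ζ ∈ paramDomain) (k : Fin 2) : ζ k ∈ Ico (0 : ℝ) 1 :=
  ⟨(hζ k).1.le, (hζ k).2⟩

theorem symL2_of_splines {q₁ q₂ q₃ q₄ q₅ q₆ : ℕ} {L₁ L₂ : List ℝ} {s₁ s₂ s₃ : Pt → ℝ}
    (h₁ : s₁ ∈ tensorSpline q₁ q₂ L₁ L₂) (h₂ : s₂ ∈ tensorSpline q₃ q₄ L₁ L₂)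
    (h₃ : s₃ ∈ tensorSpline q₅ q₆ L₁ L₂) : SymL2 fun ζ => !![s₁ ζ, s₂ ζ; s₂ ζ, s₃ ζ] := by
  refine ⟨fun i j => ?_, .of_forall fun ζ => ?_⟩
  · fin_cases i <;> fin_cases j
    · exact (bddMeas_tensorSpline h₁).memLp
    · exact (bddMeas_tensorSpline h₂).memLp
    · exact (bddMeas_tensorSpline h₂).memLp
    · exact (bddMeas_tensorSpline h₃).memLp
  · ext i j; fin_cases i <;> fin_cases j <;> rfl

theorem vecL2_of_splines {q₁ q₂ q₃ q₄ : ℕ} {L₁ L₂ : List ℝ} {s₁ s₂ : Pt → ℝ}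
    (h₁ : s₁ ∈ tensorSpline q₁ q₂ L₁ L₂) (h₂ : s₂ ∈ tensorSpline q₃ q₄ L₁ L₂) :
    VecL2 fun ζ => ![s₁ ζ, s₂ ζ] := by
  intro i; fin_cases i
  · exact (bddMeas_tensorSpline h₁).memLp
  · exact (bddMeas_tensorSpline h₂).memLp

theorem vecL2_of_mem_paramDisp {p m : ℕ} {K₁ K₂ : InteriorKnots m} {w : Pt → Fin 2 → ℝ}
    (hw : w ∈ paramDisp p K₁ K₂) : VecL2 w := by
  obtain ⟨s₁, h₁, s₂, h₂, rfl⟩ := hw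
  exact vecL2_of_splines h₁ h₂

/-- The degrees match: ∂₁s₁ and ∂₂s₂ have bidegree (p, p-1), ∂₁s₂ and ∂₂s₃ have bidegree (p-1, p).
Degrees are written with p = q + 1 so that p - 1 is a genuine predecessor. -/
theorem exists_isPrimitive_of_mem_paramStress {q m : ℕ} (hm : m ≤ q + 1) {K₁ K₂ : InteriorKnots m}
    {W : Pt → Mat} (hW : W ∈ paramStress (q + 1) K₁ K₂) :
    ∃ a b, IsPrimitive W a b ∧ (fun ζ => a ζ + b ζ) ∈ paramDisp (q + 1) K₁ K₂ := by
  obtain ⟨s₁, h₁, s₂, h₂, s₃, h₃, rfl⟩ := hW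
  obtain ⟨a₁, ha₁, ea₁⟩ := exists_tensorSpline_deriv1 (by omega) h₁
  obtain ⟨a₂, ha₂, ea₂⟩ := exists_tensorSpline_deriv1 hm h₂
  obtain ⟨b₁, hb₁, eb₁⟩ := exists_tensorSpline_deriv2 hm h₂
  obtain ⟨b₂, hb₂, eb₂⟩ := exists_tensorSpline_deriv2 (by omega) h₃
  refine ⟨fun ζ => ![a₁ ζ, a₂ ζ], fun ζ => ![b₁ ζ, b₂ ζ],
    ⟨symL2_of_splines h₁ h₂ h₃, fun i => ?_, vecL2_of_splines ha₁ ha₂, vecL2_of_splines hb₁ hb₂,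
      fun ζ hζ i => ?_, fun ζ hζ i => ?_⟩,
    ⟨a₁ + b₁, Submodule.add_mem _ ha₁ hb₁, a₂ + b₂, Submodule.add_mem _ ha₂ hb₂, ?_⟩⟩
  · fin_cases i
    · exact bddMeas_tensorSpline_trace h₁
    · exact bddMeas_tensorSpline_trace h₂
  · fin_cases i
    · exact ea₁ ζ (mem_Ico_of_mem hζ 0)
    · exact ea₂ ζ (mem_Ico_of_mem hζ 0)
  · fin_cases i
    · exact eb₁ ζ (mem_Ico_of_mem hζ 1)
    · exact eb₂ ζ (mem_Ico_of_mem hζ 1)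
  · funext ζ i; fin_cases i <;> simp

/-- Every discrete displacement is the divergence of a discrete stress with vanishing trace. -/
theorem exists_paramStress_of_mem_paramDisp {q m : ℕ} (hm : m ≤ q + 1) {K₁ K₂ : InteriorKnots m}
    {w : Pt → Fin 2 → ℝ} (hw : w ∈ paramDisp (q + 1) K₁ K₂) :
    ∃ W ∈ paramStress (q + 1) K₁ K₂, ∃ a b, IsPrimitive W a b ∧ (fun ζ => a ζ + b ζ) = w ∧
      (∀ t i, W ![0, t] i 0 = 0) ∧ ∀ ζ ∈ paramDomain,
        W ζ = !![int1 (fun ξ => w ξ 0) ζ, 0; 0, int2 (fun ξ => w ξ 1) ζ] := by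
  obtain ⟨w₁, h₁, w₂, h₂, rfl⟩ := hw
  obtain ⟨s₁, hs₁, e₁⟩ := exists_tensorSpline_eq_int1 (by omega) h₁
  obtain ⟨s₃, hs₃, e₃⟩ := exists_tensorSpline_eq_int2 (by omega) h₂
  have h0 : (0 : Pt → ℝ) ∈ tensorSpline (q + 1) (q + 1) K₁.knots K₂.knots := Submodule.zero_mem _
  have z₁ : ∀ t, s₁ ![0, t] = 0 := fun t => by
    rw [e₁ _ (by simp)]; exact intervalIntegral.integral_same
  have z₃ : ∀ s, s₃ ![s, 0] = 0 := fun s => by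
    rw [e₃ _ (by simp)]; exact intervalIntegral.integral_same
  have ht : ∀ t i, (!![s₁ ![0, t], (0 : Pt → ℝ) ![0, t]; (0 : Pt → ℝ) ![0, t], s₃ ![0, t]] : Mat)
      i 0 = 0 := fun t i => by fin_cases i <;> simp [z₁]
  refine ⟨_, ⟨s₁, hs₁, 0, h0, s₃, hs₃, rfl⟩, fun ζ => ![w₁ ζ, 0], fun ζ => ![0, w₂ ζ],
    ⟨symL2_of_splines hs₁ h0 hs₃, fun i => ?_, ?_, ?_, fun ζ hζ i => ?_, fun ζ hζ i => ?_⟩,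
    ?_, ht, fun ζ hζ => ?_⟩
  · fin_cases i
    · exact bddMeas_tensorSpline_trace hs₁
    · exact bddMeas_tensorSpline_trace h0
  · exact vecL2_of_splines h₁ h0
  · exact vecL2_of_splines h0 h₂
  · fin_cases i
    · simpa [z₁] using e₁ ζ (mem_Ico_of_mem hζ 0)
    · simp [int1]
  · fin_cases i
    · simp [int2]
    · simpa [z₃] using e₃ ζ (mem_Ico_of_mem hζ 1)
  · funext ζ i; fin_cases i <;> simp
  · have f₁ := e₁ ζ (mem_Ico_of_mem hζ 0)
    have f₃ := e₃ ζ (mem_Ico_of_mem hζ 1)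
    ext i j
    fin_cases i <;> fin_cases j
    · exact f₁
    · rfl
    · rfl
    · exact f₃

end Estimates

/-! ### Compliance form and stability of the discrete right inverse. -/

section Stability

open Set MeasureTheory Filter

theorem weakDiv_spec {D : Set Pt} {τ : Pt → Mat} (h : ∃ d, MemL2 D d ∧ HasWeakDiv D τ d) :
    MemL2 D (weakDiv D τ) ∧ HasWeakDiv D τ (weakDiv D τ) := by
  rw [weakDiv, dif_pos h]
  exact h.choose_spec

theorem weakDiv_ae_eq {D : Set Pt} (hD : IsOpen D) {τ : Pt → Mat} {d : Pt → Fin 2 → ℝ}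
    (hd : MemL2 D d) (h : HasWeakDiv D τ d) : weakDiv D τ =ᵐ[volume.restrict D] d := by
  obtain ⟨h1, h2⟩ := weakDiv_spec ⟨d, hd, h⟩
  exact HasWeakDiv.unique hD h1 hd h2 h

theorem innerVec_congr {D : Set Pt} {u u' v v' : Pt → Fin 2 → ℝ}
    (hu : u =ᵐ[volume.restrict D] u') (hv : v =ᵐ[volume.restrict D] v') :
    innerVec D u v = innerVec D u' v' :=
  integral_congr_ae (by filter_upwards [hu, hv] with x h1 h2 using by rw [h1, h2])

theorem innerVec_self_nonneg (D : Set Pt) (v : Pt → Fin 2 → ℝ) : 0 ≤ innerVec D v v :=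
  integral_nonneg fun _ => Finset.sum_nonneg fun _ _ => mul_self_nonneg _

theorem innerMat_self_nonneg (D : Set Pt) (τ : Pt → Mat) : 0 ≤ innerMat D τ τ :=
  integral_nonneg fun _ => Finset.sum_nonneg fun _ _ => Finset.sum_nonneg fun _ _ =>
    mul_self_nonneg _

theorem innerVec_self_pos {D : Set Pt} {v : Pt → Fin 2 → ℝ} (hv : MemL2 D v)
    (h : ¬ v =ᵐ[volume.restrict D] 0) : 0 < innerVec D v v := by
  refine lt_of_le_of_ne (innerVec_self_nonneg D v) fun h0 => h ?_
  have hi : Integrable (fun x => ∑ i, v x i * v x i) (volume.restrict D) :=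
    integrable_finsetSum _ fun i _ => (hv i).integrable_mul (hv i)
  have := (integral_eq_zero_iff_of_nonneg
    (fun _ => Finset.sum_nonneg fun _ _ => mul_self_nonneg _) hi).1 h0.symm
  filter_upwards [this] with x hx
  have h1 := (Finset.sum_eq_zero_iff_of_nonneg fun i _ => mul_self_nonneg (v x i)).1 hx
  funext i
  exact mul_self_eq_zero.1 (h1 i (Finset.mem_univ i))

theorem symm_decomposition {M : Mat} (hM : M.IsSymm) :
    M = M 0 0 • !![1, 0; 0, 0] + M 0 1 • !![0, 1; 1, 0] + M 1 1 • !![0, 0; 0, 1] := by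
  have := hM.apply 0 1
  ext i j
  fin_cases i <;> fin_cases j <;> simp [this]

/-- Measurability of A is given on constant matrices only; expanding τ in a basis of the symmetric
matrices extends it to fields. -/
theorem memLp_compliance {D : Set Pt} {A : Pt → Mat →ₗ[ℝ] Mat} (hA : IsCompliance D A)
    {τ : Pt → Mat} (hτ : MemL2Sym D τ) (i j : Fin 2) :
    MemLp (fun x => A x (τ x) i j) 2 (volume.restrict D) := by
  obtain ⟨C, hC⟩ := hA.bounded
  have hm : AEStronglyMeasurable (fun x => A x (τ x) i j) (volume.restrict D) := by
    have h1 := hA.measurable !![1, 0; 0, 0] (by ext i j; fin_cases i <;> fin_cases j <;> rfl) i j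
    have h2 := hA.measurable !![0, 1; 1, 0] (by ext i j; fin_cases i <;> fin_cases j <;> rfl) i j
    have h3 := hA.measurable !![0, 0; 0, 1] (by ext i j; fin_cases i <;> fin_cases j <;> rfl) i j
    refine ((((hτ.1 0 0).1.mul h1).add ((hτ.1 0 1).1.mul h2)).add ((hτ.1 1 1).1.mul h3)).congr ?_
    filter_upwards [hτ.2] with x hx
    conv_rhs => rw [symm_decomposition hx]
    simp only [map_add, map_smul, Matrix.add_apply, Matrix.smul_apply, smul_eq_mul,
      Pi.add_apply, Pi.mul_apply]
  refine (memLp_two_iff_integrable_sq hm).2 ?_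
  have hi : Integrable (fun x => C * ∑ i, ∑ j, τ x i j ^ 2) (volume.restrict D) :=
    (integrable_finsetSum _ fun i _ => integrable_finsetSum _ fun j _ =>
      (hτ.1 i j).integrable_sq).const_mul C
  refine hi.mono' (hm.pow 2) ?_
  filter_upwards [hC, hτ.2] with x h1 h2
  rw [Real.norm_of_nonneg (sq_nonneg _)]
  refine le_trans ?_ (h1 _ h2)
  refine (Finset.single_le_sum (f := fun j => A x (τ x) i j ^ 2) (fun _ _ => sq_nonneg _)
    (Finset.mem_univ j)).trans ?_
  exact Finset.single_le_sum (f := fun i => ∑ j, A x (τ x) i j ^ 2)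
    (fun _ _ => Finset.sum_nonneg fun _ _ => sq_nonneg _) (Finset.mem_univ i)

theorem le_formA {D : Set Pt} {A : Pt → Mat →ₗ[ℝ] Mat} (hA : IsCompliance D A) {α : ℝ}
    (hα : ∀ᵐ x ∂(volume.restrict D), ∀ M : Mat, M.IsSymm →
      α * ∑ i, ∑ j, M i j ^ 2 ≤ ∑ i, ∑ j, A x M i j * M i j) {τ : Pt → Mat}
    (hτ : MemL2Sym D τ) : α * innerMat D τ τ ≤ formA D A τ τ := by
  rw [formA, innerMat, innerMat, ← integral_const_mul]
  refine integral_mono_ae ?_ ?_ ?_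
  · exact (integrable_finsetSum _ fun i _ => integrable_finsetSum _ fun j _ =>
      (hτ.1 i j).integrable_mul (hτ.1 i j)).const_mul α
  · exact integrable_finsetSum _ fun i _ => integrable_finsetSum _ fun j _ =>
      (memLp_compliance hA hτ i j).integrable_mul (hτ.1 i j)
  · filter_upwards [hα, hτ.2] with x h1 h2
    have h3 := h1 _ h2
    simp only [pow_two] at h3
    exact h3

namespace IsParametrization

variable {F G : Pt → Pt} (hF : IsParametrization F G)
include hF

/-- The `L²` stability of the right inverse of the divergence. -/
theorem exists_innerMat_le :
    ∃ C : ℝ, 0 ≤ C ∧ ∀ (W : Pt → Mat) (a b v : Pt → Fin 2 → ℝ), IsPrimitive W a b →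
      MemL2 (physDomain F) v → VecL2 (fun ζ => a ζ + b ζ) →
      Y3 F v =ᵐ[sq] (fun ζ => a ζ + b ζ) → (∀ t i, W ![0, t] i 0 = 0) →
      (∀ ζ ∈ paramDomain, W ζ = !![int1 (fun ξ => a ξ 0 + b ξ 0) ζ, 0; 0,
        int2 (fun ξ => a ξ 1 + b ξ 1) ζ]) →
      innerMat (physDomain F) (Y2Tilde F G W) (Y2Tilde F G W) ≤
        C * innerVec (physDomain F) v v := by
  obtain ⟨A, hA, hS⟩ := hF.exists_integral_Y2ΓInv_le
  obtain ⟨B, hB, hL⟩ := exists_energy_primOp_le hF.matCoef_adjJac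
  obtain ⟨E, hE⟩ := hF.isCoef_det.bddMeas.2
  have hE0 : 0 ≤ E := by
    obtain ⟨ζ, hζ⟩ := nonempty_paramDomain
    exact (abs_nonneg _).trans (hE ζ hζ)
  -- Outer E: passage from Ω to the square; 2: squared triangle inequality; A: inverse stress
  -- transform; B: displacement transform; inner E: from det(J) v∘F back to v on Ω.
  refine ⟨E * (2 * (A * (B * E))), by positivity, fun W a b v hW hv hw hY h0 hWw => ?_⟩
  have hD := hF.symL2_correction hW.bddMeas
  -- With zero trace at ζ₁ = 0 the field T(W) vanishes, hence so does the correction.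
  have hc0 : ∀ ζ ∈ paramDomain, correction F G W ζ = 0 := by
    have hy : ∀ ζ ∈ paramDomain, Y3 F (T F G W) ζ = 0 := fun ζ hζ => by
      rw [Y3_eq, primOp_congr_on (h := 0) _ (fun ξ hξ => ?_) hζ]
      · have : int1v 0 ζ = 0 := funext fun i => intervalIntegral.integral_zero
        rw [primOp, this]; simp
      · rw [hF.det_smul_T W hξ]
        simp only [h0]
        exact Matrix.mulVec_zero _
    intro ζ hζ
    have e1 : int1 (fun ξ => Y3 F (T F G W) ξ 0) ζ = 0 :=
      (int1_congr_on (g := fun _ => 0) (fun ξ hξ => congrFun (hy ξ hξ) 0) hζ).trans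
        intervalIntegral.integral_zero
    have e2 : int2 (fun ξ => Y3 F (T F G W) ξ 1) ζ = 0 :=
      (int2_congr_on (g := fun _ => 0) (fun ξ hξ => congrFun (hy ξ hξ) 1) hζ).trans
        intervalIntegral.integral_zero
    rw [correction, e1, e2]
    ext i j; fin_cases i <;> fin_cases j <;> rfl
  have hDe : ∀ j, energy (colField j (correction F G W)) = 0 := fun j => by
    have : energy (colField j (correction F G W)) = energy 0 := energy_congr (by
      filter_upwards [ae_mem_paramDomain] with ζ hζ
      funext i; rw [colField, hc0 ζ hζ]; rfl)
    rw [this]; simp [energy, nsq]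
  have iW := hF.integrable_frobSq (hF.Y2ΓInv_spec hW.symL2).1.1
  have iD := hF.integrable_frobSq (hF.Y2ΓInv_spec hD).1.1
  have hWe : energy (colField 0 W) + energy (colField 1 W) ≤ energy fun ζ => a ζ + b ζ := by
    have e0 : energy (colField 0 W) = ∫ ζ, int1 (fun ξ => a ξ 0 + b ξ 0) ζ ^ 2 ∂sq :=
      integral_congr_ae (by
        filter_upwards [ae_mem_paramDomain] with ζ hζ
        simp [nsq, colField, hWw ζ hζ])
    have e1 : energy (colField 1 W) = ∫ ζ, int2 (fun ξ => a ξ 1 + b ξ 1) ζ ^ 2 ∂sq :=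
      integral_congr_ae (by
        filter_upwards [ae_mem_paramDomain] with ζ hζ
        simp [nsq, colField, hWw ζ hζ])
    have e2 : energy (fun ζ => a ζ + b ζ) = _ :=
      integral_add (hw 0).integrable_sq (hw 1).integrable_sq
    rw [e0, e1, e2]
    exact add_le_add (integral_int1_sq_le (hw 0)) (integral_int2_sq_le (hw 1))
  have hve : energy (fun ξ => (jac F ξ).det • v (F ξ)) ≤ E * innerVec (physDomain F) v v := by
    rw [energy, innerVec, hF.integral_physDomain, ← integral_const_mul]
    refine integral_mono_of_nonneg (.of_forall fun _ => nsq_nonneg _) ?_ ?_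
    · have h1 := fun i => (hF.vecL2_smul_comp hv i).integrable_mul (hF.memLp_comp (hv i))
      have h2 : ∀ i, Integrable (fun ζ => |(jac F ζ).det| * (v (F ζ) i * v (F ζ) i)) sq :=
        fun i => (h1 i).abs.congr (.of_forall fun ζ => by
          simp only [Pi.mul_apply, Pi.smul_apply, smul_eq_mul, abs_mul, mul_assoc, abs_mul_abs_self])
      simp only [Fin.sum_univ_two, mul_add]
      exact ((h2 0).const_mul E).add ((h2 1).const_mul E)
    · filter_upwards [ae_mem_paramDomain] with ζ hζ
      have h1 := hE ζ hζ
      have h2 : nsq ((jac F ζ).det • v (F ζ)) = |(jac F ζ).det| * (|(jac F ζ).det| *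
          ∑ i, v (F ζ) i * v (F ζ) i) := by
        rw [← mul_assoc, abs_mul_abs_self, Fin.sum_univ_two]
        simp only [nsq, Pi.smul_apply, smul_eq_mul]
        ring
      rw [h2]
      exact mul_le_mul_of_nonneg_right h1 (mul_nonneg (abs_nonneg _)
        (Finset.sum_nonneg fun _ _ => mul_self_nonneg _))
  have hwe : energy (fun ζ => a ζ + b ζ) ≤ B * (E * innerVec (physDomain F) v v) := by
    rw [← energy_congr hY, Y3_eq]
    exact (hL _ (hF.vecL2_smul_comp hv)).trans (mul_le_mul_of_nonneg_left hve hB)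
  have hτ : ∫ ζ, frobSq (Y2Tilde F G W (F ζ)) ∂sq ≤
      2 * ∫ ζ, frobSq (Y2ΓInv F W (F ζ)) ∂sq +
        2 * ∫ ζ, frobSq (Y2ΓInv F (correction F G W) (F ζ)) ∂sq := by
    rw [← integral_const_mul, ← integral_const_mul,
      ← integral_add (iW.const_mul 2) (iD.const_mul 2)]
    exact integral_mono_of_nonneg (.of_forall fun _ => frobSq_nonneg _)
      ((iW.const_mul 2).add (iD.const_mul 2)) (.of_forall fun ζ => frobSq_sub_le _ _)
  have h1 := hS W hW.symL2
  have h2 := hS _ hD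
  -- The chosen preimage of the zero correction need not vanish pointwise; the bound for the inverse
  -- transform makes its L² norm zero.
  rw [hDe, hDe, add_zero, mul_zero] at h2
  have iτ := hF.integrable_frobSq (hF.memL2Sym_Y2Tilde hW).1
  have h3 : innerMat (physDomain F) (Y2Tilde F G W) (Y2Tilde F G W) ≤
      E * ∫ ζ, frobSq (Y2Tilde F G W (F ζ)) ∂sq := by
    rw [hF.innerMat_eq, ← integral_const_mul]
    refine integral_mono_of_nonneg
      (.of_forall fun _ => mul_nonneg (abs_nonneg _) (frobSq_nonneg _)) (iτ.const_mul E) ?_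
    filter_upwards [ae_mem_paramDomain] with ζ hζ
    exact mul_le_mul_of_nonneg_right (hE ζ hζ) (frobSq_nonneg _)
  rw [mul_assoc, mul_assoc, mul_assoc, mul_assoc]
  refine h3.trans (mul_le_mul_of_nonneg_left ?_ hE0)
  have h4 := mul_le_mul_of_nonneg_left (hWe.trans hwe) hA
  linarith

end IsParametrization

/-- The inf-sup quotient of a pair with ∇·τ = v, for N = ‖v‖² and X = ‖τ‖². -/
theorem inv_sqrt_le_div {C N X : ℝ} (hC : 0 ≤ C) (hN : 0 < N) (hX0 : 0 ≤ X) (hX : X ≤ C * N) :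
    (Real.sqrt (C + 1))⁻¹ ≤ N / (Real.sqrt (X + N) * Real.sqrt N) := by
  have h1 : 0 < Real.sqrt (X + N) * Real.sqrt N :=
    mul_pos (Real.sqrt_pos.2 (by linarith)) (Real.sqrt_pos.2 hN)
  have h2 : 0 < Real.sqrt (C + 1) := Real.sqrt_pos.2 (by linarith)
  rw [le_div_iff₀ h1, inv_mul_le_iff₀ h2]
  have h3 : Real.sqrt (X + N) ≤ Real.sqrt (C + 1) * Real.sqrt N := by
    rw [← Real.sqrt_mul (by linarith)]
    exact Real.sqrt_le_sqrt (by linarith)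
  calc Real.sqrt (X + N) * Real.sqrt N
      ≤ Real.sqrt (C + 1) * Real.sqrt N * Real.sqrt N :=
        mul_le_mul_of_nonneg_right h3 (Real.sqrt_nonneg _)
    _ = Real.sqrt (C + 1) * N := by rw [mul_assoc, Real.mul_self_sqrt hN.le]

end Stability

end StrongSym

/-! ### The stability theorem. -/

open StrongSym

theorem mainTheorem5 (p r : ℕ) (hr : 1 ≤ r) (hrp : r < p)
    (F G : Pt → Pt) (hF : IsParametrization F G) :
    ∃ γ₁ : ℝ, 0 < γ₁ ∧
      ∀ A : Pt → Mat →ₗ[ℝ] Mat, IsCompliance (physDomain F) A →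
        ∃ γ₂ : ℝ, 0 < γ₂ ∧
          ∀ K₁ K₂ : InteriorKnots (p - r),
            -- the discrete spaces are conforming
            (∀ τ ∈ stressSpace F G p K₁ K₂, MemHdivSym (physDomain F) τ) ∧
            (∀ v ∈ dispSpace F p K₁ K₂, MemL2 (physDomain F) v) ∧
            -- the discrete inf-sup condition
            (γ₁ : EReal) ≤
              ⨅ v ∈ {v | v ∈ dispSpace F p K₁ K₂ ∧
                  ¬ v =ᵐ[MeasureTheory.volume.restrict (physDomain F)] 0},
                ⨆ τ ∈ stressSpace F G p K₁ K₂,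
                  ((formB (physDomain F) τ v /
                    (normHdiv (physDomain F) τ * normL2 (physDomain F) v) : ℝ) : EReal) ∧
            -- coercivity on the discrete kernel
            (∀ τ ∈ discreteKernel F G p K₁ K₂,
              γ₂ * normHdiv (physDomain F) τ ^ 2 ≤ formA (physDomain F) A τ τ) := by
  obtain ⟨q, rfl⟩ : ∃ q, p = q + 1 := ⟨p - 1, by omega⟩
  have hm : q + 1 - r ≤ q + 1 := Nat.sub_le _ _
  have hO := hF.isOpen_physDomain
  obtain ⟨C, hC, hstab⟩ := hF.exists_innerMat_le
  refine ⟨(Real.sqrt (C + 1))⁻¹, by positivity, fun A hA => ?_⟩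
  obtain ⟨α, hα0, hα⟩ := hA.posDef
  refine ⟨α, hα0, fun K₁ K₂ => ⟨?_, ?_, ?_, ?_⟩⟩
  · rintro _ ⟨W, hW, rfl⟩
    obtain ⟨a, b, hp, hab⟩ := exists_isPrimitive_of_mem_paramStress hm hW
    exact ⟨hF.memL2Sym_Y2Tilde hp, _, (hF.Y3Inv_spec (vecL2_of_mem_paramDisp hab)).1,
      hF.hasWeakDiv_Y2Tilde hp⟩
  · rintro _ ⟨w, hw, rfl⟩
    exact (hF.Y3Inv_spec (vecL2_of_mem_paramDisp hw)).1
  · refine le_iInf₂ ?_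
    rintro _ ⟨⟨w, hw, rfl⟩, hv0⟩
    have hwL := vecL2_of_mem_paramDisp hw
    obtain ⟨hv, hY⟩ := hF.Y3Inv_spec hwL
    obtain ⟨W, hW, a, b, hp, rfl, h0, hWw⟩ := exists_paramStress_of_mem_paramDisp hm hw
    have hdiv := weakDiv_ae_eq hO hv (hF.hasWeakDiv_Y2Tilde hp)
    have hX := hstab W a b _ hp hv hwL hY h0 hWw
    -- The supremum is tested with the stable right inverse of the divergence at v.
    refine le_iSup₂_of_le (Y2Tilde F G W) ⟨W, hW, rfl⟩ (EReal.coe_le_coe_iff.2 ?_)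
    rw [formB, normHdiv, normL2, innerVec_congr hdiv Filter.EventuallyEq.rfl,
      innerVec_congr hdiv hdiv]
    exact inv_sqrt_le_div hC (innerVec_self_pos hv hv0) (innerMat_self_nonneg _ _) hX
  · rintro _ ⟨⟨W, hW, rfl⟩, hker⟩
    obtain ⟨a, b, hp, hab⟩ := exists_isPrimitive_of_mem_paramStress hm hW
    have hv := (hF.Y3Inv_spec (vecL2_of_mem_paramDisp hab)).1
    have hdiv := weakDiv_ae_eq hO hv (hF.hasWeakDiv_Y2Tilde hp)
    -- The divergence of τ lies in the discrete displacement space up to null sets; testing with it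
    -- gives ‖∇·τ‖² = 0.
    have h0 := hker _ ⟨_, hab, rfl⟩
    rw [formB, ← innerVec_congr Filter.EventuallyEq.rfl hdiv] at h0
    rw [normHdiv, h0, add_zero, Real.sq_sqrt (innerMat_self_nonneg _ _)]
    exact le_formA hA hα (hF.memL2Sym_Y2Tilde hp)
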